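/- Let $\mathcal N=(P,T,\mathrm{Pre},\mathrm{Post})$ be a Petri net: $P,T$ finite, $\mathrm{Pre},\mathrm{Post}\in\mathbb N^{P\times T}$, incidence matrix $C=\mathrm{Post}-\mathrm{Pre}$, reverse net $\mathcal N^{-1}=(P,T,\mathrm{Post},\mathrm{Pre})$, and ${}^\bullet t=\{p:\mathrm{Pre}(p,t)>0\}$, ${}^\bullet p=\{t:\mathrm{Post}(p,t)>0\}$. In the continuous semantics markings are vectors in $\mathbb Q_{\ge0}^P$; the enabling degree of $t$ at $m$ is $\mathrm{enab}(t,m)=\min\{m(p)/\mathrm{Pre}(p,t):p\in{}^\bullet t\}$ ($\infty$ if ${}^\bullet t=\emptyset$); if it is positive, $t$ may be fired by any amount $q\in\mathbb Q_{\ge0}$ with $q\le\mathrm{enab}(t,m)$, leading to the marking $m'$ with $m'(p)=m(p)+q\,C(p,t)$ for all $p$. A marking is $\mathbb Q$-reachable from $m_0$ if a finite sequence of such firings leads from $m_0$ to it. The Parikh image of a sequence gives for each $t$ the total amount by which $t$ is fired, and the firing set $\mathrm{fs}(\mathcal N,m)$ is the set of supports of the Parikh images of the sequences that can be fired from $m$.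 Let $\Phi(w,x)$ be the following formula of the first-order theory of $(\mathbb Q_{\ge0},+,>)$, with free variables $w(p),x(p)$ for $p\in P$: $$\Phi(w,x)=\exists y\in\mathbb Q_{\ge0}^T:\ \Phi_{\mathrm{eqn}}^{\mathcal N}(w,x,y)\wedge\Phi_{\mathrm{fs}}^{\mathcal N}(w,y)\wedge\Phi_{\mathrm{fs}}^{\mathcal N^{-1}}(x,y),$$ where $\Phi_{\mathrm{eqn}}^{\mathcal N}(w,x,y)$ is the state equation $x=C\cdot y+w$, written without subtraction, and with auxiliary existentially quantified variables by which the multiples $a\cdot y(t)$, for coefficients $a\in\mathbb N$ in binary, are expressed through repeated doubling; and where $$\Phi_{\mathrm{fs}}^{\mathcal N}(w,y)=\exists z\in\mathbb Q_{\ge0}^{P\cup T}:\ \bigwedge_{t\in T}\Bigl(y(t)>0\to\bigwedge_{p\in{}^\bullet t}0<z(p)\le z(t)\Bigr)\wedge\bigwedge_{p\in P}\Bigl(z(p)>0\to\bigl(w(p)>0\vee\bigvee_{t\in{}^\bullet p}(y(t)>0\wedge z(t)<z(p))\bigr)\Bigr).$$ Then: 1. $\Phi$ is an existential $\mathrm{FO}(\mathbb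 Q_{\ge0},+,>)$-formula (built from quantifier-free formulas by conjunction, disjunction and existential quantification), and for all markings $m_0,m\in\mathbb Q_{\ge0}^P$ (in particular for every Petri net system $(\mathcal N,m_0)$ with $m_0\in\mathbb N^P$), $m$ is $\mathbb Q$-reachable from $m_0$ if and only if $\Phi(m_0,m)$ holds. 2. For all $w,x\in\mathbb Q_{\ge0}^P$ and $y\in\mathbb Q_{\ge0}^T$: $\Phi_{\mathrm{eqn}}^{\mathcal N}(w,x,y)$ holds iff $x=C\cdot y+w$; $\Phi_{\mathrm{fs}}^{\mathcal N}(w,y)$ holds iff the support of $y$ belongs to $\mathrm{fs}(\mathcal N,w)$; and $\Phi_{\mathrm{fs}}^{\mathcal N^{-1}}(x,y)$ holds iff the support of $y$ belongs to $\mathrm{fs}(\mathcal N^{-1},x)$. 3. The size of $\Phi$ (number of symbols, where a variable counts as a constant number of symbols) is linear in the size of $\mathcal N$, that is, in $|P|+|T|$ plus the number of binary digits of all non-zero entries of $\mathrm{Pre}$ and $\mathrm{Post}$. 4. $\Phi$ is computable in linear time: there is one random access machine (unit-cost addition, subtraction and memory access, on words whose values are bounded by a constant times the input length plus one) that on input the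 matrices $\mathrm{Pre},\mathrm{Post}$, with entries in binary, writes $\Phi$ in a number of steps linear in the length of the input, where $|P|$ and $|T|$ are counted in unary. -/

import Mathlib

open FirstOrder

open scoped NNRat

/-! ### Petri nets and their continuous semantics -/

/-- A Petri net with places `P` and transitions `T`, given by its backward and forward incidence
matrices. -/
structure PetriNet (P T : Type) where
  pre : P → T → ℕ
  post : P → T → ℕ

namespace PetriNet

variable {P T : Type}

/-- The incidence matrix. -/
def incidence (N : PetriNet P T) (p : P) (t : T) : ℤ := (N.post p t : ℤ) - (N.pre p t : ℤ)

/-- The reverse net. -/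
def reverse (N : PetriNet P T) : PetriNet P T where
  pre := N.post
  post := N.pre

/-- The enabling degree of `t` at `m`: the minimum of `m p / pre p t` over the input places `p`
of `t`, which is `⊤` (infinity) if there are none. -/
def enablingDegree [Fintype P] (N : PetriNet P T) (t : T) (m : P → ℚ≥0) : WithTop ℚ≥0 :=
  (Finset.univ.filter fun p => 0 < N.pre p t).inf
    fun p => ((m p / (N.pre p t : ℚ≥0) : ℚ≥0) : WithTop ℚ≥0)

/-- `t` is enabled at `m` and firing it by the amount `q` leads to `m'`. -/
def Fires [Fintype P] (N : PetriNet P T) (q : ℚ≥0) (t : T) (m m' : P → ℚ≥0) : Prop :=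
  0 < N.enablingDegree t m ∧ (q : WithTop ℚ≥0) ≤ N.enablingDegree t m ∧
    ∀ p, (m' p : ℚ) = (m p : ℚ) + (q : ℚ) * (N.incidence p t : ℚ)

/-- `N.FiresSeq σ m m'`: the sequence `σ` can be fired from `m` and leads to `m'`. -/
inductive FiresSeq [Fintype P] (N : PetriNet P T) :
    List (ℚ≥0 × T) → (P → ℚ≥0) → (P → ℚ≥0) → Prop
  | nil (m : P → ℚ≥0) : FiresSeq N [] m m
  | cons {q : ℚ≥0} {t : T} {σ : List (ℚ≥0 × T)} {m m' m'' : P → ℚ≥0} :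
      N.Fires q t m m' → FiresSeq N σ m' m'' → FiresSeq N ((q, t) :: σ) m m''

/-- Reachability in the continuous semantics. -/
def QReachable [Fintype P] (N : PetriNet P T) (m₀ m : P → ℚ≥0) : Prop :=
  ∃ σ : List (ℚ≥0 × T), N.FiresSeq σ m₀ m

/-- The Parikh image of a sequence. -/
def parikh [DecidableEq T] (σ : List (ℚ≥0 × T)) (t : T) : ℚ≥0 :=
  ((σ.filter fun a => a.2 = t).map Prod.fst).sum

/-- The firing set: the supports of the Parikh images of the sequences that can be fired
from `m`. -/
def firingSet [Fintype P] [DecidableEq T] (N : PetriNet P T) (m : P → ℚ≥0) : Set (Set T) :=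
  {S | ∃ (σ : List (ℚ≥0 × T)) (m' : P → ℚ≥0),
    N.FiresSeq σ m m' ∧ Function.support (parikh σ) = S}

/-- The size of a net: number of places, plus number of transitions, plus number of binary
digits of all arc weights (`Nat.size 0 = 0`, so absent arcs do not count). -/
def size {np nt : ℕ} (N : PetriNet (Fin np) (Fin nt)) : ℕ :=
  np + nt + ∑ p, ∑ t, ((N.pre p t).size + (N.post p t).size)

/-- A number as a list of words: the number of its binary digits, then its digits, least
significant first. -/
def natCode (a : ℕ) : List ℕ := a.size :: a.bits.map Bool.toNat

/-- A net as a list of words: the number of places, the number of transitions, and for each place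
and each transition the two entries of the incidence matrices, in binary. -/
def code {np nt : ℕ} (N : PetriNet (Fin np) (Fin nt)) : List ℕ :=
  np :: nt :: (List.finRange np).flatMap fun p =>
    (List.finRange nt).flatMap fun t => natCode (N.pre p t) ++ natCode (N.post p t)

/-- The length of the input that describes a net: the length of `N.code`, where the numbers of
places and of transitions are counted in unary. -/
def inputLength {np nt : ℕ} (N : PetriNet (Fin np) (Fin nt)) : ℕ := np + nt + N.code.length

end PetriNet

/-! ### The first-order language of addition and order on the non-negative rationals -/

namespace AddGt

/-- The only function symbol: binary addition. -/
inductive Func : ℕ → Type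
  | add : Func 2

/-- The only relation symbol (besides equality, which is logical): the strict order `>`. -/
inductive Rel : ℕ → Type
  | gt : Rel 2

/-- The first-order language with signature `+, >`. -/
def lang : Language where
  Functions := Func
  Relations := Rel

/-- The non-negative rationals as a structure of this language. -/
instance : lang.Structure ℚ≥0 where
  funMap f := match f with
    | Func.add => fun v => v 0 + v 1
  RelMap r := match r with
    | Rel.gt => fun v => v 0 > v 1

/-- Existential formulas: the closure of the quantifier-free formulas under conjunction,
disjunction and existential quantification. -/
inductive IsExistential {α : Type} : {n : ℕ} → lang.BoundedFormula α n → Prop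
  | of_isQF {n : ℕ} {φ : lang.BoundedFormula α n} : φ.IsQF → IsExistential φ
  | inf {n : ℕ} {φ ψ : lang.BoundedFormula α n} :
      IsExistential φ → IsExistential ψ → IsExistential (φ ⊓ ψ)
  | sup {n : ℕ} {φ ψ : lang.BoundedFormula α n} :
      IsExistential φ → IsExistential ψ → IsExistential (φ ⊔ ψ)
  | ex {n : ℕ} {φ : lang.BoundedFormula α (n + 1)} : IsExistential φ → IsExistential φ.ex

section

variable {α : Type} {n : ℕ}

/-- The sum of two terms. -/
def add (s t : lang.Term (α ⊕ Fin n)) : lang.Term (α ⊕ Fin n) :=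
  Language.Term.func (L := lang) Func.add ![s, t]

/-- The atomic formula `s > t`. -/
def gt (s t : lang.Term (α ⊕ Fin n)) : lang.BoundedFormula α n :=
  Language.BoundedFormula.rel (L := lang) Rel.gt ![s, t]

/-- A variable as a term. -/
def tm (v : α ⊕ Fin n) : lang.Term (α ⊕ Fin n) := Language.Term.var v

/-- The formula `v > 0`, written without a constant as `v + v > v`. -/
def pos (v : α ⊕ Fin n) : lang.BoundedFormula α n := gt (add (tm v) (tm v)) (tm v)

/-- The formula `v = 0`, written without a constant as `v = v + v`. -/
def zero (v : α ⊕ Fin n) : lang.BoundedFormula α n := (tm v).bdEqual (add (tm v) (tm v))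

/-- Finite conjunctions. -/
def conj {ι : Type} (l : List ι) (f : ι → lang.BoundedFormula α n) : lang.BoundedFormula α n :=
  l.foldr (fun i φ => f i ⊓ φ) ⊤

/-- Finite disjunctions. -/
def disj {ι : Type} (l : List ι) (f : ι → lang.BoundedFormula α n) : lang.BoundedFormula α n :=
  l.foldr (fun i φ => f i ⊔ φ) ⊥

/-- Existential quantification over the last `k` bound variables. -/
def exN : (k : ℕ) → lang.BoundedFormula α (n + k) → lang.BoundedFormula α n
  | 0, φ => φ
  | k + 1, φ => exN k (Language.BoundedFormula.ex φ)

/-- A variable seen in the scope of one more, respectively `k` more, bound variables. -/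
def up (k : ℕ) (v : α ⊕ Fin n) : α ⊕ Fin (n + k) := Sum.map id (Fin.castAdd k) v

/-- The `i`-th of `k` bound variables introduced last. -/
def new {k : ℕ} (i : Fin k) : α ⊕ Fin (n + k) := Sum.inr (Fin.natAdd n i)

end

/-- The formula `s = a * y`, where `a` is the number with the given binary digits (least
significant first): `s = 0` if there are no digits, and `∃ u, s = u + u + b * y ∧ u = a' * y` if
the digits are `b` followed by those of `a'`. -/
def mul {α : Type} : {n : ℕ} → List Bool → (y s : α ⊕ Fin n) → lang.BoundedFormula α n
  | _, [], _, s => zero s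
  | n, b :: bs, y, s =>
      let u : α ⊕ Fin (n + 1) := new (0 : Fin 1)
      let double := add (tm u) (tm u)
      Language.BoundedFormula.ex
        ((tm (up 1 s)).bdEqual (if b then add double (tm (up 1 y)) else double) ⊓
          mul bs (up 1 y) u)

/-- The formula `s = ∑ a * y`, the sum over the pairs `(a, y)` in the list, in the scope of `k`
more bound variables than those that may occur in the list: `s = 0` for the empty list, and
`∃ u v, s = u + v ∧ u = a * y ∧ v = (sum over the rest)` otherwise. -/
def lin {α : Type} {n : ℕ} :
    (k : ℕ) → List (ℕ × (α ⊕ Fin n)) → (s : α ⊕ Fin (n + k)) → lang.BoundedFormula α (n + k)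
  | _, [], s => zero s
  | k, (a, y) :: l, s =>
      let u : α ⊕ Fin (n + (k + 2)) := new (n := n + k) (0 : Fin 2)
      let v : α ⊕ Fin (n + (k + 2)) := new (n := n + k) (1 : Fin 2)
      exN 2
        (((tm (up 2 s)).bdEqual (add (tm u) (tm v)) ⊓ mul a.bits (up (k + 2) y) u) ⊓
          lin (k + 2) l v)

/-! ### The formulas of a net

The free variables `Sum.inl p` and `Sum.inr p` are the components `w p` and `x p` of the two
markings; the first `nt` bound variables are the components `y t` of the Parikh vector. -/

section

variable {np nt : ℕ}

/-- The variable `y t`. -/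
def yVar (t : Fin nt) : (Fin np ⊕ Fin np) ⊕ Fin nt := Sum.inr t

/-- The transitions `t` with `a p t > 0`, together with this number and the variable `y t`. -/
def rowTerms (a : Fin np → Fin nt → ℕ) (p : Fin np) :
    List (ℕ × ((Fin np ⊕ Fin np) ⊕ Fin nt)) :=
  ((List.finRange nt).filter fun t => 0 < a p t).map fun t => (a p t, yVar t)

/-- The state equation `x = C * y + w`; in the row of `p` it is written without subtraction, as
`∃ s s', s = ∑ t, pre p t * y t ∧ s' = ∑ t, post p t * y t ∧ x p + s = w p + s'`. -/
def eqnFormula (N : PetriNet (Fin np) (Fin nt)) :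
    lang.BoundedFormula (Fin np ⊕ Fin np) nt :=
  conj (List.finRange np) fun p =>
    let s : (Fin np ⊕ Fin np) ⊕ Fin (nt + 2) := new (0 : Fin 2)
    let s' : (Fin np ⊕ Fin np) ⊕ Fin (nt + 2) := new (1 : Fin 2)
    exN 2
      (lin 2 (rowTerms N.pre p) s ⊓
        (lin 2 (rowTerms N.post p) s' ⊓
          (add (tm (Sum.inl (Sum.inr p))) (tm s)).bdEqual
            (add (tm (Sum.inl (Sum.inl p))) (tm s'))))

/-- The variable `y t` in the scope of the ordering variables `z`. -/
def yVar' (t : Fin nt) : (Fin np ⊕ Fin np) ⊕ Fin (nt + (np + nt)) := up (np + nt) (yVar t)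

/-- The ordering variable `z p` of a place. -/
def zPlace (p : Fin np) : (Fin np ⊕ Fin np) ⊕ Fin (nt + (np + nt)) := new (Fin.castAdd nt p)

/-- The ordering variable `z t` of a transition. -/
def zTrans (t : Fin nt) : (Fin np ⊕ Fin np) ⊕ Fin (nt + (np + nt)) := new (Fin.natAdd np t)

/-- For every transition `t`: if `y t > 0`, then `0 < z p ≤ z t` for all input places `p`
of `t`. -/
def dtFormula (N : PetriNet (Fin np) (Fin nt)) :
    lang.BoundedFormula (Fin np ⊕ Fin np) (nt + (np + nt)) :=
  conj (List.finRange nt) fun t =>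
    (pos (yVar' t)).imp
      (conj ((List.finRange np).filter fun p => 0 < N.pre p t) fun p =>
        pos (zPlace p) ⊓ (gt (tm (zPlace p)) (tm (zTrans t))).not)

/-- For every place `p`: if `z p > 0`, then `w p > 0`, or `y t > 0` and `z t < z p` for some
transition `t` that has `p` as an output place. Here `mark p` is the variable for `w p`. -/
def mkFormula (N : PetriNet (Fin np) (Fin nt)) (mark : Fin np → Fin np ⊕ Fin np) :
    lang.BoundedFormula (Fin np ⊕ Fin np) (nt + (np + nt)) :=
  conj (List.finRange np) fun p =>
    (pos (zPlace p)).imp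
      (pos (Sum.inl (mark p)) ⊔
        disj ((List.finRange nt).filter fun t => 0 < N.post p t) fun t =>
          pos (yVar' t) ⊓ gt (tm (zPlace p)) (tm (zTrans t)))

/-- The formula for membership of the support of `y` in the firing set of `N` from the marking
whose variables are given by `mark`. -/
def fsFormula (N : PetriNet (Fin np) (Fin nt)) (mark : Fin np → Fin np ⊕ Fin np) :
    lang.BoundedFormula (Fin np ⊕ Fin np) nt :=
  exN (np + nt) (dtFormula N ⊓ mkFormula N mark)

/-- The formula for reachability of `x` from `w`. -/
def reachFormula (N : PetriNet (Fin np) (Fin nt)) : lang.Formula (Fin np ⊕ Fin np) :=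
  Language.BoundedFormula.exs
    (eqnFormula N ⊓ (fsFormula N Sum.inl ⊓ fsFormula N.reverse Sum.inr))

end

/-! ### Formulas as lists of words -/

/-- The words for a variable: a tag for its kind, and its number. -/
def varCode {np n : ℕ} : (Fin np ⊕ Fin np) ⊕ Fin n → List ℕ
  | Sum.inl (Sum.inl p) => [0, p]
  | Sum.inl (Sum.inr p) => [1, p]
  | Sum.inr i => [2, i]

/-- A term in Polish notation. -/
def termCode {np n : ℕ} : lang.Term ((Fin np ⊕ Fin np) ⊕ Fin n) → List ℕ
  | .var v => varCode v
  | .func Func.add ts => 3 :: (termCode (ts 0) ++ termCode (ts 1))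

/-- A formula in Polish notation. -/
def code {np : ℕ} : {n : ℕ} → lang.BoundedFormula (Fin np ⊕ Fin np) n → List ℕ
  | _, .falsum => [4]
  | _, .equal s t => 5 :: (termCode s ++ termCode t)
  | _, .rel Rel.gt ts => 6 :: (termCode (ts 0) ++ termCode (ts 1))
  | _, .imp φ ψ => 7 :: (code φ ++ code ψ)
  | _, .all φ => 8 :: code φ

end AddGt

/-! ### Random access machines

A machine has registers, a random access memory, a random access read-only input and a write-only
output. Its arithmetic is addition and truncated subtraction at unit cost, on words that may not
exceed a bound `W`. -/

namespace RAM

/-- Programs. The arguments of the instructions are register numbers, except for the number `k`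
in `const r k`. -/
inductive Prog
  | skip
  | const (r k : ℕ)
  | add (r a b : ℕ)
  | sub (r a b : ℕ)
  | input (r a : ℕ)
  | load (r a : ℕ)
  | store (a b : ℕ)
  | write (a : ℕ)
  | seq (p q : Prog)
  | ite (r : ℕ) (p q : Prog)
  | loop (r : ℕ) (p : Prog)

/-- The contents of the registers and of the memory, and the output written so far. -/
structure State where
  reg : ℕ → ℕ
  mem : ℕ → ℕ
  out : List ℕ

/-- The state at the start: all registers and memory cells are zero, nothing is written. -/
def State.start : State := ⟨fun _ => 0, fun _ => 0, []⟩

/-- Change of a register. -/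
def State.setReg (s : State) (r v : ℕ) : State := { s with reg := Function.update s.reg r v }

/-- `Exec W inp p s s' k`: on input `inp`, the program `p` started in state `s` halts in
state `s'` after `k` steps, and all words computed on the way are at most `W`. -/
inductive Exec (W : ℕ) (inp : List ℕ) : Prog → State → State → ℕ → Prop
  | skip (s : State) : Exec W inp .skip s s 1
  | const {r k : ℕ} {s : State} : k ≤ W → Exec W inp (.const r k) s (s.setReg r k) 1
  | add {r a b : ℕ} {s : State} : s.reg a + s.reg b ≤ W →
      Exec W inp (.add r a b) s (s.setReg r (s.reg a + s.reg b)) 1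
  | sub {r a b : ℕ} {s : State} :
      Exec W inp (.sub r a b) s (s.setReg r (s.reg a - s.reg b)) 1
  | input {r a : ℕ} {s : State} : inp.getD (s.reg a) 0 ≤ W →
      Exec W inp (.input r a) s (s.setReg r (inp.getD (s.reg a) 0)) 1
  | load {r a : ℕ} {s : State} : Exec W inp (.load r a) s (s.setReg r (s.mem (s.reg a))) 1
  | store {a b : ℕ} {s : State} :
      Exec W inp (.store a b) s
        { s with mem := Function.update s.mem (s.reg a) (s.reg b) } 1
  | write {a : ℕ} {s : State} :
      Exec W inp (.write a) s { s with out := s.out ++ [s.reg a] } 1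
  | seq {p q : Prog} {s s' s'' : State} {k l : ℕ} :
      Exec W inp p s s' k → Exec W inp q s' s'' l → Exec W inp (.seq p q) s s'' (k + l)
  | ite_true {r : ℕ} {p q : Prog} {s s' : State} {k : ℕ} : s.reg r ≠ 0 →
      Exec W inp p s s' k → Exec W inp (.ite r p q) s s' (k + 1)
  | ite_false {r : ℕ} {p q : Prog} {s s' : State} {k : ℕ} : s.reg r = 0 →
      Exec W inp q s s' k → Exec W inp (.ite r p q) s s' (k + 1)
  | loop_done {r : ℕ} {p : Prog} {s : State} : s.reg r = 0 →
      Exec W inp (.loop r p) s s 1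
  | loop_step {r : ℕ} {p : Prog} {s s' s'' : State} {k l : ℕ} : s.reg r ≠ 0 →
      Exec W inp p s s' k → Exec W inp (.loop r p) s' s'' l →
      Exec W inp (.loop r p) s s'' (k + l + 1)

end RAM

/-!
*Correctness.* Fix a net and a marking `m`. A set `S` of transitions lies in the firing set of `m`
if and only if its elements can be listed so that the input places of each are marked by `m` or are
output places of earlier ones (`PetriNet.Orderable`, `PetriNet.mem_firingSet_iff_orderable`): given
such a list, fire each transition by at most half of its enabling degree, so that no marked place is
ever emptied. The variables `z` of the formula for the firing set label places and transitions by
their times in such a list (`PetriNet.orderable_iff_exists_labelling`).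

Reachability of `m'` from `m` is then characterized by a Parikh vector `y` that solves the state
equation and whose support lies in the firing sets of `m` and, in the reverse net, of `m'`
(`PetriNet.qReachable_iff`). Necessity: a firing sequence read backwards is one of the reverse net.
Sufficiency: fire the support of `y` from both ends, by at most half of `y` each time. In the two
markings obtained in this way, all places around the support are marked, and the difference of
their Parikh vectors to `y` is non-negative. Between two such markings the state equation suffices
(`PetriNet.qReachable_of_pos`): along the segment between them the tokens on these places are
bounded away from zero, so that the remaining vector can be fired in many small equal rounds.

*Size and time.* The words of the formula are written as explicit concatenations over the places,
the transitions and the binary digits of the entries (`AddGt.reachWords`,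
`AddGt.code_reachFormula`); existential quantifiers and conjunctions close by constant words, so
that the end of a nested formula is a repetition of these. The linear bound on the size is read off
from there, and the same shape gives the program `RAM.formulaProg`. It first stores the positions of
all matrix entries in memory, because the formula for the transitions runs through the matrices by
columns, and it then consists of nested loops that follow `AddGt.reachWords`. Multiplication is not
available, so each loop keeps an address in arithmetic progression besides its index
(`RAM.forLoop`). The assertions `RAM.Emits` about programs record the words written, the number of
steps, and that the registers below a given one are kept.
-/

namespace PetriNet

/-! ### Firing and the state equation -/

section Semantics

variable {P T : Type} [Fintype P]

theorem enablingDegree_pos_iff (N : PetriNet P T) (t : T) (m : P → ℚ≥0) :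
    0 < N.enablingDegree t m ↔ ∀ p, 0 < N.pre p t → 0 < m p := by
  unfold enablingDegree
  rw [← WithTop.coe_zero, Finset.lt_inf_iff (WithTop.coe_lt_top (0 : ℚ≥0))]
  simp only [Finset.mem_filter, Finset.mem_univ, true_and]
  refine forall₂_congr fun p hp => ?_
  have hp' : (0 : ℚ≥0) < N.pre p t := by exact_mod_cast hp
  rw [WithTop.coe_lt_coe]
  exact div_pos_iff_of_pos_right hp'

theorem le_enablingDegree_iff (N : PetriNet P T) (q : ℚ≥0) (t : T) (m : P → ℚ≥0) :
    (q : WithTop ℚ≥0) ≤ N.enablingDegree t m ↔ ∀ p, q * N.pre p t ≤ m p := by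
  unfold enablingDegree
  rw [Finset.le_inf_iff]
  simp only [Finset.mem_filter, Finset.mem_univ, true_and, WithTop.coe_le_coe]
  refine forall_congr' fun p => ?_
  rcases Nat.eq_zero_or_pos (N.pre p t) with h | h
  · simp [h]
  · have hp' : (0 : ℚ≥0) < N.pre p t := by exact_mod_cast h
    simp only [h, true_imp_iff]
    exact le_div_iff₀ hp'

/-- The firing rule in terms of the non-negative matrices, without division and subtraction. -/
theorem fires_iff (N : PetriNet P T) (q : ℚ≥0) (t : T) (m m' : P → ℚ≥0) :
    N.Fires q t m m' ↔ (∀ p, 0 < N.pre p t → 0 < m p) ∧ (∀ p, q * N.pre p t ≤ m p) ∧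
      ∀ p, m' p + q * N.pre p t = m p + q * N.post p t := by
  unfold Fires
  rw [enablingDegree_pos_iff, le_enablingDegree_iff]
  refine and_congr_right fun _ => and_congr_right fun _ => forall_congr' fun p => ?_
  rw [← NNRat.coe_inj]
  simp only [incidence]
  push_cast
  constructor <;> intro h <;> linarith

/-- An enabled transition can be fired by every amount for which there are enough tokens. The
successor marking is given by truncated subtraction. -/
theorem fires_of_le (N : PetriNet P T) {q : ℚ≥0} {t : T} {m : P → ℚ≥0}
    (h : ∀ p, 0 < N.pre p t → 0 < m p) (hq : ∀ p, q * N.pre p t ≤ m p) :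
    N.Fires q t m fun p => m p - q * N.pre p t + q * N.post p t := by
  rw [fires_iff]
  refine ⟨h, hq, fun p => ?_⟩
  rw [add_right_comm, tsub_add_cancel_of_le (hq p)]

theorem FiresSeq.append {N : PetriNet P T} {σ τ : List (ℚ≥0 × T)} {m m' m'' : P → ℚ≥0}
    (h : N.FiresSeq σ m m') (h' : N.FiresSeq τ m' m'') : N.FiresSeq (σ ++ τ) m m'' := by
  induction h with
  | nil => exact h'
  | cons hf _ ih => exact .cons hf (ih h')

theorem FiresSeq.single {N : PetriNet P T} {q : ℚ≥0} {t : T} {m m' : P → ℚ≥0}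
    (h : N.Fires q t m m') : N.FiresSeq [(q, t)] m m' := .cons h (.nil _)

theorem QReachable.trans {N : PetriNet P T} {m m' m'' : P → ℚ≥0}
    (h : N.QReachable m m') (h' : N.QReachable m' m'') : N.QReachable m m'' := by
  obtain ⟨σ, hσ⟩ := h
  obtain ⟨τ, hτ⟩ := h'
  exact ⟨σ ++ τ, hσ.append hτ⟩

variable [DecidableEq T]

theorem parikh_nil (t : T) : parikh [] t = 0 := rfl

theorem parikh_cons (q : ℚ≥0) (t : T) (σ : List (ℚ≥0 × T)) (t' : T) :
    parikh ((q, t) :: σ) t' = (if t = t' then q else 0) + parikh σ t' := by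
  unfold parikh
  by_cases h : t = t' <;> simp [h]

theorem parikh_append (σ τ : List (ℚ≥0 × T)) (t : T) :
    parikh (σ ++ τ) t = parikh σ t + parikh τ t := by
  simp [parikh]

theorem support_parikh_cons (q : ℚ≥0) (t : T) (σ : List (ℚ≥0 × T)) (hq : 0 < q) :
    Function.support (parikh ((q, t) :: σ)) = insert t (Function.support (parikh σ)) := by
  ext t'
  simp only [Function.mem_support, parikh_cons, Set.mem_insert_iff]
  by_cases h : t = t'
  · simp [h, hq.ne']
  · simp [h, Ne.symm h]

/-- The state equation. -/
theorem FiresSeq.state_eq [Fintype T] {N : PetriNet P T} {σ : List (ℚ≥0 × T)}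
    {m m' : P → ℚ≥0} (h : N.FiresSeq σ m m') (p : P) :
    m' p + ∑ t, parikh σ t * N.pre p t = m p + ∑ t, parikh σ t * N.post p t := by
  induction h with
  | nil => simp [parikh_nil]
  | @cons q t σ m m' m'' hf _ ih =>
    have := ((N.fires_iff _ _ _ _).1 hf).2.2 p
    simp only [parikh_cons, add_mul, ite_mul, zero_mul, Finset.sum_add_distrib,
      Finset.sum_ite_eq, Finset.mem_univ, if_true]
    linear_combination ih + this

/-- Read backwards, a firing sequence is one of the reverse net, once the firings by the
amount `0` are left out: the transition may not be enabled after such a firing. -/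
theorem FiresSeq.reverse {N : PetriNet P T} {σ : List (ℚ≥0 × T)} {m m' : P → ℚ≥0}
    (h : N.FiresSeq σ m m') :
    ∃ τ, N.reverse.FiresSeq τ m' m ∧ ∀ t, parikh τ t = parikh σ t := by
  induction h with
  | nil => exact ⟨[], .nil _, fun _ => rfl⟩
  | @cons q t σ m m' m'' hf _ ih =>
    obtain ⟨τ, hτ, hp⟩ := ih
    obtain ⟨h1, h2, h3⟩ := (N.fires_iff _ _ _ _).1 hf
    rcases eq_or_ne q 0 with rfl | hq
    · have : m' = m := funext fun p => by simpa using h3 p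
      subst this
      exact ⟨τ, hτ, fun t' => by simp [parikh_cons, hp]⟩
    · have hle (p : P) : q * N.post p t ≤ m' p := by
        have a1 := h3 p
        have a2 := h2 p
        by_contra! hlt
        exact (add_lt_add_of_le_of_lt a2 hlt).ne (by rw [← a1, add_comm])
      refine ⟨τ ++ [(q, t)], hτ.append (.single ?_), fun t' => ?_⟩
      · rw [fires_iff]
        refine ⟨fun p hp => ?_, hle, fun p => (h3 p).symm⟩
        have : (0 : ℚ≥0) < N.post p t := by exact_mod_cast hp
        exact (mul_pos (pos_iff_ne_zero.2 hq) this).trans_le (hle p)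
      · rw [parikh_append, hp, parikh_cons, parikh_cons, parikh_nil, add_zero, add_comm]

end Semantics

/-! ### Firing sets -/

section FiringSets

variable {P T : Type}

/-- `N.Orderable M S`: the transitions of `S` can be ordered in such a way that the input places
of each of them lie in `M` or are output places of earlier ones. -/
inductive Orderable (N : PetriNet P T) (M : Set P) : Set T → Prop
  | empty : Orderable N M ∅
  | insert {S : Set T} {t : T} : Orderable N M S →
      (∀ p, 0 < N.pre p t → p ∈ M ∨ ∃ t' ∈ S, 0 < N.post p t') → Orderable N M (insert t S)

/-- A transition that is enabled by `M` may also be put in front of an order. -/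
theorem Orderable.cons {N : PetriNet P T} {M M' : Set P} {S : Set T} {t : T}
    (h : N.Orderable M' S) (ht : ∀ p, 0 < N.pre p t → p ∈ M)
    (hM : ∀ p ∈ M', p ∈ M ∨ 0 < N.post p t) : N.Orderable M (Insert.insert t S) := by
  induction h with
  | empty => exact .insert .empty fun p hp => .inl (ht p hp)
  | @insert S t' _ h' ih =>
    rw [Set.insert_comm]
    refine .insert ih fun p hp => ?_
    rcases h' p hp with h | ⟨s, hs, hsp⟩
    · exact (hM p h).imp id fun h => ⟨t, Set.mem_insert _ _, h⟩
    · exact .inr ⟨s, Set.mem_insert_of_mem _ hs, hsp⟩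

variable [Fintype P]

/-- The order of the first firings by positive amounts. -/
theorem FiresSeq.orderable [DecidableEq T] {N : PetriNet P T} {σ : List (ℚ≥0 × T)}
    {m m' : P → ℚ≥0} (h : N.FiresSeq σ m m') :
    N.Orderable {p | 0 < m p} (Function.support (parikh σ)) := by
  induction h with
  | nil =>
    have : Function.support (parikh ([] : List (ℚ≥0 × T))) = ∅ := by
      ext t
      simp [parikh_nil]
    rw [this]
    exact .empty
  | @cons q t σ m m' m'' hf _ ih =>
    obtain ⟨h1, h2, h3⟩ := (N.fires_iff _ _ _ _).1 hf
    rcases eq_or_ne q 0 with rfl | hq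
    · have : m' = m := funext fun p => by simpa using h3 p
      subst this
      convert ih using 1
      ext t'
      simp [parikh_cons]
    · rw [support_parikh_cons _ _ _ (pos_iff_ne_zero.2 hq)]
      refine ih.cons h1 fun p hp => ?_
      by_contra! hc
      obtain ⟨hc1, hc2⟩ := hc
      have e1 : m p = 0 := by simpa using hc1
      have e2 : N.post p t = 0 := by omega
      have := h3 p
      rw [e1, e2] at this
      simp only [Nat.cast_zero, mul_zero, add_zero, add_eq_zero] at this
      exact (ne_of_gt hp) this.1

/-- The transitions of an orderable set can be fired by arbitrarily small amounts, in such a way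
that all places that were marked, and all places around the transitions, are marked at the end:
every transition is fired by at most half of the amount that its input places admit. -/
theorem Orderable.exists_firesSeq [DecidableEq T] {N : PetriNet P T} {m : P → ℚ≥0} {S : Set T}
    (h : N.Orderable {p | 0 < m p} S) (b : T → ℚ≥0) (hb : ∀ t ∈ S, 0 < b t) :
    ∃ σ m', N.FiresSeq σ m m' ∧ Function.support (parikh σ) = S ∧ (∀ t, parikh σ t ≤ b t) ∧
      (∀ p, 0 < m p → 0 < m' p) ∧
      ∀ t ∈ S, ∀ p, 0 < N.pre p t ∨ 0 < N.post p t → 0 < m' p := by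
  induction h generalizing b with
  | empty =>
    refine ⟨[], m, .nil _, ?_, fun t => zero_le, fun _ => id, by simp⟩
    ext t
    simp [parikh_nil]
  | @insert S t _ ht ih =>
    by_cases htS : t ∈ S
    · rw [Set.insert_eq_of_mem htS] at hb ⊢
      exact ih b hb
    · obtain ⟨σ, m', h1, h2, h3, h4, h5⟩ :=
        ih b fun s hs => hb s (Set.mem_insert_of_mem _ hs)
      have hpos (p : P) (hp : 0 < N.pre p t) : 0 < m' p := by
        rcases ht p hp with h | ⟨s, hs, hsp⟩
        · exact h4 p h
        · exact h5 s hs p (.inr hsp)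
      have hlt : (0 : WithTop ℚ≥0) < N.enablingDegree t m' := (enablingDegree_pos_iff _ _ _).2 hpos
      obtain ⟨q, hq0, hqb, hqe⟩ : ∃ q : ℚ≥0, 0 < q ∧ q ≤ b t ∧
          ((2 * q : ℚ≥0) : WithTop ℚ≥0) ≤ N.enablingDegree t m' := by
        have hbt := hb t (Set.mem_insert _ _)
        cases he : N.enablingDegree t m' with
        | top => exact ⟨b t, hbt, le_rfl, le_top⟩
        | coe e =>
          rw [he] at hlt
          have he0 : 0 < e := by exact_mod_cast hlt
          refine ⟨min (b t) (e / 2), lt_min hbt (by positivity), min_le_left _ _, ?_⟩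
          rw [WithTop.coe_le_coe]
          calc 2 * min (b t) (e / 2) ≤ 2 * (e / 2) := by gcongr; exact min_le_right _ _
            _ = e := by field_simp
      rw [le_enablingDegree_iff] at hqe
      have hqle (p : P) : q * N.pre p t ≤ m' p := by
        refine le_trans ?_ (hqe p)
        rw [mul_assoc, two_mul]
        exact le_add_of_nonneg_left zero_le
      have hkeep (p : P) (hp : 0 < m' p) : 0 < m' p - q * N.pre p t + q * N.post p t := by
        refine lt_of_lt_of_le (tsub_pos_of_lt ?_) le_self_add
        rcases Nat.eq_zero_or_pos (N.pre p t) with h0 | h0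
        · simpa [h0] using hp
        · refine lt_of_lt_of_le ?_ (hqe p)
          have : (0 : ℚ≥0) < N.pre p t := by exact_mod_cast h0
          rw [mul_assoc, two_mul]
          exact lt_add_of_pos_left _ (by positivity)
      refine ⟨σ ++ [(q, t)], _, h1.append (.single (N.fires_of_le hpos hqle)), ?_, ?_,
        fun p hp => hkeep p (h4 p hp), ?_⟩
      · ext s
        have := Set.ext_iff.1 h2 s
        simp only [Function.mem_support, parikh_append, parikh_cons, parikh_nil,
          Set.mem_insert_iff] at this ⊢
        by_cases hs : t = s
        · simp [hs, hq0.ne']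
        · simp [hs, Ne.symm hs, this]
      · intro s
        rw [parikh_append, parikh_cons, parikh_nil, add_zero]
        by_cases hs : t = s
        · subst hs
          have : parikh σ t = 0 := by
            by_contra hne
            exact htS (h2 ▸ Function.mem_support.2 hne)
          simpa [this] using hqb
        · simpa [hs] using h3 s
      · intro s hs p hp
        rcases Set.mem_insert_iff.1 hs with rfl | hs
        · rcases Nat.eq_zero_or_pos (N.post p s) with h0 | h0
          · exact hkeep p (hpos p (hp.resolve_right (by omega)))
          · have : (0 : ℚ≥0) < N.post p s := by exact_mod_cast h0
            exact add_pos_of_nonneg_of_pos zero_le (by positivity)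
        · exact hkeep p (h5 s hs p hp)

theorem mem_firingSet_iff_orderable [DecidableEq T] (N : PetriNet P T) (m : P → ℚ≥0)
    (S : Set T) : S ∈ N.firingSet m ↔ N.Orderable {p | 0 < m p} S := by
  constructor
  · rintro ⟨σ, m', hσ, rfl⟩
    exact hσ.orderable
  · intro h
    obtain ⟨σ, m', h1, h2, -⟩ := h.exists_firesSeq (fun _ => 1) fun _ _ => one_pos
    exact ⟨σ, m', h1, h2⟩

/-- An order on the transitions of `S` as required for orderability is the same as a labelling of
places and transitions by non-negative rationals, in which the label of a transition lies between
those of its input places and those of the places that it marks first. -/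
theorem orderable_iff_exists_labelling [Fintype T] (N : PetriNet P T) (M : Set P) (S : Set T) :
    N.Orderable M S ↔ ∃ (a : P → ℚ≥0) (b : T → ℚ≥0),
      (∀ t ∈ S, ∀ p, 0 < N.pre p t → 0 < a p ∧ a p ≤ b t) ∧
      ∀ p, 0 < a p → p ∈ M ∨ ∃ t, 0 < N.post p t ∧ t ∈ S ∧ b t < a p := by
  classical
  constructor
  · intro h
    -- The induction also needs that the marked places and the output places have labels.
    suffices ∃ (a : P → ℚ≥0) (b : T → ℚ≥0),
        (∀ t ∈ S, ∀ p, 0 < N.pre p t → 0 < a p ∧ a p ≤ b t) ∧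
        (∀ p, 0 < a p → p ∈ M ∨ ∃ t, 0 < N.post p t ∧ t ∈ S ∧ b t < a p) ∧
        (∀ p ∈ M, 0 < a p) ∧ ∀ t ∈ S, ∀ p, 0 < N.post p t → 0 < a p by
      obtain ⟨a, b, h1, h2, -⟩ := this
      exact ⟨a, b, h1, h2⟩
    induction h with
    | empty =>
      refine ⟨fun p => if p ∈ M then 1 else 0, fun _ => 0, by simp, fun p hp => .inl ?_, ?_,
        by simp⟩
      · by_contra h
        simp [h] at hp
      · intro p hp
        simp [hp]
    | @insert S t _ ht ih =>
      obtain ⟨a, b, h1, h2, h3, h4⟩ := ih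
      by_cases htS : t ∈ S
      · rw [Set.insert_eq_of_mem htS]
        exact ⟨a, b, h1, h2, h3, h4⟩
      -- The new transition gets a label above those of all places.
      set B := ∑ p, a p with hB
      have haB (p : P) : a p ≤ B :=
        Finset.single_le_sum (f := a) (fun _ _ => zero_le) (Finset.mem_univ p)
      let a' : P → ℚ≥0 := fun p => if 0 < a p then a p else if 0 < N.post p t then B + 1 else 0
      have ha' (p : P) (hp : 0 < a p) : a' p = a p := by simp [a', hp]
      have hb' (s : T) (hs : s ∈ S) : Function.update b t B s = b s :=
        Function.update_of_ne (by rintro rfl; exact htS hs) _ _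
      have hin (p : P) (hp : 0 < N.pre p t) : 0 < a p := by
        rcases ht p hp with h | ⟨s, hs, hsp⟩
        · exact h3 p h
        · exact h4 s hs p hsp
      refine ⟨a', Function.update b t B, ?_, ?_, ?_, ?_⟩
      · intro s hs p hp
        rcases Set.mem_insert_iff.1 hs with rfl | hs
        · rw [ha' p (hin p hp), Function.update_self]
          exact ⟨hin p hp, haB p⟩
        · rw [ha' p (h1 s hs p hp).1, hb' s hs]
          exact h1 s hs p hp
      · intro p hp
        by_cases hap : 0 < a p
        · rw [ha' p hap]
          refine (h2 p hap).imp id ?_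
          rintro ⟨s, hs1, hs2, hs3⟩
          exact ⟨s, hs1, Set.mem_insert_of_mem _ hs2, by rwa [hb' s hs2]⟩
        · by_cases hpt : 0 < N.post p t
          · refine .inr ⟨t, hpt, Set.mem_insert _ _, ?_⟩
            rw [Function.update_self]
            simp only [a', hap, hpt, if_true, if_false]
            exact lt_add_one B
          · simp [a', hap, hpt] at hp
      · intro p hp
        rw [ha' p (h3 p hp)]
        exact h3 p hp
      · intro s hs p hp
        by_cases hap : 0 < a p
        · rwa [ha' p hap]
        · rcases Set.mem_insert_iff.1 hs with rfl | hs
          · simp only [a', hap, hp, if_true, if_false]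
            positivity
          · exact absurd (h4 s hs p hp) hap
  · rintro ⟨a, b, h1, h2⟩
    have key (F : Finset T) : (∀ t ∈ F, t ∈ S) → (∀ t ∈ F, ∀ s ∈ S, b s < b t → s ∈ F) →
        N.Orderable M (F : Set T) := by
      induction F using Finset.induction_on_max_value b with
      | empty => intro _ _; simpa using Orderable.empty
      | insert t F htF hmax ih =>
        intro hF hd
        rw [Finset.coe_insert]
        refine .insert (ih (fun s hs => hF s (Finset.mem_insert_of_mem hs)) ?_) ?_
        · intro s hs s' hs' hlt
          refine (Finset.mem_insert.1 (hd s (Finset.mem_insert_of_mem hs) s' hs' hlt)).resolve_left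
            ?_
          rintro rfl
          exact absurd (hmax s hs) hlt.not_ge
        · intro p hp
          obtain ⟨hp0, hpt⟩ := h1 t (hF t (Finset.mem_insert_self _ _)) p hp
          refine (h2 p hp0).imp id ?_
          rintro ⟨s, hs1, hs2, hs3⟩
          have hst := hs3.trans_le hpt
          refine ⟨s, ?_, hs1⟩
          refine (Finset.mem_insert.1 (hd t (Finset.mem_insert_self _ _) s hs2 hst)).resolve_left ?_
          rintro rfl
          exact lt_irrefl _ hst
    have := key S.toFinset (by simp) (by simp +contextual)
    simpa using this

end FiringSets

/-! ### Reachability -/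

section Reachability

variable {P T : Type} [Fintype P] [Fintype T]

/-- If there are enough tokens for all firings together, then the transitions can be fired one
after another. -/
theorem qReachable_of_sum_le (N : PetriNet P T) (v : T → ℚ≥0) {m m' : P → ℚ≥0}
    (h : ∀ p, ∑ t, v t * N.pre p t ≤ m p)
    (he : ∀ p, m' p + ∑ t, v t * N.pre p t = m p + ∑ t, v t * N.post p t) :
    N.QReachable m m' := by
  classical
  suffices ∀ (F : Finset T) (m m' : P → ℚ≥0), (∀ p, ∑ t ∈ F, v t * N.pre p t ≤ m p) →
      (∀ p, m' p + ∑ t ∈ F, v t * N.pre p t = m p + ∑ t ∈ F, v t * N.post p t) →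
      N.QReachable m m' from this _ _ _ h he
  intro F
  induction F using Finset.induction_on with
  | empty =>
    intro m m' _ he
    obtain rfl : m' = m := funext fun p => by simpa using he p
    exact ⟨[], .nil _⟩
  | insert t F htF ih =>
    intro m m' h he
    simp only [Finset.sum_insert htF] at h he
    rcases eq_or_ne (v t) 0 with h0 | h0
    · simp only [h0, zero_mul, zero_add] at h he
      exact ih m m' h he
    have hle (p : P) : v t * N.pre p t ≤ m p := le_self_add.trans (h p)
    have hpos (p : P) (hp : 0 < N.pre p t) : 0 < m p := by
      have : (0 : ℚ≥0) < N.pre p t := by exact_mod_cast hp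
      exact (mul_pos (pos_iff_ne_zero.2 h0) this).trans_le (hle p)
    have hf := N.fires_of_le hpos hle
    refine QReachable.trans ⟨_, .single hf⟩ (ih _ _ (fun p => ?_) fun p => ?_)
    · exact (le_tsub_of_add_le_left (h p)).trans le_self_add
    · have h1 := ((N.fires_iff _ _ _ _).1 hf).2.2 p
      have h2 := he p
      generalize m p - v t * N.pre p t + v t * N.post p t = x at h1 ⊢
      refine add_right_cancel (b := v t * N.pre p t) ?_
      linear_combination h2 - h1

/-- If all places around the transitions to be fired are marked at both ends, then the state
equation suffices for reachability: fire along the segment between the two markings, in many small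
rounds. -/
theorem qReachable_of_pos (N : PetriNet P T) (v : T → ℚ≥0) {m m' : P → ℚ≥0}
    (he : ∀ p, m' p + ∑ t, v t * N.pre p t = m p + ∑ t, v t * N.post p t)
    (h : ∀ t, 0 < v t → ∀ p, 0 < N.pre p t → 0 < m p ∧ 0 < m' p) :
    N.QReachable m m' := by
  classical
  obtain ⟨n, hn0, hn⟩ : ∃ n : ℕ, 0 < n ∧
      ∀ p, ∑ t, v t * N.pre p t ≤ n * min (m p) (m' p) := by
    have (p : P) : ∃ n : ℕ, ∑ t, v t * N.pre p t ≤ n * min (m p) (m' p) := by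
      by_cases hp : 0 < min (m p) (m' p)
      · obtain ⟨n, hn⟩ := Archimedean.arch (∑ t, v t * (N.pre p t : ℚ≥0)) hp
        exact ⟨n, by simpa using hn⟩
      · refine ⟨0, ?_⟩
        rw [Finset.sum_eq_zero]
        · simp
        · intro t _
          by_contra hne
          have hv : 0 < v t := pos_iff_ne_zero.2 (left_ne_zero_of_mul hne)
          have hpre : 0 < N.pre p t := by
            have := right_ne_zero_of_mul hne
            exact Nat.pos_of_ne_zero (by exact_mod_cast this)
          exact hp (lt_min (h t hv p hpre).1 (h t hv p hpre).2)
    choose f hf using this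
    refine ⟨∑ p, f p + 1, by positivity, fun p => (hf p).trans ?_⟩
    gcongr
    exact (Finset.single_le_sum (f := f) (fun _ _ => Nat.zero_le _) (Finset.mem_univ p)).trans
      (Nat.le_succ _)
  have hn0' : (0 : ℚ≥0) < n := by exact_mod_cast hn0
  have key (i j : ℕ) (hij : i + j = n) : N.QReachable m fun p => (j * m p + i * m' p) / n := by
    induction i generalizing j with
    | zero =>
      have : (fun p => ((j : ℚ≥0) * m p + (0 : ℕ) * m' p) / n) = m := by
        obtain rfl : j = n := by omega
        funext p
        field_simp
        simp
      rw [this]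
      exact ⟨[], .nil _⟩
    | succ i ih =>
      refine (ih (j + 1) (by omega)).trans (N.qReachable_of_sum_le (fun t => v t / n) ?_ ?_)
      · intro p
        have h1 : ∑ t, v t / n * (N.pre p t : ℚ≥0) = (∑ t, v t * N.pre p t) / n := by
          rw [Finset.sum_div]
          exact Finset.sum_congr rfl fun t _ => by ring
        rw [h1]
        gcongr
        refine (hn p).trans ?_
        have h2 : (n : ℚ≥0) = (j + 1 : ℕ) + i := by rw [← hij]; push_cast; ring
        rw [h2, add_mul]
        gcongr
        · exact min_le_left _ _
        · exact min_le_right _ _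
      · intro p
        have h1 (f : T → ℕ) : ∑ t, v t / n * (f t : ℚ≥0) = (∑ t, v t * f t) / n := by
          rw [Finset.sum_div]
          exact Finset.sum_congr rfl fun t _ => by ring
        rw [h1, h1, ← add_div, ← add_div]
        congr 1
        push_cast
        linear_combination he p
  have := key n 0 (by omega)
  convert this using 2 with p
  field_simp
  simp

/-- The characterization of reachability by Fraca and Haddad. -/
theorem qReachable_iff [DecidableEq T] (N : PetriNet P T) (m m' : P → ℚ≥0) :
    N.QReachable m m' ↔ ∃ y : T → ℚ≥0,
      (∀ p, m' p + ∑ t, y t * N.pre p t = m p + ∑ t, y t * N.post p t) ∧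
      Function.support y ∈ N.firingSet m ∧ Function.support y ∈ N.reverse.firingSet m' := by
  constructor
  · rintro ⟨σ, hσ⟩
    obtain ⟨τ, hτ, hp⟩ := hσ.reverse
    exact ⟨parikh σ, hσ.state_eq, ⟨σ, _, hσ, rfl⟩, ⟨τ, _, hτ, by rw [funext hp]⟩⟩
  · rintro ⟨y, he, h1, h2⟩
    rw [mem_firingSet_iff_orderable] at h1 h2
    -- Half of `y` is left for the first firings from each of the two ends.
    have hb (t : T) (ht : t ∈ Function.support y) : 0 < y t / 2 :=
      div_pos (pos_iff_ne_zero.2 ht) two_pos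
    obtain ⟨σ, m₁, hσ, -, hσy, -, hσp⟩ := h1.exists_firesSeq (fun t => y t / 2) hb
    obtain ⟨τ, m₂, hτ, -, hτy, -, hτp⟩ := h2.exists_firesSeq (fun t => y t / 2) hb
    obtain ⟨τ', hτ', -⟩ := hτ.reverse
    have hle (t : T) : parikh σ t + parikh τ t ≤ y t :=
      (add_le_add (hσy t) (hτy t)).trans_eq (add_halves _)
    refine QReachable.trans ⟨σ, hσ⟩ (QReachable.trans ?_ ⟨τ', hτ'⟩)
    obtain ⟨v, hv⟩ : ∃ v : T → ℚ≥0, ∀ t, y t = v t + (parikh σ t + parikh τ t) :=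
      ⟨fun t => y t - (parikh σ t + parikh τ t), fun t => (tsub_add_cancel_of_le (hle t)).symm⟩
    refine N.qReachable_of_pos v (fun p => ?_) fun t ht p hp => ?_
    · have e1 := he p
      have e2 := hσ.state_eq p
      have e3 := hτ.state_eq p
      simp only [hv, add_mul, Finset.sum_add_distrib, PetriNet.reverse] at e1 e2 e3
      rw [← NNRat.coe_inj] at e1 e2 e3 ⊢
      push_cast at e1 e2 e3 ⊢
      linarith
    · have hty : t ∈ Function.support y := by
        rw [Function.mem_support, hv]
        exact (add_pos_of_pos_of_nonneg ht zero_le).ne'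
      exact ⟨hσp t hty p (.inl hp), hτp t hty p (.inr hp)⟩

end Reachability

end PetriNet

namespace AddGt

/-! ### Existential formulas -/

section Existential

variable {α : Type} {n : ℕ}

theorem isQF_gt (s t : lang.Term (α ⊕ Fin n)) : (gt s t).IsQF :=
  (Language.BoundedFormula.IsAtomic.rel (L := lang) Rel.gt ![s, t]).isQF

theorem isQF_bdEqual (s t : lang.Term (α ⊕ Fin n)) : (s.bdEqual t).IsQF :=
  (Language.BoundedFormula.IsAtomic.equal s t).isQF

theorem isQF_conj {ι : Type} (l : List ι) {f : ι → lang.BoundedFormula α n}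
    (h : ∀ i, (f i).IsQF) : (conj l f).IsQF := by
  induction l with
  | nil => exact Language.BoundedFormula.IsQF.top
  | cons i l ih => exact (h i).inf ih

theorem isQF_disj {ι : Type} (l : List ι) {f : ι → lang.BoundedFormula α n}
    (h : ∀ i, (f i).IsQF) : (disj l f).IsQF := by
  induction l with
  | nil => exact Language.BoundedFormula.isQF_bot
  | cons i l ih => exact (h i).sup ih

theorem isExistential_conj {ι : Type} (l : List ι) {f : ι → lang.BoundedFormula α n}
    (h : ∀ i, IsExistential (f i)) : IsExistential (conj l f) := by
  induction l with
  | nil => exact .of_isQF Language.BoundedFormula.IsQF.top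
  | cons i l ih => exact (h i).inf ih

theorem IsExistential.exN {k : ℕ} {φ : lang.BoundedFormula α (n + k)} (h : IsExistential φ) :
    IsExistential (exN k φ) := by
  induction k with
  | zero => exact h
  | succ k ih => exact ih h.ex

theorem IsExistential.exs {n : ℕ} {φ : lang.BoundedFormula α n} (h : IsExistential φ) :
    IsExistential φ.exs := by
  induction n with
  | zero => exact h
  | succ n ih => exact ih h.ex

theorem isExistential_mul (bs : List Bool) (y s : α ⊕ Fin n) : IsExistential (mul bs y s) := by
  induction bs generalizing n with
  | nil => exact .of_isQF (isQF_bdEqual _ _)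
  | cons b bs ih => exact .ex (.inf (.of_isQF (isQF_bdEqual _ _)) (ih _ _))

theorem isExistential_lin (k : ℕ) (l : List (ℕ × (α ⊕ Fin n))) (s : α ⊕ Fin (n + k)) :
    IsExistential (lin k l s) := by
  induction l generalizing k with
  | nil => exact .of_isQF (isQF_bdEqual _ _)
  | cons a l ih =>
    exact .exN (k := 2) (.inf (.inf (.of_isQF (isQF_bdEqual _ _)) (isExistential_mul _ _ _))
      (ih _ _))

variable {np nt : ℕ}

theorem isExistential_eqnFormula (N : PetriNet (Fin np) (Fin nt)) :
    IsExistential (eqnFormula N) :=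
  isExistential_conj _ fun _ => .exN (k := 2) (.inf (isExistential_lin _ _ _)
    (.inf (isExistential_lin _ _ _) (.of_isQF (isQF_bdEqual _ _))))

theorem isExistential_fsFormula (N : PetriNet (Fin np) (Fin nt))
    (mark : Fin np → Fin np ⊕ Fin np) : IsExistential (fsFormula N mark) :=
  .exN (.of_isQF (.inf
    (isQF_conj _ fun _ => (isQF_gt _ _).imp
      (isQF_conj _ fun _ => (isQF_gt _ _).inf (isQF_gt _ _).not))
    (isQF_conj _ fun _ => (isQF_gt _ _).imp
      ((isQF_gt _ _).sup (isQF_disj _ fun _ => (isQF_gt _ _).inf (isQF_gt _ _))))))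

theorem isExistential_reachFormula (N : PetriNet (Fin np) (Fin nt)) :
    IsExistential (reachFormula N) :=
  IsExistential.exs ((isExistential_eqnFormula N).inf
    ((isExistential_fsFormula N _).inf (isExistential_fsFormula N.reverse _)))

end Existential

/-! ### The meaning of the formulas -/

section Realize

variable {α : Type} {n : ℕ} (v : α → ℚ≥0) (xs : Fin n → ℚ≥0)

theorem realize_tm (x : α ⊕ Fin n) : (tm x).realize (Sum.elim v xs) = Sum.elim v xs x := rfl

theorem realize_add (s t : lang.Term (α ⊕ Fin n)) :
    (add s t).realize (Sum.elim v xs) =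
      s.realize (Sum.elim v xs) + t.realize (Sum.elim v xs) := rfl

theorem realize_gt (s t : lang.Term (α ⊕ Fin n)) :
    (gt s t).Realize v xs ↔ s.realize (Sum.elim v xs) > t.realize (Sum.elim v xs) := Iff.rfl

theorem realize_pos (x : α ⊕ Fin n) : (pos x).Realize v xs ↔ 0 < Sum.elim v xs x := by
  rw [pos, realize_gt, realize_add, realize_tm]
  exact lt_add_iff_pos_left _

theorem realize_zero (x : α ⊕ Fin n) : (zero x).Realize v xs ↔ Sum.elim v xs x = 0 := by
  rw [zero, Language.BoundedFormula.realize_bdEqual, realize_add, realize_tm]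
  exact left_eq_add

theorem realize_conj {ι : Type} (l : List ι) (f : ι → lang.BoundedFormula α n) :
    (conj l f).Realize v xs ↔ ∀ i ∈ l, (f i).Realize v xs := by
  induction l with
  | nil => simp [conj]
  | cons i l ih =>
    rw [List.forall_mem_cons, ← ih]
    exact Language.BoundedFormula.realize_inf

theorem realize_disj {ι : Type} (l : List ι) (f : ι → lang.BoundedFormula α n) :
    (disj l f).Realize v xs ↔ ∃ i ∈ l, (f i).Realize v xs := by
  induction l with
  | nil => simp [disj]
  | cons i l ih =>
    simp only [List.mem_cons, exists_eq_or_imp, ← ih]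
    exact Language.BoundedFormula.realize_sup

theorem realize_exN {k : ℕ} (φ : lang.BoundedFormula α (n + k)) :
    (exN k φ).Realize v xs ↔ ∃ u : Fin k → ℚ≥0, φ.Realize v (Fin.append xs u) := by
  induction k with
  | zero =>
    have (u : Fin 0 → ℚ≥0) : Fin.append xs u = xs := by
      rw [Subsingleton.elim u Fin.elim0, Fin.append_elim0]
      rfl
    simp only [this, exists_const]
    exact Iff.rfl
  | succ k ih =>
    refine (ih _).trans ?_
    simp only [Language.BoundedFormula.realize_ex]
    constructor
    · rintro ⟨u, a, h⟩
      exact ⟨Fin.snoc u a, by rwa [Fin.append_snoc]⟩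
    · rintro ⟨u, h⟩
      refine ⟨Fin.init u, u (Fin.last k), ?_⟩
      rwa [← Fin.append_snoc, Fin.snoc_init_self]

variable {k : ℕ} (u : Fin k → ℚ≥0)

theorem elim_up (x : α ⊕ Fin n) :
    Sum.elim v (Fin.append xs u) (up k x) = Sum.elim v xs x := by
  rcases x with x | x <;> simp [up]

theorem elim_new (i : Fin k) :
    Sum.elim v (Fin.append xs u) (new i : α ⊕ Fin (n + k)) = u i := by
  simp [new]

theorem realize_mul (a : ℕ) (y s : α ⊕ Fin n) :
    (mul a.bits y s).Realize v xs ↔ Sum.elim v xs s = a * Sum.elim v xs y := by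
  induction a using Nat.binaryRec' generalizing n with
  | zero =>
    rw [Nat.zero_bits, mul, realize_zero]
    simp
  | bit b a h ih =>
    rw [Nat.bits_append_bit a b h, mul]
    refine (realize_exN v xs (k := 1) _).trans ?_
    simp only [Language.BoundedFormula.realize_inf, Language.BoundedFormula.realize_bdEqual, ih,
      realize_tm, elim_up, elim_new]
    have key (x : ℚ≥0) : (if b then add (add (tm (new (0 : Fin 1))) (tm (new (0 : Fin 1))))
          (tm (up 1 y)) else add (tm (new (0 : Fin 1))) (tm (new (0 : Fin 1)))).realize
          (Sum.elim v (Fin.append xs fun _ : Fin 1 => x)) =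
        x + x + b.toNat * Sum.elim v xs y := by
      cases b <;> simp [realize_add, realize_tm, elim_up, elim_new]
    have hbit : ((Nat.bit b a : ℕ) : ℚ≥0) = a + a + b.toNat := by
      rw [Nat.bit_val]
      push_cast
      ring
    constructor
    · rintro ⟨u, h1, h2⟩
      obtain ⟨x, rfl⟩ : ∃ x, u = fun _ => x := ⟨u 0, funext fun i => by rw [Subsingleton.elim i 0]⟩
      rw [key] at h1
      replace h2 : x = a * Sum.elim v xs y := h2
      rw [h1, h2, hbit]
      ring
    · intro h1
      refine ⟨fun _ => a * Sum.elim v xs y, ?_, rfl⟩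
      rw [key, h1, hbit]
      ring

/-- The variables of the summands live in the outer scope, hence the shift `up k`. -/
theorem realize_lin (k : ℕ) (xs : Fin (n + k) → ℚ≥0) (l : List (ℕ × (α ⊕ Fin n)))
    (s : α ⊕ Fin (n + k)) :
    (lin k l s).Realize v xs ↔
      Sum.elim v xs s = (l.map fun a => (a.1 : ℚ≥0) * Sum.elim v xs (up k a.2)).sum := by
  induction l generalizing k with
  | nil => exact realize_zero v xs s
  | cons a l ih =>
    obtain ⟨a, y⟩ := a
    have hup (y : α ⊕ Fin n) : (up (k + 2) y : α ⊕ Fin (n + (k + 2))) = up 2 (up k y) := by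
      rcases y with y | y <;> rfl
    rw [lin]
    refine (realize_exN v xs (k := 2) _).trans ?_
    have key (u : Fin 2 → ℚ≥0) :=
      ih (k + 2) (Fin.append (m := n + k) xs u) (new (n := n + k) (1 : Fin 2))
    simp only [hup] at key
    simp only [Language.BoundedFormula.realize_inf, Language.BoundedFormula.realize_bdEqual,
      realize_add, realize_tm, List.map_cons, List.sum_cons, hup, realize_mul]
    constructor
    · rintro ⟨u, ⟨h1, h2⟩, h3⟩
      have h4 := (key u).1 h3
      simp only [elim_up, elim_new] at h1 h2 h4
      rw [h1, h2, h4]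
    · intro h
      let u : Fin 2 → ℚ≥0 := ![(a : ℚ≥0) * Sum.elim v xs (up k y),
        (l.map fun a => (a.1 : ℚ≥0) * Sum.elim v xs (up k a.2)).sum]
      refine ⟨u, ⟨?_, ?_⟩, (key u).2 ?_⟩
      · simp only [elim_up, elim_new]
        exact h
      · simp only [elim_up, elim_new]
        rfl
      · simp only [elim_up, elim_new]
        rfl

end Realize

section Net

variable {np nt : ℕ}

theorem sum_rowTerms (a : Fin np → Fin nt → ℕ) (p : Fin np) (f : Fin nt → ℚ≥0)
    (g : (Fin np ⊕ Fin np) ⊕ Fin nt → ℚ≥0) (hg : ∀ t, g (yVar t) = f t) :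
    ((rowTerms a p).map fun b => (b.1 : ℚ≥0) * g b.2).sum = ∑ t, f t * a p t := by
  have (l : List (Fin nt)) :
      (((l.filter fun t => 0 < a p t).map fun t => (a p t, yVar (np := np) t)).map
        fun b => (b.1 : ℚ≥0) * g b.2).sum = (l.map fun t => f t * a p t).sum := by
    induction l with
    | nil => rfl
    | cons t l ih =>
      rcases Nat.eq_zero_or_pos (a p t) with h | h
      · simpa [h] using ih
      · rw [List.filter_cons_of_pos (by simpa using h), List.map_cons, List.map_cons,
          List.sum_cons, ih, List.map_cons, List.sum_cons, hg, mul_comm]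
  rw [rowTerms, this, ← List.ofFn_eq_map, List.sum_ofFn]

theorem realize_eqnFormula (N : PetriNet (Fin np) (Fin nt)) (w x : Fin np → ℚ≥0)
    (y : Fin nt → ℚ≥0) :
    (eqnFormula N).Realize (Sum.elim w x) y ↔
      ∀ p, x p + ∑ t, y t * N.pre p t = w p + ∑ t, y t * N.post p t := by
  rw [eqnFormula, realize_conj]
  simp only [List.mem_finRange, true_imp_iff]
  refine forall_congr' fun p => ?_
  refine (realize_exN _ y (k := 2) _).trans ?_
  have hsum (a : Fin np → Fin nt → ℕ) (u : Fin 2 → ℚ≥0) :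
      ((rowTerms a p).map fun b => (b.1 : ℚ≥0) *
        Sum.elim (Sum.elim w x) (Fin.append y u) (up 2 b.2)).sum = ∑ t, y t * a p t :=
    sum_rowTerms a p y (fun b => Sum.elim (Sum.elim w x) (Fin.append y u) (up 2 b))
      fun t => by rw [elim_up]; rfl
  simp only [Language.BoundedFormula.realize_inf, Language.BoundedFormula.realize_bdEqual,
    realize_add, realize_tm, realize_lin, elim_new, hsum, Sum.elim_inl, Sum.elim_inr]
  constructor
  · rintro ⟨u, h1, h2, h3⟩
    rwa [h1, h2] at h3
  · intro h
    exact ⟨![_, _], rfl, rfl, h⟩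

theorem realize_fsFormula (N : PetriNet (Fin np) (Fin nt)) (mark : Fin np → Fin np ⊕ Fin np)
    (v : Fin np ⊕ Fin np → ℚ≥0) (y : Fin nt → ℚ≥0) :
    (fsFormula N mark).Realize v y ↔
      Function.support y ∈ N.firingSet fun p => v (mark p) := by
  rw [PetriNet.mem_firingSet_iff_orderable, PetriNet.orderable_iff_exists_labelling, fsFormula,
    realize_exN]
  have hy (u : Fin (np + nt) → ℚ≥0) (t : Fin nt) :
      Sum.elim v (Fin.append y u) (yVar' t) = y t := by rw [yVar', elim_up]; rfl
  have hp (u : Fin (np + nt) → ℚ≥0) (p : Fin np) :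
      Sum.elim v (Fin.append y u) (zPlace p) = u (Fin.castAdd nt p) := by rw [zPlace, elim_new]
  have ht (u : Fin (np + nt) → ℚ≥0) (t : Fin nt) :
      Sum.elim v (Fin.append y u) (zTrans t) = u (Fin.natAdd np t) := by rw [zTrans, elim_new]
  have key (u : Fin (np + nt) → ℚ≥0) :
      (dtFormula N ⊓ mkFormula N mark).Realize v (Fin.append y u) ↔
        (∀ t, 0 < y t → ∀ p, 0 < N.pre p t →
          0 < u (Fin.castAdd nt p) ∧ u (Fin.castAdd nt p) ≤ u (Fin.natAdd np t)) ∧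
        ∀ p, 0 < u (Fin.castAdd nt p) → 0 < v (mark p) ∨
          ∃ t, 0 < N.post p t ∧ 0 < y t ∧ u (Fin.natAdd np t) < u (Fin.castAdd nt p) := by
    simp only [Language.BoundedFormula.realize_inf, dtFormula, mkFormula, realize_conj,
      realize_disj, Language.BoundedFormula.realize_imp, Language.BoundedFormula.realize_not,
      Language.BoundedFormula.realize_sup, realize_pos, realize_gt, realize_tm, hy, hp, ht,
      List.mem_filter, List.mem_finRange, true_and, decide_eq_true_eq, true_imp_iff, not_lt,
      gt_iff_lt, Sum.elim_inl]
  simp only [key, Function.mem_support, ← pos_iff_ne_zero, Set.mem_ofPred_eq]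
  constructor
  · rintro ⟨u, h1, h2⟩
    exact ⟨fun p => u (Fin.castAdd nt p), fun t => u (Fin.natAdd np t), h1, h2⟩
  · rintro ⟨a, b, h1, h2⟩
    exact ⟨Fin.append a b, by simpa using h1, by simpa using h2⟩

theorem realize_reachFormula (N : PetriNet (Fin np) (Fin nt)) (w x : Fin np → ℚ≥0) :
    (reachFormula N).Realize (Sum.elim w x) ↔ N.QReachable w x := by
  rw [reachFormula, Language.BoundedFormula.realize_exs, PetriNet.qReachable_iff]
  simp only [Language.BoundedFormula.realize_inf, realize_eqnFormula, realize_fsFormula,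
    Sum.elim_inl, Sum.elim_inr]

theorem state_eq_iff (N : PetriNet (Fin np) (Fin nt)) (w x : Fin np → ℚ≥0) (y : Fin nt → ℚ≥0)
    (p : Fin np) :
    x p + ∑ t, y t * N.pre p t = w p + ∑ t, y t * N.post p t ↔
      (x p : ℚ) = (∑ t, (N.incidence p t : ℚ) * (y t : ℚ)) + (w p : ℚ) := by
  rw [← NNRat.coe_inj]
  simp only [PetriNet.incidence]
  push_cast
  simp only [sub_mul, Finset.sum_sub_distrib, mul_comm (y _ : ℚ)]
  constructor <;> intro h <;> linarith

end Net

end AddGt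

/-! ### Lists indexed by initial segments -/

section Lists

variable {β : Type}

theorem flatMap_finRange (n : ℕ) (g : ℕ → List β) :
    (List.finRange n).flatMap (fun i : Fin n => g i) = (List.range n).flatMap g := by
  rw [← List.map_coe_finRange_eq_range, List.flatMap_map]

theorem flatMap_filter_finRange (n : ℕ) (P : Fin n → Prop) [DecidablePred P] (Q : ℕ → Prop)
    [DecidablePred Q] (h : ∀ i : Fin n, P i ↔ Q i) (g : ℕ → List β) :
    ((List.finRange n).filter fun i => P i).flatMap (fun i : Fin n => g i) =
      (List.range n).flatMap fun i => if Q i then g i else [] := by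
  rw [← flatMap_finRange]
  induction List.finRange n with
  | nil => rfl
  | cons i l ih => by_cases hi : P i <;> simp [hi, ih, ← h]

theorem flatMap_range_succ (n : ℕ) (g : ℕ → List β) :
    (List.range (n + 1)).flatMap g = (List.range n).flatMap g ++ g n := by
  rw [List.range_succ, List.flatMap_append, List.flatMap_singleton]

theorem flatMap_range_succ' (n : ℕ) (g : ℕ → List β) :
    (List.range (n + 1)).flatMap g = g 0 ++ (List.range n).flatMap fun i => g (i + 1) := by
  rw [List.range_succ_eq_map, List.flatMap_cons, List.flatMap_map]

theorem length_flatMap_range (n : ℕ) (g : ℕ → List β) :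
    ((List.range n).flatMap g).length = ∑ i ∈ Finset.range n, (g i).length := by
  induction n with
  | zero => rfl
  | succ n ih => rw [flatMap_range_succ, List.length_append, ih, Finset.sum_range_succ]

theorem flatMap_range_congr {n : ℕ} {f g : ℕ → List β} (h : ∀ i < n, f i = g i) :
    (List.range n).flatMap f = (List.range n).flatMap g := by
  induction n with
  | zero => rfl
  | succ n ih =>
    rw [flatMap_range_succ, flatMap_range_succ, ih fun i hi => h i (by omega), h n (by omega)]

end Lists

namespace AddGt

/-! ### The words of the formulas -/

section Words

/-- The words of the formula `s = 0`. -/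
def zeroWords (s : ℕ) : List ℕ := [5, 2, s, 3, 2, s, 2, s]

/-- The words of the formula `v > 0` for a bound variable. -/
def posWords (v : ℕ) : List ℕ := [6, 3, 2, v, 2, v, 2, v]

/-- The words by which one binary digit `b` contributes to the formula `s = a * y`, up to the
formula for the remaining digits; `u` is the variable quantified here. -/
def digitWords (b : Bool) (y s u : ℕ) : List ℕ :=
  [7, 8, 7, 7, 7, 5, 2, s] ++ (if b then [3, 3, 2, u, 2, u, 2, y] else [3, 2, u, 2, u]) ++ [7]

/-- The words of the formula `s = a * y` in the scope of `D` bound variables. -/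
def mulWords (a y s D : ℕ) : List ℕ :=
  ((List.range a.size).flatMap fun j =>
    digitWords (a.bits.getD j false) y (if j = 0 then s else D + j - 1) (D + j)) ++
  zeroWords (if a.size = 0 then s else D + a.size - 1) ++
  (List.range a.size).flatMap fun _ => [4, 4, 4, 4]

/-- The words by which one summand `a * y` contributes to a linear form with value `s`, up to the
formula for the remaining summands. -/
def summandWords (a y s D : ℕ) : List ℕ :=
  [7, 8, 7, 7, 8, 7, 7, 7, 7, 7, 5, 2, s, 3, 2, D, 2, D + 1, 7] ++ mulWords a y D (D + 2) ++
    [4, 4, 7]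

/-- The variable to which the sum over the indices from `t` on is equated in the formula for
`s = ∑ A t * y t`, in the scope of `D` bound variables. -/
def restVar (A : ℕ → ℕ) (s D t : ℕ) : ℕ :=
  if Nat.count (0 < A ·) t = 0 then s else D + 2 * Nat.count (0 < A ·) t - 1

/-- The words of the formula `s = ∑ A t * y t`, the sum over the `t < n` with `A t ≠ 0`, in the
scope of `D` bound variables. -/
def linWords (A : ℕ → ℕ) (n s D : ℕ) : List ℕ :=
  ((List.range n).flatMap fun t =>
    if 0 < A t then
      summandWords (A t) t (restVar A s D t) (D + 2 * Nat.count (0 < A ·) t) else []) ++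
  zeroWords (restVar A s D n) ++
  (List.range n).flatMap fun t => if 0 < A t then [4, 4, 4, 4, 4, 4] else []

/-- The words of the conjunction of the formulas with words `f i` for `i < n`. -/
def conjWords (n : ℕ) (f : ℕ → List ℕ) : List ℕ :=
  ((List.range n).flatMap fun i => [7, 7] ++ f i ++ [7]) ++ [7, 4, 4] ++
    (List.range n).flatMap fun _ => [4, 4]

/-- The words of the conjunction over those `i < n` with `A i ≠ 0`. -/
def conjWords' (A : ℕ → ℕ) (n : ℕ) (f : ℕ → List ℕ) : List ℕ :=
  ((List.range n).flatMap fun i => if 0 < A i then [7, 7] ++ f i ++ [7] else []) ++ [7, 4, 4] ++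
    (List.range n).flatMap fun i => if 0 < A i then [4, 4] else []

/-- The words of the disjunction over those `i < n` with `A i ≠ 0`. -/
def disjWords' (A : ℕ → ℕ) (n : ℕ) (f : ℕ → List ℕ) : List ℕ :=
  ((List.range n).flatMap fun i => if 0 < A i then [7, 7] ++ f i ++ [4] else []) ++ [4]

/-- The words of a formula with words `l` preceded by `k` existential quantifiers. -/
def exWords (k : ℕ) (l : List ℕ) : List ℕ :=
  ((List.range k).flatMap fun _ => [7, 8, 7]) ++ l ++ (List.range k).flatMap fun _ => [4, 4]

/-- The words of the row of the place `p` in the state equation. -/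
def rowWords (nt : ℕ) (pre post : ℕ → ℕ → ℕ) (p : ℕ) : List ℕ :=
  [7, 8, 7, 7, 8, 7, 7, 7] ++ linWords (pre p) nt nt (nt + 2) ++ [7, 7, 7] ++
    linWords (post p) nt (nt + 1) (nt + 2) ++
    [7, 5, 3, 1, p, 2, nt, 3, 0, p, 2, nt + 1, 4, 4, 4, 4, 4, 4, 4, 4]

/-- The words of the formula for the transitions in the description of the firing set. -/
def dtWords (np nt : ℕ) (pre : ℕ → ℕ → ℕ) : List ℕ :=
  conjWords nt fun t => [7] ++ posWords t ++ conjWords' (pre · t) np fun p =>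
    [7, 7] ++ posWords (nt + p) ++ [7, 7, 6, 2, nt + p, 2, nt + np + t, 4, 4, 4]

/-- The words of the formula for the places in the description of the firing set. Here `b` is the
tag for the kind of the free variables that describe the marking. -/
def mkWords (np nt : ℕ) (post : ℕ → ℕ → ℕ) (b : ℕ) : List ℕ :=
  conjWords np fun p => [7] ++ posWords (nt + p) ++
    ([7, 7, 6, 3, b, p, b, p, b, p, 4] ++ disjWords' (post p) nt fun t =>
      [7, 7] ++ posWords t ++ [7, 6, 2, nt + p, 2, nt + np + t, 4, 4])

/-- The words of the formula for the firing set. -/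
def fsWords (np nt : ℕ) (pre post : ℕ → ℕ → ℕ) (b : ℕ) : List ℕ :=
  exWords (np + nt) ([7, 7] ++ dtWords np nt pre ++ [7] ++ mkWords np nt post b ++ [4, 4])

/-- The words of the formula for reachability. -/
def reachWords (np nt : ℕ) (pre post : ℕ → ℕ → ℕ) : List ℕ :=
  exWords nt ([7, 7] ++ conjWords np (rowWords nt pre post) ++ [7] ++
    ([7, 7] ++ fsWords np nt pre post 0 ++ [7] ++ fsWords np nt post pre 1 ++ [4, 4]) ++ [4, 4])

end Words

/-- A matrix as a function on pairs of natural numbers, with zeros outside of its range. -/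
def extend {np nt : ℕ} (a : Fin np → Fin nt → ℕ) (p t : ℕ) : ℕ :=
  if h : p < np ∧ t < nt then a ⟨p, h.1⟩ ⟨t, h.2⟩ else 0

theorem extend_coe {np nt : ℕ} (a : Fin np → Fin nt → ℕ) (p : Fin np) (t : Fin nt) :
    extend a p t = a p t := by
  simp [extend]

section Code

variable {np n : ℕ}

theorem code_imp (φ ψ : lang.BoundedFormula (Fin np ⊕ Fin np) n) :
    code (φ.imp ψ) = 7 :: (code φ ++ code ψ) := rfl

theorem code_inf (φ ψ : lang.BoundedFormula (Fin np ⊕ Fin np) n) :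
    code (φ ⊓ ψ) = [7, 7] ++ code φ ++ [7] ++ code ψ ++ [4, 4] := by
  have : code (φ ⊓ ψ) = 7 :: ((7 :: (code φ ++ (7 :: (code ψ ++ [4])))) ++ [4]) := rfl
  simp [this]

theorem code_sup (φ ψ : lang.BoundedFormula (Fin np ⊕ Fin np) n) :
    code (φ ⊔ ψ) = [7, 7] ++ code φ ++ [4] ++ code ψ := by
  have : code (φ ⊔ ψ) = 7 :: ((7 :: (code φ ++ [4])) ++ code ψ) := rfl
  simp [this]

theorem code_ex (φ : lang.BoundedFormula (Fin np ⊕ Fin np) (n + 1)) :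
    code φ.ex = [7, 8, 7] ++ code φ ++ [4, 4] := by
  have : code φ.ex = 7 :: ((8 :: (7 :: (code φ ++ [4]))) ++ [4]) := rfl
  simp [this]

theorem code_not_gt (v w : (Fin np ⊕ Fin np) ⊕ Fin n) :
    code (gt (tm v) (tm w)).not = [7, 6] ++ varCode v ++ varCode w ++ [4] := by
  have : code (gt (tm v) (tm w)).not = 7 :: ((6 :: (varCode v ++ varCode w)) ++ [4]) := rfl
  simp [this]

theorem code_gt (v w : (Fin np ⊕ Fin np) ⊕ Fin n) :
    code (gt (tm v) (tm w)) = [6] ++ varCode v ++ varCode w := rfl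

theorem code_pos (v : (Fin np ⊕ Fin np) ⊕ Fin n) :
    code (pos v) = [6, 3] ++ varCode v ++ varCode v ++ varCode v := by
  have : code (pos v) = 6 :: ((3 :: (varCode v ++ varCode v)) ++ varCode v) := rfl
  simp [this]

theorem code_zero (v : (Fin np ⊕ Fin np) ⊕ Fin n) :
    code (zero v) = [5] ++ varCode v ++ [3] ++ varCode v ++ varCode v := by
  have : code (zero v) = 5 :: (varCode v ++ (3 :: (varCode v ++ varCode v))) := rfl
  simp [this]

theorem code_conj {ι : Type} (l : List ι) (f : ι → lang.BoundedFormula (Fin np ⊕ Fin np) n) :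
    code (conj l f) = (l.flatMap fun i => [7, 7] ++ code (f i) ++ [7]) ++ [7, 4, 4] ++
      l.flatMap fun _ => [4, 4] := by
  induction l with
  | nil => rfl
  | cons i l ih =>
    have hc : ([4, 4] : List ℕ) ++ (l.flatMap fun _ => [4, 4]) =
        (l.flatMap fun _ => [4, 4]) ++ [4, 4] := by
      clear ih
      induction l with
      | nil => rfl
      | cons _ l ih => rw [List.flatMap_cons, List.append_assoc, ← ih]
    have : conj (i :: l) f = f i ⊓ conj l f := rfl
    rw [this, code_inf, ih, List.flatMap_cons, List.flatMap_cons, hc]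
    simp only [List.append_assoc]

theorem code_disj {ι : Type} (l : List ι) (f : ι → lang.BoundedFormula (Fin np ⊕ Fin np) n) :
    code (disj l f) = (l.flatMap fun i => [7, 7] ++ code (f i) ++ [4]) ++ [4] := by
  induction l with
  | nil => rfl
  | cons i l ih =>
    have : disj (i :: l) f = f i ⊔ disj l f := rfl
    rw [this, code_sup, ih, List.flatMap_cons]
    simp only [List.append_assoc]

theorem code_conj_finRange (k : ℕ) (f : Fin k → lang.BoundedFormula (Fin np ⊕ Fin np) n)
    (g : ℕ → List ℕ) (h : ∀ i, code (f i) = g i) :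
    code (conj (List.finRange k) f) = conjWords k g := by
  simp only [code_conj, h, conjWords]
  rw [flatMap_finRange k fun i => [7, 7] ++ g i ++ [7], flatMap_finRange k (fun _ => [4, 4])]

theorem code_conj_filter (k : ℕ) (a : Fin k → ℕ) (A : ℕ → ℕ) (hA : ∀ i : Fin k, a i = A i)
    (f : Fin k → lang.BoundedFormula (Fin np ⊕ Fin np) n)
    (g : ℕ → List ℕ) (h : ∀ i, code (f i) = g i) :
    code (conj ((List.finRange k).filter fun i => 0 < a i) f) = conjWords' A k g := by
  simp only [code_conj, h, conjWords']
  rw [flatMap_filter_finRange k (fun i => 0 < a i) (fun i => 0 < A i) (by simp [hA])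
      (fun i => [7, 7] ++ g i ++ [7]),
    flatMap_filter_finRange k (fun i => 0 < a i) (fun i => 0 < A i) (by simp [hA])
      (fun _ => [4, 4])]

theorem code_disj_filter (k : ℕ) (a : Fin k → ℕ) (A : ℕ → ℕ) (hA : ∀ i : Fin k, a i = A i)
    (f : Fin k → lang.BoundedFormula (Fin np ⊕ Fin np) n)
    (g : ℕ → List ℕ) (h : ∀ i, code (f i) = g i) :
    code (disj ((List.finRange k).filter fun i => 0 < a i) f) = disjWords' A k g := by
  simp only [code_disj, h, disjWords']
  rw [flatMap_filter_finRange k (fun i => 0 < a i) (fun i => 0 < A i) (by simp [hA])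
      (fun i => [7, 7] ++ g i ++ [4])]

/-- Quantifiers are added at the inner end, as in the definition of `exN`. -/
theorem exWords_succ (k : ℕ) (l : List ℕ) :
    exWords (k + 1) l = exWords k ([7, 8, 7] ++ l ++ [4, 4]) := by
  rw [exWords, exWords, flatMap_range_succ, flatMap_range_succ']
  simp only [List.append_assoc]

theorem code_exN (k : ℕ) (φ : lang.BoundedFormula (Fin np ⊕ Fin np) (n + k)) :
    code (exN k φ) = exWords k (code φ) := by
  induction k with
  | zero => simp [exN, exWords]
  | succ k ih => rw [exWords_succ, ← code_ex, ← ih]; rfl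

theorem code_exs (φ : lang.BoundedFormula (Fin np ⊕ Fin np) n) :
    code φ.exs = exWords n (code φ) := by
  induction n with
  | zero => simp [Language.BoundedFormula.exs, exWords]
  | succ n ih => rw [exWords_succ, ← code_ex, ← ih]; rfl

/-- The words of `s = a * y` in recursive form, by the list of binary digits of `a`. -/
theorem code_mul_bits (bs : List Bool) (y s : Fin n) :
    code (mul bs (Sum.inr y : (Fin np ⊕ Fin np) ⊕ Fin n) (Sum.inr s)) =
      ((List.range bs.length).flatMap fun j =>
        digitWords (bs.getD j false) y (if j = 0 then s else n + j - 1) (n + j)) ++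
      zeroWords (if bs.length = 0 then s else n + bs.length - 1) ++
      (List.range bs.length).flatMap fun _ => [4, 4, 4, 4] := by
  induction bs generalizing n with
  | nil => rw [mul, code_zero]; rfl
  | cons b bs ih =>
    rw [mul, code_ex, code_inf]
    have h1 := ih (n := n + 1) (Fin.castAdd 1 y) (Fin.natAdd n 0)
    have h2 : mul bs (up 1 (Sum.inr y : (Fin np ⊕ Fin np) ⊕ Fin n)) (new (0 : Fin 1)) =
      mul bs (Sum.inr (Fin.castAdd 1 y)) (Sum.inr (Fin.natAdd n 0)) := rfl
    rw [h2, h1, List.length_cons, flatMap_range_succ', flatMap_range_succ]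
    have h3 : [7, 8, 7] ++ ([7, 7] ++ code ((tm (up 1 (Sum.inr s))).bdEqual
        (if b then add (add (tm (new (0 : Fin 1))) (tm (new (0 : Fin 1))))
          (tm (up 1 (Sum.inr y : (Fin np ⊕ Fin np) ⊕ Fin n)))
        else add (tm (new (0 : Fin 1))) (tm (new (0 : Fin 1))))) ++ [7]) =
        digitWords b y s n := by
      cases b <;> rfl
    have h4 : (List.range bs.length).flatMap (fun j => digitWords (bs.getD j false)
          (Fin.castAdd 1 y : Fin (n + 1)) (if j = 0 then ((Fin.natAdd n 0 : Fin (n + 1)) : ℕ)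
          else n + 1 + j - 1) (n + 1 + j)) =
        (List.range bs.length).flatMap (fun j => digitWords ((b :: bs).getD (j + 1) false)
          y (if j + 1 = 0 then (s : ℕ) else n + (j + 1) - 1) (n + (j + 1))) := by
      refine flatMap_range_congr fun j _ => ?_
      have e1 : (if j = 0 then ((Fin.natAdd n 0 : Fin (n + 1)) : ℕ) else n + 1 + j - 1) =
          n + (j + 1) - 1 := by
        split_ifs with h
        · simp [h]
        · omega
      rw [e1, if_neg (Nat.succ_ne_zero j), List.getD_cons_succ, Fin.val_castAdd,
        show n + 1 + j = n + (j + 1) by omega]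
    have h5 : (if bs.length = 0 then ((Fin.natAdd n 0 : Fin (n + 1)) : ℕ)
        else n + 1 + bs.length - 1) = if bs.length + 1 = 0 then (s : ℕ) else
          n + (bs.length + 1) - 1 := by
      rw [if_neg (Nat.succ_ne_zero _)]
      split_ifs with h
      · simp [h]
      · omega
    rw [h4, h5, List.getD_cons_zero, if_pos rfl, add_zero, ← h3]
    simp only [List.append_assoc]
    rfl

theorem code_mul (a : ℕ) (y s : Fin n) :
    code (mul a.bits (Sum.inr y : (Fin np ⊕ Fin np) ⊕ Fin n) (Sum.inr s)) =
      mulWords a y s n := by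
  rw [code_mul_bits, mulWords, Nat.size_eq_bits_len]

theorem restVar_succ (A : ℕ → ℕ) (s D t : ℕ) :
    restVar A s D (t + 1) =
      if 0 < A t then D + 2 * Nat.count (0 < A ·) t + 1 else restVar A s D t := by
  unfold restVar
  rw [Nat.count_succ]
  by_cases h : 0 < A t
  · rw [if_pos h, if_pos h, if_neg (by omega)]
    omega
  · rw [if_neg h, if_neg h, add_zero]

theorem linWords_zero (A : ℕ → ℕ) (s D : ℕ) : linWords A 0 s D = zeroWords s := by
  simp [linWords, restVar]

/-- The words of the formula for a linear form whose terms are the non-zero ones among `A t`, for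
`t < m`, with the variable of number `o + t`. The shift by `o` serves the induction on `m`, which
removes the first index because the formula nests from the left. -/
theorem code_lin_shift {nt : ℕ} (k m o : ℕ) (A : ℕ → ℕ) (f : ℕ → Fin nt)
    (hf : ∀ t < m, (f t : ℕ) = o + t) (s : Fin (nt + k)) :
    code (lin k (((List.range m).filter fun t => 0 < A t).map fun t =>
        (A t, (Sum.inr (f t) : (Fin np ⊕ Fin np) ⊕ Fin nt))) (Sum.inr s)) =
      ((List.range m).flatMap fun t => if 0 < A t then
        summandWords (A t) (o + t) (restVar A s (nt + k) t)
          (nt + k + 2 * Nat.count (0 < A ·) t) else []) ++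
      zeroWords (restVar A s (nt + k) m) ++
      (List.range m).flatMap fun t => if 0 < A t then [4, 4, 4, 4, 4, 4] else [] := by
  induction m generalizing k o A f s with
  | zero =>
    simp only [List.range_zero, List.filter_nil, List.map_nil, List.flatMap_nil, lin]
    rw [code_zero]
    simp [restVar, zeroWords, varCode]
  | succ m ih =>
    have hr : (((List.range (m + 1)).filter fun t => 0 < A t).map fun t =>
        (A t, (Sum.inr (f t) : (Fin np ⊕ Fin np) ⊕ Fin nt))) =
        (if 0 < A 0 then [(A 0, Sum.inr (f 0))] else []) ++
        (((List.range m).filter fun t => 0 < A (t + 1)).map fun t =>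
        (A (t + 1), (Sum.inr (f (t + 1)) : (Fin np ⊕ Fin np) ⊕ Fin nt))) := by
      rw [List.range_succ_eq_map, List.filter_cons]
      by_cases h : 0 < A 0 <;> simp [h, List.filter_map, Function.comp_def]
    have hfs (t : ℕ) (ht : t < m) : (f (t + 1) : ℕ) = o + 1 + t := by
      rw [hf _ (by omega)]
      omega
    rw [hr, flatMap_range_succ']
    by_cases h : 0 < A 0
    · have hsuf (l : ℕ) : ((List.range (l + 1)).flatMap fun t =>
          if 0 < A t then [4, 4, 4, 4, 4, 4] else []) =
          ((List.range l).flatMap fun t =>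
            if 0 < A (t + 1) then [4, 4, 4, 4, 4, 4] else []) ++ [4, 4, 4, 4, 4, 4] := by
        induction l with
        | zero => simp [h]
        | succ l ih =>
          rw [flatMap_range_succ, ih, flatMap_range_succ]
          split_ifs <;> simp
      have hrv (t : ℕ) : restVar A s (nt + k) (t + 1) =
          restVar (fun t => A (t + 1)) (nt + k + 1) (nt + (k + 2)) t := by
        unfold restVar
        rw [Nat.count_succ', if_pos h, if_neg (by omega)]
        by_cases hc : Nat.count (fun t => 0 < A (t + 1)) t = 0
        · rw [if_pos hc]
          omega
        · rw [if_neg hc]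
          beta_reduce
          omega
      have hcount (t : ℕ) : nt + k + 2 * Nat.count (0 < A ·) (t + 1) =
          nt + (k + 2) + 2 * Nat.count (fun t => 0 < A (t + 1)) t := by
        rw [Nat.count_succ', if_pos h]
        omega
      have ih' := ih (k + 2) (o + 1) (fun t => A (t + 1)) (fun t => f (t + 1)) hfs
        (Fin.natAdd (nt + k) (1 : Fin 2))
      rw [if_pos h, List.singleton_append, hsuf, if_pos h]
      simp only [hrv, hcount]
      rw [lin]
      refine (code_exN (n := nt + k) 2 _).trans ?_
      rw [code_inf, code_inf]
      have hm := code_mul (np := np) (A 0) (Fin.castAdd (k + 2) (f 0))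
        (Fin.natAdd (nt + k) (0 : Fin 2))
      have e1 : code (mul (A 0).bits (up (k + 2) (Sum.inr (f 0) : (Fin np ⊕ Fin np) ⊕ Fin nt))
          (new (n := nt + k) (0 : Fin 2))) = mulWords (A 0) o (nt + k) (nt + k + 2) := by
        refine hm.trans ?_
        rw [Fin.val_castAdd, hf 0 (by omega)]
        rfl
      have e2 := ih'
      have e3 : code ((tm (up 2 (Sum.inr s : (Fin np ⊕ Fin np) ⊕ Fin (nt + k)))).bdEqual
          (add (tm (new (n := nt + k) (0 : Fin 2))) (tm (new (n := nt + k) (1 : Fin 2))))) =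
          [5, 2, (s : ℕ), 3, 2, nt + k, 2, nt + k + 1] := rfl
      have e4 : restVar A s (nt + k) 0 = s := by simp [restVar]
      have e5 : ((Fin.natAdd (nt + k) (1 : Fin 2) : Fin (nt + k + 2)) : ℕ) = nt + k + 1 := rfl
      have e6 (t : ℕ) : o + 1 + t = o + (t + 1) := by omega
      rw [e1, e3, e4, Nat.count_zero]
      refine (congrArg (fun l => exWords 2 (_ ++ [7] ++ l ++ [4, 4])) e2).trans ?_
      rw [e5]
      simp only [e6, exWords, summandWords, List.range_succ, List.range_zero, List.append_assoc,
        List.nil_append, List.flatMap_cons, List.flatMap_nil,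
        List.cons_append, mul_zero, add_zero]
    · have hsuf : ((List.range (m + 1)).flatMap fun t =>
          if 0 < A t then [4, 4, 4, 4, 4, 4] else []) =
          (List.range m).flatMap fun t =>
            if 0 < A (t + 1) then [4, 4, 4, 4, 4, 4] else [] := by
        rw [flatMap_range_succ', if_neg h, List.nil_append]
      have hcount (t : ℕ) : Nat.count (0 < A ·) (t + 1) =
          Nat.count (fun t => 0 < A (t + 1)) t := by
        rw [Nat.count_succ', if_neg h, add_zero]
      have hrv (t : ℕ) : restVar A s (nt + k) (t + 1) =
          restVar (fun t => A (t + 1)) s (nt + k) t := by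
        unfold restVar
        rw [hcount]
      have e6 (t : ℕ) : o + 1 + t = o + (t + 1) := by omega
      rw [if_neg h, if_neg h, hsuf, List.nil_append, List.nil_append,
        ih k (o + 1) (fun t => A (t + 1)) (fun t => f (t + 1)) hfs s]
      simp only [hrv, hcount, e6]

theorem code_lin {nt : ℕ} (k : ℕ) (a : Fin np → Fin nt → ℕ) (p : Fin np) (s : Fin (nt + k)) :
    code (lin k (rowTerms a p) (Sum.inr s)) = linWords (extend a p) nt s (nt + k) := by
  rcases Nat.eq_zero_or_pos nt with rfl | hnt
  · rw [linWords_zero]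
    simp only [rowTerms, List.finRange_zero, List.filter_nil, List.map_nil, lin]
    rw [code_zero]
    rfl
  have : rowTerms a p = ((List.range nt).filter fun t => 0 < extend a p t).map fun t =>
      (extend a p t, Sum.inr (if h : t < nt then ⟨t, h⟩ else ⟨0, hnt⟩)) := by
    rw [rowTerms, ← List.map_coe_finRange_eq_range, List.filter_map, List.map_map]
    simp [Function.comp_def, extend_coe, yVar]
  rw [this, code_lin_shift k nt 0 (extend a p) _ (fun t ht => by simp [ht]), linWords]
  simp only [zero_add]

variable {nt : ℕ}

theorem code_eqnFormula (N : PetriNet (Fin np) (Fin nt)) :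
    code (eqnFormula N) = conjWords np (rowWords nt (extend N.pre) (extend N.post)) := by
  refine code_conj_finRange _ _ _ fun p => ?_
  refine (code_exN (n := nt) 2 _).trans ?_
  rw [code_inf, code_inf]
  have h1 := code_lin 2 N.pre p (Fin.natAdd nt (0 : Fin 2))
  have h2 := code_lin 2 N.post p (Fin.natAdd nt (1 : Fin 2))
  have h3 : code ((add (tm (Sum.inl (Sum.inr p))) (tm (new (n := nt) (0 : Fin 2)))).bdEqual
      (add (tm (Sum.inl (Sum.inl p))) (tm (new (n := nt) (1 : Fin 2))))) =
      [5, 3, 1, (p : ℕ), 2, nt, 3, 0, (p : ℕ), 2, nt + 1] := rfl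
  rw [h3]
  refine (congrArg₂ (fun l l' => exWords 2 ([7, 7] ++ l ++ [7] ++
    ([7, 7] ++ l' ++ [7] ++ _ ++ [4, 4]) ++ [4, 4])) h1 h2).trans ?_
  simp [exWords, rowWords, List.range_succ]

theorem code_fsFormula (N : PetriNet (Fin np) (Fin nt)) (mark : Fin np → Fin np ⊕ Fin np)
    (b : ℕ) (hb : ∀ p, varCode (n := nt + (np + nt)) (Sum.inl (mark p)) = [b, (p : ℕ)]) :
    code (fsFormula N mark) = fsWords np nt (extend N.pre) (extend N.post) b := by
  have hy (t : Fin nt) : varCode (yVar' (np := np) t) = [2, (t : ℕ)] := rfl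
  have hp (p : Fin np) : varCode (zPlace (nt := nt) p) = [2, nt + (p : ℕ)] := rfl
  have ht (t : Fin nt) : varCode (zTrans (np := np) t) = [2, nt + np + (t : ℕ)] := by
    rw [add_assoc]
    rfl
  have h1 : code (dtFormula N) = dtWords np nt (extend N.pre) := by
    refine code_conj_finRange _ _ _ fun t => ?_
    rw [code_imp, code_pos, code_conj_filter np (fun p => N.pre p t) (extend N.pre · t)
      (fun p => (extend_coe N.pre p t).symm) _ (fun p => [7, 7] ++ posWords (nt + p) ++
        [7, 7, 6, 2, nt + p, 2, nt + np + t, 4, 4, 4])]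
    · rw [hy]
      rfl
    · intro p
      rw [code_inf, code_pos, code_not_gt, hp, ht]
      simp [posWords]
  have h2 : code (mkFormula N mark) = mkWords np nt (extend N.post) b := by
    refine code_conj_finRange _ _ _ fun p => ?_
    rw [code_imp, code_sup, code_pos, code_pos, code_disj_filter nt (fun t => N.post p t)
      (extend N.post p) (fun t => (extend_coe N.post p t).symm) _ (fun t => [7, 7] ++ posWords t ++
        [7, 6, 2, nt + p, 2, nt + np + t, 4, 4])]
    · rw [hp, hb]
      rfl
    · intro t
      rw [code_inf, code_pos, code_gt, hp, ht, hy]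
      simp [posWords]
  rw [fsFormula, code_exN, code_inf, h1, h2]
  rfl

theorem code_reachFormula (N : PetriNet (Fin np) (Fin nt)) :
    code (reachFormula N) = reachWords np nt (extend N.pre) (extend N.post) := by
  rw [reachFormula, code_exs, code_inf, code_inf, code_eqnFormula, code_fsFormula _ _ 0 fun _ => rfl,
    code_fsFormula _ _ 1 fun _ => rfl]
  rfl

end Code

end AddGt

/-! ### The size of the formula -/

namespace AddGt

section Size

open Finset

theorem length_digitWords_le (b : Bool) (y s u : ℕ) : (digitWords b y s u).length ≤ 17 := by
  cases b <;> simp [digitWords]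

theorem length_mulWords_le (a y s D : ℕ) : (mulWords a y s D).length ≤ 8 + 21 * a.size := by
  have h1 : ∑ j ∈ range a.size, (digitWords (a.bits.getD j false) y (if j = 0 then s else D + j - 1)
      (D + j)).length ≤ a.size * 17 := by
    refine (sum_le_card_nsmul _ _ 17 fun j _ => length_digitWords_le _ _ _ _).trans_eq ?_
    simp
  simp only [mulWords, List.length_append, length_flatMap_range, zeroWords, List.length_cons,
    List.length_nil, sum_const, card_range, smul_eq_mul]
  omega

theorem length_summandWords_le (a y s D : ℕ) :
    (summandWords a y s D).length ≤ 30 + 21 * a.size := by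
  have := length_mulWords_le a y D (D + 2)
  simp only [summandWords, List.length_append, List.length_cons, List.length_nil]
  omega

theorem length_if_le {a c : ℕ} {l : List ℕ} (h : l.length ≤ c) :
    (if 0 < a then l else []).length ≤ c * a.size := by
  split_ifs with h0
  · have := Nat.size_pos.2 h0
    nlinarith
  · simp

theorem length_linWords_le (A : ℕ → ℕ) (n s D : ℕ) :
    (linWords A n s D).length ≤ 8 + 57 * ∑ t ∈ range n, (A t).size := by
  have h1 : ∑ t ∈ range n, (if 0 < A t then summandWords (A t) t (restVar A s D t)
      (D + 2 * Nat.count (0 < A ·) t) else []).length ≤ 51 * ∑ t ∈ range n, (A t).size := by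
    rw [mul_sum]
    refine sum_le_sum fun t _ => ?_
    split_ifs with h0
    · have := length_summandWords_le (A t) t (restVar A s D t) (D + 2 * Nat.count (0 < A ·) t)
      have := Nat.size_pos.2 h0
      omega
    · simp
  have h2 : ∑ t ∈ range n, (if 0 < A t then [4, 4, 4, 4, 4, 4] else []).length ≤
      6 * ∑ t ∈ range n, (A t).size := by
    rw [mul_sum]
    exact sum_le_sum fun t _ => length_if_le (by simp)
  simp only [linWords, List.length_append, length_flatMap_range, zeroWords, List.length_cons,
    List.length_nil]
  omega

theorem length_conjWords (n : ℕ) (f : ℕ → List ℕ) :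
    (conjWords n f).length = 3 + 5 * n + ∑ i ∈ range n, (f i).length := by
  simp only [conjWords, List.length_append, length_flatMap_range, List.length_cons,
    List.length_nil, sum_add_distrib, sum_const, card_range, smul_eq_mul]
  omega

theorem length_conjWords'_le (A : ℕ → ℕ) (n c : ℕ) (f : ℕ → List ℕ)
    (h : ∀ i, (f i).length ≤ c) :
    (conjWords' A n f).length ≤ 3 + (c + 5) * ∑ i ∈ range n, (A i).size := by
  have h1 : ∑ i ∈ range n, (if 0 < A i then [7, 7] ++ f i ++ [7] else []).length ≤
      (c + 3) * ∑ t ∈ range n, (A t).size := by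
    rw [mul_sum]
    refine sum_le_sum fun i _ => length_if_le ?_
    have := h i
    simp
    omega
  have h2 : ∑ i ∈ range n, (if 0 < A i then [4, 4] else []).length ≤
      2 * ∑ t ∈ range n, (A t).size := by
    rw [mul_sum]
    exact sum_le_sum fun i _ => length_if_le (by simp)
  simp only [conjWords', List.length_append, length_flatMap_range, List.length_cons,
    List.length_nil]
  linarith

theorem length_disjWords'_le (A : ℕ → ℕ) (n c : ℕ) (f : ℕ → List ℕ)
    (h : ∀ i, (f i).length ≤ c) :
    (disjWords' A n f).length ≤ 1 + (c + 3) * ∑ i ∈ range n, (A i).size := by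
  have h1 : ∑ i ∈ range n, (if 0 < A i then [7, 7] ++ f i ++ [4] else []).length ≤
      (c + 3) * ∑ t ∈ range n, (A t).size := by
    rw [mul_sum]
    refine sum_le_sum fun i _ => length_if_le ?_
    have := h i
    simp
    omega
  simp only [disjWords', List.length_append, length_flatMap_range, List.length_cons,
    List.length_nil]
  linarith

theorem length_exWords (k : ℕ) (l : List ℕ) : (exWords k l).length = 5 * k + l.length := by
  simp only [exWords, List.length_append, length_flatMap_range, List.length_cons,
    List.length_nil, sum_const, card_range, smul_eq_mul]
  omega

theorem length_rowWords_le (nt : ℕ) (pre post : ℕ → ℕ → ℕ) (p : ℕ) :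
    (rowWords nt pre post p).length ≤
      47 + 57 * ∑ t ∈ range nt, ((pre p t).size + (post p t).size) := by
  have h1 := length_linWords_le (pre p) nt nt (nt + 2)
  have h2 := length_linWords_le (post p) nt (nt + 1) (nt + 2)
  simp only [rowWords, List.length_append, List.length_cons, List.length_nil, sum_add_distrib]
  omega

theorem length_dtWords_le (np nt : ℕ) (pre : ℕ → ℕ → ℕ) :
    (dtWords np nt pre).length ≤
      3 + 17 * nt + 25 * ∑ p ∈ range np, ∑ t ∈ range nt, (pre p t).size := by
  rw [dtWords, length_conjWords, sum_comm]
  have : ∑ t ∈ range nt, ([7] ++ posWords t ++ conjWords' (pre · t) np fun p =>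
      [7, 7] ++ posWords (nt + p) ++ [7, 7, 6, 2, nt + p, 2, nt + np + t, 4, 4, 4]).length ≤
      ∑ t ∈ range nt, (12 + 25 * ∑ p ∈ range np, (pre p t).size) := by
    refine sum_le_sum fun t _ => ?_
    have := length_conjWords'_le (pre · t) np 20 (fun p =>
      [7, 7] ++ posWords (nt + p) ++ [7, 7, 6, 2, nt + p, 2, nt + np + t, 4, 4, 4])
      (by simp [posWords])
    simp only [List.length_append, posWords, List.length_cons, List.length_nil] at this ⊢
    omega
  rw [sum_add_distrib, ← mul_sum, sum_const, card_range, smul_eq_mul] at this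
  omega

theorem length_mkWords_le (np nt : ℕ) (post : ℕ → ℕ → ℕ) (b : ℕ) :
    (mkWords np nt post b).length ≤
      3 + 26 * np + 25 * ∑ p ∈ range np, ∑ t ∈ range nt, (post p t).size := by
  rw [mkWords, length_conjWords]
  have : ∑ p ∈ range np, ([7] ++ posWords (nt + p) ++
      ([7, 7, 6, 3, b, p, b, p, b, p, 4] ++ disjWords' (post p) nt fun t =>
      [7, 7] ++ posWords t ++ [7, 6, 2, nt + p, 2, nt + np + t, 4, 4])).length ≤
      ∑ p ∈ range np, (21 + 25 * ∑ t ∈ range nt, (post p t).size) := by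
    refine sum_le_sum fun p _ => ?_
    have := length_disjWords'_le (post p) nt 18 (fun t =>
      [7, 7] ++ posWords t ++ [7, 6, 2, nt + p, 2, nt + np + t, 4, 4])
      (by simp [posWords])
    simp only [List.length_append, posWords, List.length_cons, List.length_nil] at this ⊢
    omega
  rw [sum_add_distrib, ← mul_sum, sum_const, card_range, smul_eq_mul] at this
  omega

theorem length_fsWords_le (np nt : ℕ) (pre post : ℕ → ℕ → ℕ) (b : ℕ) :
    (fsWords np nt pre post b).length ≤ 11 + 31 * (np + nt) +
      25 * ∑ p ∈ range np, ∑ t ∈ range nt, ((pre p t).size + (post p t).size) := by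
  have h1 := length_dtWords_le np nt pre
  have h2 := length_mkWords_le np nt post b
  simp only [fsWords, length_exWords, List.length_append, List.length_cons, List.length_nil,
    sum_add_distrib]
  omega

theorem length_reachWords_le (np nt : ℕ) (pre post : ℕ → ℕ → ℕ) :
    (reachWords np nt pre post).length ≤ 35 + 119 * (np + nt +
      ∑ p ∈ range np, ∑ t ∈ range nt, ((pre p t).size + (post p t).size)) := by
  have h1 := length_fsWords_le np nt pre post 0
  have h2 := length_fsWords_le np nt post pre 1
  have h3 : ∑ p ∈ range np, (rowWords nt pre post p).length ≤
      ∑ p ∈ range np, (47 + 57 * ∑ t ∈ range nt, ((pre p t).size + (post p t).size)) :=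
    sum_le_sum fun p _ => length_rowWords_le _ _ _ _
  rw [sum_add_distrib, ← mul_sum, sum_const, card_range, smul_eq_mul] at h3
  simp only [add_comm (post _ _).size] at h2
  simp only [reachWords, length_exWords, length_conjWords, List.length_append, List.length_cons,
    List.length_nil]
  omega

theorem size_eq_sum_extend {np nt : ℕ} (N : PetriNet (Fin np) (Fin nt)) :
    N.size = np + nt + ∑ p ∈ range np, ∑ t ∈ range nt,
      ((extend N.pre p t).size + (extend N.post p t).size) := by
  simp only [PetriNet.size, sum_range, extend_coe]

theorem length_code_reachFormula_le {np nt : ℕ} (N : PetriNet (Fin np) (Fin nt)) :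
    (code (reachFormula N)).length ≤ 119 * (N.size + 1) := by
  have := length_reachWords_le np nt (extend N.pre) (extend N.post)
  rw [code_reachFormula, size_eq_sum_extend]
  omega

end Size

end AddGt

/-! ### Verification of random access machines -/

namespace RAM

/-- `EmitsTo W inp p s Q l c`: started in `s`, the program `p` halts after at most `c` steps in a
state with property `Q`, and writes the words `l`. -/
def EmitsTo (W : ℕ) (inp : List ℕ) (p : Prog) (s : State) (Q : State → Prop) (l : List ℕ)
    (c : ℕ) : Prop :=
  ∃ s' k, Exec W inp p s s' k ∧ Q s' ∧ s'.out = s.out ++ l ∧ k ≤ c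

/-- The states have the same memory and the same contents of the registers below `R`. -/
def Agree (R : ℕ) (s s' : State) : Prop := s'.mem = s.mem ∧ ∀ r < R, s'.reg r = s.reg r

/-- The program halts, writes the words `l`, and changes neither the memory nor the registers
below `R`. Registers are allocated in increasing order: code that is nested more deeply uses
higher registers. -/
abbrev Emits (W : ℕ) (inp : List ℕ) (R : ℕ) (p : Prog) (s : State) (l : List ℕ) (c : ℕ) : Prop :=
  EmitsTo W inp p s (Agree R s) l c

theorem Agree.refl (R : ℕ) (s : State) : Agree R s s := ⟨rfl, fun _ _ => rfl⟩

theorem Agree.trans {R : ℕ} {s s' s'' : State} (h : Agree R s s') (h' : Agree R s' s'') :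
    Agree R s s'' :=
  ⟨h'.1.trans h.1, fun r hr => (h'.2 r hr).trans (h.2 r hr)⟩

theorem Agree.mono {R R' : ℕ} {s s' : State} (h : Agree R s s') (hR : R' ≤ R) : Agree R' s s' :=
  ⟨h.1, fun r hr => h.2 r (hr.trans_le hR)⟩

theorem agree_setReg {R r : ℕ} (s : State) (v : ℕ) (h : R ≤ r) : Agree R s (s.setReg r v) :=
  ⟨rfl, fun _ hr => Function.update_of_ne (by omega) _ _⟩

theorem setReg_reg (s : State) (r v : ℕ) : (s.setReg r v).reg r = v := Function.update_self _ _ _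

theorem setReg_reg_of_ne (s : State) {r r' : ℕ} (v : ℕ) (h : r' ≠ r) :
    (s.setReg r v).reg r' = s.reg r' := Function.update_of_ne h _ _

section

variable {W : ℕ} {inp : List ℕ} {R : ℕ} {p q : Prog} {s : State} {Q Q' : State → Prop}
  {l l' : List ℕ} {c c' : ℕ}

theorem EmitsTo.weaken (h : EmitsTo W inp p s Q l c) (hQ : ∀ s', Q s' → Q' s') (hl : l = l')
    (hc : c ≤ c') : EmitsTo W inp p s Q' l' c' := by
  obtain ⟨s', k, h1, h2, h3, h4⟩ := h
  exact ⟨s', k, h1, hQ _ h2, hl ▸ h3, h4.trans hc⟩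

theorem EmitsTo.congr (h : EmitsTo W inp p s Q l c) (hl : l = l') (hc : c ≤ c') :
    EmitsTo W inp p s Q l' c' := h.weaken (fun _ => id) hl hc

theorem Emits.mono {R' : ℕ} (h : Emits W inp R' p s l c) (hR : R ≤ R') : Emits W inp R p s l c :=
  h.weaken (fun _ h => h.mono hR) rfl le_rfl

theorem EmitsTo.seq (h : EmitsTo W inp p s Q l c)
    (h' : ∀ s', Q s' → EmitsTo W inp q s' Q' l' c') :
    EmitsTo W inp (.seq p q) s Q' (l ++ l') (c + c') := by
  obtain ⟨s', k, h1, h2, h3, h4⟩ := h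
  obtain ⟨s'', k', h1', h2', h3', h4'⟩ := h' s' h2
  exact ⟨s'', k + k', .seq h1 h1', h2', by rw [h3', h3, List.append_assoc], by omega⟩

theorem Emits.seq (h : Emits W inp R p s l c)
    (h' : ∀ s', Agree R s s' → Emits W inp R q s' l' c') :
    Emits W inp R (.seq p q) s (l ++ l') (c + c') :=
  EmitsTo.seq h fun s' hs' => (h' s' hs').weaken (fun _ h => hs'.trans h) rfl le_rfl

theorem emits_skip : Emits W inp R .skip s [] 1 :=
  ⟨s, 1, .skip s, Agree.refl _ _, by simp, le_rfl⟩

theorem EmitsTo.ite {r : ℕ} (h : s.reg r ≠ 0 → EmitsTo W inp p s Q l c)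
    (h' : s.reg r = 0 → EmitsTo W inp q s Q l c) :
    EmitsTo W inp (.ite r p q) s Q l (c + 1) := by
  by_cases hr : s.reg r = 0
  · obtain ⟨s', k, h1, h2, h3, h4⟩ := h' hr
    exact ⟨s', k + 1, .ite_false hr h1, h2, h3, by omega⟩
  · obtain ⟨s', k, h1, h2, h3, h4⟩ := h hr
    exact ⟨s', k + 1, .ite_true hr h1, h2, h3, by omega⟩

/-- The rule for an instruction that changes one register. Nothing is kept about the registers
above `r`, which suits the allocation in increasing order. -/
theorem emitsTo_setReg {r v : ℕ} (he : Exec W inp p s (s.setReg r v) 1)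
    (h : ∀ s', Agree r s s' → s'.reg r = v → s'.out = s.out → EmitsTo W inp q s' Q l c) :
    EmitsTo W inp (.seq p q) s Q l (c + 1) := by
  obtain ⟨s', k, h1, h2, h3, h4⟩ :=
    h (s.setReg r v) (agree_setReg s v le_rfl) (setReg_reg s r v) rfl
  exact ⟨s', 1 + k, .seq he h1, h2, h3, by omega⟩

theorem emits_setReg {r v : ℕ} (hr : R ≤ r) (he : Exec W inp p s (s.setReg r v) 1)
    (h : ∀ s', Agree r s s' → s'.reg r = v → Emits W inp R q s' l c) :
    Emits W inp R (.seq p q) s l (c + 1) :=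
  emitsTo_setReg he fun s' h1 h2 _ =>
    (h s' h1 h2).weaken (fun _ h => (h1.mono hr).trans h) rfl le_rfl

theorem emits_add {r a b : ℕ} (hr : R ≤ r) (hW : s.reg a + s.reg b ≤ W)
    (h : ∀ s', Agree r s s' → s'.reg r = s.reg a + s.reg b → Emits W inp R q s' l c) :
    Emits W inp R (.seq (.add r a b) q) s l (c + 1) :=
  emits_setReg hr (.add hW) h

theorem emits_sub {r a b : ℕ} (hr : R ≤ r)
    (h : ∀ s', Agree r s s' → s'.reg r = s.reg a - s.reg b → Emits W inp R q s' l c) :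
    Emits W inp R (.seq (.sub r a b) q) s l (c + 1) :=
  emits_setReg hr .sub h

theorem emits_input {r a : ℕ} (hr : R ≤ r) (hW : inp.getD (s.reg a) 0 ≤ W)
    (h : ∀ s', Agree r s s' → s'.reg r = inp.getD (s.reg a) 0 → Emits W inp R q s' l c) :
    Emits W inp R (.seq (.input r a) q) s l (c + 1) :=
  emits_setReg hr (.input hW) h

/-- Writes the contents of the given registers. -/
def emit : List ℕ → Prog
  | [] => .skip
  | r :: rs => .seq (.write r) (emit rs)

theorem emits_emit {rs : List ℕ} (h : rs.map s.reg = l) :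
    Emits W inp R (emit rs) s l (rs.length + 1) := by
  subst h
  induction rs generalizing s with
  | nil => exact emits_skip
  | cons r rs ih =>
    obtain ⟨s', k, h1, h2, h3, h4⟩ := ih (s := { s with out := s.out ++ [s.reg r] })
    refine ⟨s', 1 + k, .seq .write h1, h2, ?_, by rw [List.length_cons]; omega⟩
    simpa using h3

/-- A loop over `i < n`, where `n` is the content of `rn`. The register `R` holds `i`, the
register `R + 1` holds `b + i * d`, where `b` and `d` are the contents of `rb` and `rd`, and the
register `R + 2` counts down. Register `1` has to hold `1`. -/
def forLoop (R rn rb rd : ℕ) (body : Prog) : Prog :=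
  .seq (.const R 0) (.seq (.add (R + 1) rb R) (.seq (.add (R + 2) rn R)
    (.loop (R + 2) (.seq body (.seq (.add R R 1)
      (.seq (.add (R + 1) (R + 1) rd) (.sub (R + 2) (R + 2) 1)))))))

/-- The rule for `forLoop` with an invariant `K i` on memory and registers below `R`. -/
theorem emitsTo_forLoop {rn rb rd n b d : ℕ} {body : Prog} {f : ℕ → List ℕ} {t : ℕ → ℕ}
    {K : ℕ → State → Prop} (hKs : ∀ i s s', K i s → Agree R s s' → K i s')
    (hR : 1 < R ∧ rn < R ∧ rb < R ∧ rd < R) (hn : s.reg rn = n) (hb : s.reg rb = b)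
    (hd : ∀ i s', K i s' → s'.reg 1 = 1 ∧ s'.reg rd = d) (hnW : n ≤ W) (hbW : b + n * d ≤ W)
    (h0 : K 0 s)
    (h : ∀ i < n, ∀ s', K i s' → s'.reg R = i → s'.reg (R + 1) = b + i * d →
      EmitsTo W inp body s' (fun s'' => K (i + 1) s'' ∧ s''.reg R = s'.reg R ∧
        s''.reg (R + 1) = s'.reg (R + 1) ∧ s''.reg (R + 2) = s'.reg (R + 2)) (f i) (t i)) :
    EmitsTo W inp (forLoop R rn rb rd body) s (K n) ((List.range n).flatMap f)
      (4 + ∑ i ∈ Finset.range n, (t i + 4)) := by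
  have key (j : ℕ) : ∀ i, i + j = n → ∀ s', K i s' → s'.reg R = i → s'.reg (R + 1) = b + i * d →
      s'.reg (R + 2) = j → ∀ o, s'.out = o ++ (List.range i).flatMap f →
      ∃ s'' k, Exec W inp (.loop (R + 2) (.seq body (.seq (.add R R 1)
        (.seq (.add (R + 1) (R + 1) rd) (.sub (R + 2) (R + 2) 1))))) s' s'' k ∧ K n s'' ∧
        s''.out = o ++ (List.range n).flatMap f ∧ k ≤ 1 + ∑ i ∈ Finset.Ico i n, (t i + 4) := by
    induction j with
    | zero =>
      intro i hi s' hK _ _ hr2 o ho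
      obtain rfl : i = n := by omega
      exact ⟨s', 1, .loop_done hr2, hK, ho, by omega⟩
    | succ j ih =>
      intro i hi s' hK hr0 hr1 hr2 o ho
      obtain ⟨s1, k, he, ⟨hK1, e0, e1, e2⟩, ho1, hk⟩ := h i (by omega) s' hK hr0 hr1
      rw [hr0] at e0
      rw [hr1] at e1
      rw [hr2] at e2
      have hle : (i + 1) * d ≤ n * d := Nat.mul_le_mul_right d (by omega)
      have hsucc : b + (i + 1) * d = b + i * d + d := by ring
      -- `s2`, `s3`, `s4` are the states after the three updates of the loop registers.
      set s2 := s1.setReg R (i + 1) with hs2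
      set s3 := s2.setReg (R + 1) (b + (i + 1) * d) with hs3
      set s4 := s3.setReg (R + 2) j with hs4
      have a2 : Agree R s1 s2 := agree_setReg _ _ le_rfl
      have a3 : Agree R s1 s3 := a2.trans (agree_setReg _ _ (by omega))
      have a4 : Agree R s1 s4 := a3.trans (agree_setReg _ _ (by omega))
      have x2 : Exec W inp (.add R R 1) s1 s2 1 := by
        have e : s1.reg R + s1.reg 1 = i + 1 := by rw [e0, (hd _ _ hK1).1]
        rw [hs2, ← e]
        exact .add (by omega)
      have x3 : Exec W inp (.add (R + 1) (R + 1) rd) s2 s3 1 := by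
        have e : s2.reg (R + 1) + s2.reg rd = b + (i + 1) * d := by
          rw [hs2, setReg_reg_of_ne _ _ (by omega), setReg_reg_of_ne _ _ (by omega), e1,
            (hd _ _ hK1).2, hsucc]
        rw [hs3, ← e]
        exact .add (by omega)
      have x4 : Exec W inp (.sub (R + 2) (R + 2) 1) s3 s4 1 := by
        have e : s3.reg (R + 2) - s3.reg 1 = j := by
          rw [hs3, setReg_reg_of_ne _ _ (by omega), a3.2 1 hR.1, (hd _ _ hK1).1, hs2,
            setReg_reg_of_ne _ _ (by omega), e2]
          omega
        rw [hs4, ← e]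
        exact .sub
      have y0 : s4.reg R = i + 1 := by
        rw [hs4, setReg_reg_of_ne _ _ (by omega), hs3, setReg_reg_of_ne _ _ (by omega), hs2,
          setReg_reg]
      have y1 : s4.reg (R + 1) = b + (i + 1) * d := by
        rw [hs4, setReg_reg_of_ne _ _ (by omega), hs3, setReg_reg]
      obtain ⟨s5, k', he', hK', ho', hk'⟩ := ih (i + 1) (by omega) s4 (hKs _ _ _ hK1 a4) y0 y1
        (setReg_reg _ _ _) o (by
          change s1.out = _
          rw [ho1, ho, flatMap_range_succ, List.append_assoc])
      refine ⟨s5, _, .loop_step (by omega) (.seq he (.seq x2 (.seq x3 x4))) he', hK', ho', ?_⟩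
      rw [Finset.sum_eq_sum_Ico_succ_bot (by omega)]
      omega
  set s1 := s.setReg R 0 with hs1
  set s2 := s1.setReg (R + 1) b with hs2
  set s3 := s2.setReg (R + 2) n with hs3
  have x1 : Exec W inp (.const R 0) s s1 1 := .const (Nat.zero_le _)
  have x2 : Exec W inp (.add (R + 1) rb R) s1 s2 1 := by
    have e : s1.reg rb + s1.reg R = b := by
      rw [hs1, setReg_reg_of_ne _ _ (by omega), setReg_reg, hb, add_zero]
    rw [hs2, ← e]
    exact .add (by omega)
  have x3 : Exec W inp (.add (R + 2) rn R) s2 s3 1 := by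
    have e : s2.reg rn + s2.reg R = n := by
      rw [hs2, setReg_reg_of_ne _ _ (by omega), setReg_reg_of_ne _ _ (by omega), hs1,
        setReg_reg_of_ne _ _ (by omega), setReg_reg, hn, add_zero]
    rw [hs3, ← e]
    exact .add (by omega)
  have a3 : Agree R s s3 := ((agree_setReg _ _ le_rfl).trans (agree_setReg _ _ (by omega))).trans
    (agree_setReg _ _ (by omega))
  have y0 : s3.reg R = 0 := by
    rw [hs3, setReg_reg_of_ne _ _ (by omega), hs2, setReg_reg_of_ne _ _ (by omega), hs1,
      setReg_reg]
  have y1 : s3.reg (R + 1) = b + 0 * d := by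
    rw [hs3, setReg_reg_of_ne _ _ (by omega), hs2, setReg_reg, zero_mul, add_zero]
  obtain ⟨s', k, he, hK, ho, hk⟩ := key n 0 (by omega) s3 (hKs _ _ _ h0 a3) y0 y1
    (setReg_reg _ _ _) s.out (by
      rw [List.range_zero, List.flatMap_nil, List.append_nil]
      rfl)
  refine ⟨s', _, .seq x1 (.seq x2 (.seq x3 he)), hK, ho, ?_⟩
  rw [Finset.range_eq_Ico]
  omega

/-- The rule for a `forLoop` whose body changes only the registers from `R + 3` on. -/
theorem emits_forLoop {rn rb rd n b d : ℕ} {body : Prog} {f : ℕ → List ℕ} {t : ℕ → ℕ}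
    (hR : 1 < R ∧ rn < R ∧ rb < R ∧ rd < R) (h1 : s.reg 1 = 1) (hn : s.reg rn = n)
    (hb : s.reg rb = b) (hd : s.reg rd = d) (hnW : n ≤ W) (hbW : b + n * d ≤ W)
    (h : ∀ i < n, ∀ s', Agree R s s' → s'.reg R = i → s'.reg (R + 1) = b + i * d →
      Emits W inp (R + 3) body s' (f i) (t i)) :
    Emits W inp R (forLoop R rn rb rd body) s ((List.range n).flatMap f)
      (4 + ∑ i ∈ Finset.range n, (t i + 4)) := by
  refine emitsTo_forLoop (K := fun _ => Agree R s) (fun _ _ _ => Agree.trans) hR hn hb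
    (fun _ s' hs' => ⟨(hs'.2 1 hR.1).trans h1, (hs'.2 rd hR.2.2.2).trans hd⟩) hnW hbW
    (Agree.refl _ _) fun i hi s' hs' e0 e1 => ?_
  refine (h i hi s' hs' e0 e1).weaken (fun s'' hs'' => ?_) rfl le_rfl
  exact ⟨hs'.trans (hs''.mono (by omega)), hs''.2 _ (by omega), hs''.2 _ (by omega),
    hs''.2 _ (by omega)⟩

theorem emits_forLoop_const {rn rb rd n b d t : ℕ} {body : Prog} {f : ℕ → List ℕ}
    (hR : 1 < R ∧ rn < R ∧ rb < R ∧ rd < R) (h1 : s.reg 1 = 1) (hn : s.reg rn = n)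
    (hb : s.reg rb = b) (hd : s.reg rd = d) (hnW : n ≤ W) (hbW : b + n * d ≤ W)
    (h : ∀ i < n, ∀ s', Agree R s s' → s'.reg R = i → s'.reg (R + 1) = b + i * d →
      Emits W inp (R + 3) body s' (f i) t) :
    Emits W inp R (forLoop R rn rb rd body) s ((List.range n).flatMap f) (4 + n * (t + 4)) :=
  (emits_forLoop hR h1 hn hb hd hnW hbW h).congr rfl (by simp)

/-- A loop that repeats a fixed output, whose words are constants that are held in the registers
of the same numbers. -/
theorem emits_forLoop_emit {rn n : ℕ} {rs : List ℕ} (hR : 1 < R ∧ rn < R)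
    (hc : ∀ r < R, r ∈ 0 :: 1 :: rs → s.reg r = r) (hrs : ∀ r ∈ rs, r < R) (hn : s.reg rn = n)
    (hnW : n ≤ W) :
    Emits W inp R (forLoop R rn 0 0 (emit rs)) s ((List.range n).flatMap fun _ => rs)
      (4 + n * (rs.length + 5)) := by
  refine emits_forLoop_const (t := rs.length + 1) (b := 0) (d := 0)
    ⟨hR.1, hR.2, by omega, by omega⟩ (hc 1 (by omega) (by simp))
    hn (hc 0 (by omega) (by simp)) (hc 0 (by omega) (by simp)) hnW (by omega)
    fun i _ s' hs' _ _ => emits_emit ?_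
  refine (List.map_congr_left fun r hr => ?_).trans (List.map_id _)
  rw [hs'.2 r (hrs r hr), hc r (hrs r hr) (by simp [hr])]
  rfl

/-! ### Access to the numbers in the input -/

/-- The input contains, from the given position on, the code of the number `a`. -/
def Entry (inp : List ℕ) (pos a : ℕ) : Prop :=
  inp.getD pos 0 = a.size ∧
    (∀ j < a.size, inp.getD (pos + 1 + j) 0 = (a.bits.getD j false).toNat) ∧
    pos + 1 + a.size ≤ inp.length

theorem entry_of_eq_append {l₁ l₂ : List ℕ} {a : ℕ} (h : inp = l₁ ++ (PetriNet.natCode a ++ l₂)) :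
    Entry inp l₁.length a := by
  have hbits : a.size = a.bits.length := (Nat.size_eq_bits_len a).symm
  subst h
  refine ⟨?_, fun j hj => ?_, ?_⟩
  · rw [List.getD_append_right _ _ _ _ le_rfl]
    simp [PetriNet.natCode]
  · have hj' : j < a.bits.length := by omega
    rw [List.getD_append_right _ _ _ _ (by omega),
      show l₁.length + 1 + j - l₁.length = j + 1 by omega, PetriNet.natCode, List.cons_append,
      List.getD_cons_succ, List.getD_append _ _ _ _ (by simpa using hj')]
    simp [List.getD_eq_getElem?_getD, hj']
  · simp [PetriNet.natCode]
    omega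

/-- Executes `body` if the number whose position in the input is stored at the address in `r` is
not zero. The position is put into register `R`, the number of digits into register `R + 1`. -/
def ifEntry (R r : ℕ) (body : Prog) : Prog :=
  .seq (.load R r) (.seq (.input (R + 1) R) (.ite (R + 1) body .skip))

theorem emitsTo_ifEntry {r a : ℕ} {body : Prog} (ha : Entry inp (s.mem (s.reg r)) a)
    (hW : inp.length ≤ W) (hQ : a = 0 → ∀ s', Agree R s s' → Q s')
    (h : 0 < a → ∀ s', Agree R s s' → s'.reg R = s.mem (s.reg r) → s'.reg (R + 1) = a.size →
      EmitsTo W inp body s' Q l c) :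
    EmitsTo W inp (ifEntry R r body) s Q (if 0 < a then l else []) (c + 4) := by
  have haW : a.size ≤ W := by have := ha.2.2; omega
  refine (emitsTo_setReg (c := c + 3) .load fun s1 a1 e1 _ => ?_).congr rfl le_rfl
  rw [← e1] at ha
  refine emitsTo_setReg (c := c + 2) (.input (by rw [ha.1]; exact haW)) fun s2 a2 e2 _ => ?_
  rw [ha.1] at e2
  have a3 : Agree R s s2 := a1.trans (a2.mono (by omega))
  refine EmitsTo.ite (c := c + 1) (fun hr => ?_) fun hr => ?_
  · rw [e2] at hr
    have h0 := Nat.size_pos.1 (Nat.pos_of_ne_zero hr)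
    refine (h h0 s2 a3 ?_ e2).congr (if_pos h0).symm (by omega)
    rw [a2.2 R (by omega), e1]
  · rw [e2] at hr
    have h0 := Nat.size_eq_zero.1 hr
    exact (emits_skip (R := R)).weaken (fun s' hs' => hQ h0 s' (a3.trans hs')) (by simp [h0])
      (by omega)

theorem emits_ifEntry {r a : ℕ} {body : Prog} (ha : Entry inp (s.mem (s.reg r)) a)
    (hW : inp.length ≤ W)
    (h : 0 < a → ∀ s', Agree R s s' → s'.reg R = s.mem (s.reg r) → s'.reg (R + 1) = a.size →
      Emits W inp R body s' l c) :
    Emits W inp R (ifEntry R r body) s (if 0 < a then l else []) (c + 4) :=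
  emitsTo_ifEntry ha hW (fun _ _ => id) fun h0 s' hs' e0 e1 =>
    (h h0 s' hs' e0 e1).weaken (fun _ h => hs'.trans h) rfl le_rfl

end

open AddGt

/-! ### The program for the state equation -/

/-- The constants and the sizes that the program keeps in the registers below `15`, the table of
the positions of the matrix entries in the input, and the bound on words: `M 0` and `M 1` are the
two matrices, whose entries alternate in the input. -/
structure Ctx (W : ℕ) (inp : List ℕ) (np nt : ℕ) (M : ℕ → ℕ → ℕ → ℕ) (s : State) : Prop where
  reg_const : ∀ r ≤ 8, s.reg r = r
  reg_np : s.reg 9 = np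
  reg_nt : s.reg 10 = nt
  reg_stride : s.reg 11 = 2 * nt
  reg_sum : s.reg 12 = nt + np
  reg_nt_one : s.reg 13 = nt + 1
  reg_nt_two : s.reg 14 = nt + 2
  entry : ∀ o < 2, ∀ p < np, ∀ t < nt, Entry inp (s.mem (o + p * (2 * nt) + t * 2)) (M o p t)
  bound : np * (2 * nt) + inp.length + 4 * nt + 2 * np + 20 ≤ W

variable {W : ℕ} {inp : List ℕ} {np nt : ℕ} {M : ℕ → ℕ → ℕ → ℕ} {s : State}

theorem Ctx.of_agree {R : ℕ} {s' : State} (h : Ctx W inp np nt M s) (ha : Agree R s s')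
    (hR : 15 ≤ R) : Ctx W inp np nt M s' where
  reg_const r hr := (ha.2 r (by omega)).trans (h.reg_const r hr)
  reg_np := (ha.2 9 (by omega)).trans h.reg_np
  reg_nt := (ha.2 10 (by omega)).trans h.reg_nt
  reg_stride := (ha.2 11 (by omega)).trans h.reg_stride
  reg_sum := (ha.2 12 (by omega)).trans h.reg_sum
  reg_nt_one := (ha.2 13 (by omega)).trans h.reg_nt_one
  reg_nt_two := (ha.2 14 (by omega)).trans h.reg_nt_two
  entry := by rw [ha.1]; exact h.entry
  bound := h.bound

theorem Ctx.length_le (h : Ctx W inp np nt M s) : inp.length ≤ W := by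
  have := h.bound
  omega

/-- The words of one binary digit; its index is in register `34`, its position in register
`35`. -/
def digitProg : Prog :=
  .seq (.add 37 32 34) (.seq (.sub 38 37 1) (.seq (.input 39 35)
    (.seq (emit [7, 8, 7, 7, 7, 5, 2]) (.seq (.ite 34 (emit [38]) (emit [25]))
      (.seq (.ite 39 (emit [3, 3, 2, 37, 2, 37, 2, 26]) (emit [3, 2, 37, 2, 37])) (emit [7]))))))

/-- The words of the formula for a multiple. The factor is given by its position in register `29`
and its number of digits in register `30`; the variables are in the registers `25` and `26`, and
the number of bound variables in register `32`. -/
def mulProg : Prog :=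
  .seq (.add 33 29 1) (.seq (forLoop 34 30 33 1 digitProg) (.seq (.add 34 32 30)
    (.seq (.sub 34 34 1) (.seq (emit [5, 2, 34, 3, 2, 34, 2, 34])
      (forLoop 34 30 0 0 (emit [4, 4, 4, 4]))))))

theorem emits_digitProg {b : Bool} {y σ D j : ℕ} (hc : ∀ r ≤ 8, s.reg r = r)
    (h25 : s.reg 25 = σ) (h26 : s.reg 26 = y) (h32 : s.reg 32 = D) (h34 : s.reg 34 = j)
    (hb : inp.getD (s.reg 35) 0 = b.toNat) (hW : D + j ≤ W) (hW' : 1 ≤ W) :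
    Emits W inp 37 digitProg s (digitWords b y (if j = 0 then σ else D + j - 1) (D + j)) 36 := by
  refine (emits_add (c := 35) le_rfl (by rw [h32, h34]; exact hW) fun s1 ⟨_, a1⟩ e1 => ?_).congr
    rfl le_rfl
  refine emits_sub (c := 34) (by omega) fun s2 ⟨_, a2⟩ e2 => ?_
  have hb' : inp.getD (s2.reg 35) 0 = b.toNat := by rw [a2 35 (by omega), a1 35 (by omega), hb]
  refine emits_input (c := 33) (by omega) ?_ fun s3 ⟨_, a3⟩ e3 => ?_
  · rw [hb']
    cases b
    · exact Nat.zero_le _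
    · exact hW'
  rw [hb'] at e3
  refine Emits.mono (R' := 40) ?_ (by omega)
  refine EmitsTo.congr (Emits.seq (l := [7, 8, 7, 7, 7, 5, 2]) (emits_emit ?_) fun s4 ⟨_, a4⟩ =>
    Emits.seq (c := 3) (l := [if j = 0 then σ else D + j - 1])
      (EmitsTo.ite (fun hr => emits_emit ?_) fun hr => emits_emit ?_) fun s5 ⟨_, a5⟩ =>
    Emits.seq (c := 10) (l := if b then [3, 3, 2, D + j, 2, D + j, 2, y] else
      [3, 2, D + j, 2, D + j]) (EmitsTo.ite (fun hr => emits_emit ?_) fun hr =>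
        EmitsTo.congr (emits_emit rfl) ?_ ?_) fun s6 ⟨_, a6⟩ =>
    emits_emit (l := [7]) ?_) ?_ ?_
  · simp [a3, a2, a1, hc]
  · have hj : j ≠ 0 := by simpa [a4, a3, a2, a1, h34] using hr
    simp [a4, a3, e2, e1, a1, hc, h32, h34, hj]
  · have hj : j = 0 := by simpa [a4, a3, a2, a1, h34] using hr
    simp [a4, a3, a2, a1, h25, hj]
  · have hb1 : b = true := by simpa [a5, a4, e3] using hr
    simp [a5, a4, a3, a2, e1, a1, hc, h32, h34, h26, hb1]
  · have hb0 : b = false := by simpa [a5, a4, e3] using hr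
    simp [a5, a4, a3, a2, e1, a1, hc, h32, h34, hb0]
  · simp
  · simp [a6, a5, a4, a3, a2, a1, hc]
  · simp [digitWords]
  · simp

theorem emits_mulProg {a y σ D : ℕ} (hc : ∀ r ≤ 8, s.reg r = r) (h25 : s.reg 25 = σ)
    (h26 : s.reg 26 = y) (h29 : Entry inp (s.reg 29) a) (h30 : s.reg 30 = a.size)
    (h32 : s.reg 32 = D) (ha : 0 < a) (hW : D + inp.length ≤ W) :
    Emits W inp 33 mulProg s (mulWords a y σ D) (30 + 50 * a.size) := by
  have hlen := h29.2.2
  have hsize : 0 < a.size := Nat.size_pos.2 ha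
  refine EmitsTo.congr (l := ((List.range a.size).flatMap fun j =>
      digitWords (a.bits.getD j false) y (if j = 0 then σ else D + j - 1) (D + j)) ++
      (zeroWords (D + a.size - 1) ++ (List.range a.size).flatMap fun _ => [4, 4, 4, 4]))
    (c := (4 + a.size * (36 + 4)) + (9 + (4 + a.size * (4 + 5)) + 1 + 1) + 1) ?_ ?_ (by omega)
  · refine emits_add le_rfl ?_ fun s1 ⟨_, a1⟩ e1 => Emits.seq ?_ fun s2 ⟨_, a2⟩ =>
      emits_add (r := 34) (by omega) ?_ fun s3 ⟨_, a3⟩ e3 =>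
      emits_sub (by omega) fun s4 ⟨_, a4⟩ e4 =>
      Emits.mono (R' := 34) ?_ (by omega)
    · rw [hc 1 (by omega)]
      omega
    · refine Emits.mono (R' := 34) (emits_forLoop_const (b := s1.reg 33) (d := 1) (by omega)
        ?_ ?_ ?_ ?_ (by omega) ?_ fun j hj s2 ⟨_, a2⟩ e2 e2' => ?_) (by omega)
      · simp [a1, hc]
      · simp [a1, h30]
      · rfl
      · simp [a1, hc]
      · rw [e1, hc 1 (by omega)]
        omega
      · refine emits_digitProg ?_ ?_ ?_ ?_ e2 ?_ (by omega) (by omega)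
        · intro r hr
          rw [a2 r (by omega), a1 r (by omega), hc r hr]
        · simp [a2, a1, h25]
        · simp [a2, a1, h26]
        · simp [a2, a1, h32]
        · rw [e2', e1, hc 1 (by omega), mul_one]
          exact h29.2.1 j hj
    · simp [a2, a1, h30, h32]
      omega
    · refine Emits.seq (emits_emit ?_) fun s5 ⟨_, a5⟩ => emits_forLoop_emit (by omega) ?_ ?_ ?_ ?_
      · simp [e4, e3, a4, a3, a2, a1, hc, h30, h32, zeroWords]
      · intro r hr hr'
        have : r ≤ 8 := by
          simp only [List.mem_cons, List.not_mem_nil, or_false] at hr'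
          omega
        rw [a5 r hr, a4 r hr, a3 r hr, a2 r (by omega), a1 r (by omega), hc r this]
      · simp
      · simp [a5, a4, a3, a2, a1, h30]
      · omega
  · rw [mulWords, if_neg hsize.ne']
    simp only [List.append_assoc]

/-- The words of a linear form: the sum over the entries of a row, whose address is given in
register `23`; the variable for its value is in the register `σ`. -/
def linProg (σ : ℕ) : Prog :=
  .seq (.add 24 σ 0) (.seq (.add 25 14 0)
    (.seq (forLoop 26 10 23 2 (ifEntry 29 27 (.seq (.add 31 25 1) (.seq (.add 32 25 2)
      (.seq (emit [7, 8, 7, 7, 8, 7, 7, 7, 7, 7, 5, 2, 24, 3, 2, 25, 2, 31, 7])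
        (.seq mulProg (.seq (emit [4, 4, 7]) (.seq (.add 24 31 0) (.add 25 32 0)))))))))
      (.seq (emit [5, 2, 24, 3, 2, 24, 2, 24])
        (forLoop 26 10 23 2 (ifEntry 29 27 (emit [4, 4, 4, 4, 4, 4]))))))

/-- Two moves between registers, written as additions of the zero in register `0`. -/
theorem emitsTo_move_move {a b c d : ℕ} (h0 : s.reg 0 = 0) (ha : a ≠ 0 ∧ a ≠ d) (hb : a ≠ b)
    (hc : s.reg c ≤ W) (hd : s.reg d ≤ W) :
    EmitsTo W inp (.seq (.add a c 0) (.add b d 0)) s (fun s' => s'.mem = s.mem ∧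
      s'.reg a = s.reg c ∧ s'.reg b = s.reg d ∧ ∀ r, r ≠ a → r ≠ b → s'.reg r = s.reg r) [] 2 := by
  set s1 := s.setReg a (s.reg c + s.reg 0) with hs1
  have x1 : Exec W inp (.add a c 0) s s1 1 := .add (by omega)
  have e0 : s1.reg 0 = 0 := by rw [hs1, setReg_reg_of_ne _ _ ha.1.symm, h0]
  have ed : s1.reg d = s.reg d := setReg_reg_of_ne _ _ ha.2.symm
  have x2 : Exec W inp (.add b d 0) s1 (s1.setReg b (s1.reg d + s1.reg 0)) 1 := .add (by omega)
  refine ⟨_, 2, .seq x1 x2, ⟨rfl, ?_, ?_, fun r hra hrb => ?_⟩, (List.append_nil _).symm, le_rfl⟩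
  · rw [setReg_reg_of_ne _ _ hb, hs1, setReg_reg, h0, add_zero]
  · rw [setReg_reg, e0, ed, add_zero]
  · rw [setReg_reg_of_ne _ _ hrb, hs1, setReg_reg_of_ne _ _ hra]

theorem row_le {np nt p t : ℕ} (hp : p < np) (ht : t ≤ nt) :
    p * (2 * nt) + t * 2 ≤ np * (2 * nt) := by
  have : (p + 1) * (2 * nt) ≤ np * (2 * nt) := Nat.mul_le_mul_right _ hp
  rw [add_mul, one_mul] at this
  omega

theorem emits_linProg {σ v o p : ℕ} (hctx : Ctx W inp np nt M s) (ho : o < 2) (hp : p < np)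
    (hv : s.reg σ = v) (hvW : v ≤ W) (h23 : s.reg 23 = o + p * (2 * nt)) :
    Emits W inp 24 (linProg σ) s (linWords (M o p) nt v (nt + 2))
      (30 + 100 * ∑ t ∈ Finset.range nt, (1 + (M o p t).size)) := by
  have hbound := hctx.bound
  have hrow := row_le (np := np) (nt := nt) hp le_rfl
  set A := M o p with hA
  set f : ℕ → List ℕ := fun t => if 0 < A t then
      summandWords (A t) t (restVar A v (nt + 2) t) (nt + 2 + 2 * Nat.count (0 < A ·) t) else []
    with hf
  refine EmitsTo.congr (l := (List.range nt).flatMap f ++ (zeroWords (restVar A v (nt + 2) nt) ++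
      (List.range nt).flatMap fun t => if 0 < A t then [4, 4, 4, 4, 4, 4] else []))
    (c := (4 + ∑ t ∈ Finset.range nt, ((60 + 50 * (A t).size + 4) + 4)) +
      (9 + (4 + nt * ((7 + 4) + 4))) + 1 + 1) ?_ ?_ ?_
  · refine emits_add le_rfl ?_ fun s1 h1 e1 => emits_add (by omega) ?_ fun s2 h2 e2 => ?_
    · rw [hv, hctx.reg_const 0 (by omega)]
      omega
    · rw [h1.2 14 (by omega), h1.2 0 (by omega), hctx.reg_nt_two, hctx.reg_const 0 (by omega)]
      omega
    have hctx2 := (hctx.of_agree h1 (by omega)).of_agree h2 (by omega)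
    have h12 : Agree 24 s s2 := h1.trans (h2.mono (by omega))
    have g24 : s2.reg 24 = v := by
      rw [h2.2 24 (by omega), e1, hv, hctx.reg_const 0 (by omega), add_zero]
    have g25 : s2.reg 25 = nt + 2 := by
      rw [e2, h1.2 14 (by omega), h1.2 0 (by omega), hctx.reg_nt_two,
        hctx.reg_const 0 (by omega), add_zero]
    have hloop : EmitsTo W inp _ s2 (fun s' => Agree 24 s2 s' ∧
        s'.reg 24 = restVar A v (nt + 2) nt ∧ s'.reg 25 = nt + 2 + 2 * Nat.count (0 < A ·) nt)
        _ _ :=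
      emitsTo_forLoop (R := 26) (rn := 10) (rb := 23) (rd := 2)
        (body := ifEntry 29 27 (.seq (.add 31 25 1) (.seq (.add 32 25 2)
          (.seq (emit [7, 8, 7, 7, 8, 7, 7, 7, 7, 7, 5, 2, 24, 3, 2, 25, 2, 31, 7])
          (.seq mulProg (.seq (emit [4, 4, 7]) (.seq (.add 24 31 0) (.add 25 32 0))))))))
        (K := fun t s' => Agree 24 s2 s' ∧ s'.reg 24 = restVar A v (nt + 2) t ∧
          s'.reg 25 = nt + 2 + 2 * Nat.count (0 < A ·) t) (f := f)
        (t := fun t => 60 + 50 * (A t).size + 4) (b := o + p * (2 * nt)) (d := 2)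
        ?_ (by omega) hctx2.reg_nt ?_ ?_ (by omega) (by omega) ?_ ?_
    · refine EmitsTo.seq hloop fun s3 ⟨h3, e3, _⟩ => ?_
      have hctx3 := hctx2.of_agree h3 (by omega)
      refine EmitsTo.weaken (Emits.seq (R := 26) (emits_emit ?_) fun s4 h4 =>
        emits_forLoop_const (b := o + p * (2 * nt)) (d := 2) (by omega) ?_ ?_ ?_ ?_ (by omega)
          (by omega) fun t ht s5 h5 e5 e5' => ?_) (fun s' hs' => h3.trans (hs'.mono (by omega)))
        rfl le_rfl
      · simp [e3, hctx3.reg_const, zeroWords]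
      · rw [h4.2 1 (by omega), hctx3.reg_const 1 (by omega)]
      · rw [h4.2 10 (by omega), hctx3.reg_nt]
      · rw [h4.2 23 (by omega), h3.2 23 (by omega), h12.2 23 (by omega), h23]
      · rw [h4.2 2 (by omega), hctx3.reg_const 2 (by omega)]
      · have hctx5 := (hctx3.of_agree h4 (by omega)).of_agree h5 (by omega)
        refine emits_ifEntry ?_ hctx5.length_le fun _ s6 h6 _ _ => emits_emit ?_
        · rw [e5']
          exact hctx5.entry o ho p hp t ht
        · simp [h6.2, hctx5.reg_const]
    · exact fun t s' s'' hK h => ⟨hK.1.trans (h.mono (by omega)), (h.2 24 (by omega)).trans hK.2.1,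
        (h.2 25 (by omega)).trans hK.2.2⟩
    · rw [h12.2 23 (by omega), h23]
    · exact fun t s' hK => ⟨(hctx2.of_agree hK.1 (by omega)).reg_const 1 (by omega),
        (hctx2.of_agree hK.1 (by omega)).reg_const 2 (by omega)⟩
    · exact ⟨Agree.refl _ _, by rw [g24]; simp [restVar], by rw [g25]; simp⟩
    · intro t ht s3 ⟨h3, k1, k2⟩ e3 e3'
      have hctx3 := hctx2.of_agree h3 (by omega)
      have hcount : Nat.count (0 < A ·) t ≤ t := Nat.count_le _
      have hrest := restVar_succ A v (nt + 2) t
      have hsucc := Nat.count_succ (0 < A ·) t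
      refine emitsTo_ifEntry (a := A t) (l := summandWords (A t) t (restVar A v (nt + 2) t)
        (nt + 2 + 2 * Nat.count (0 < A ·) t)) ?_ hctx3.length_le (fun h0 s4 h4 => ?_)
        fun h0 s4 h4 e4 e4' => ?_
      · rw [e3']
        exact hctx3.entry o ho p hp t ht
      · have h0' : ¬0 < A t := by omega
        rw [if_neg h0'] at hrest hsucc
        refine ⟨⟨h3.trans (h4.mono (by omega)), ?_, ?_⟩, h4.2 26 (by omega), h4.2 27 (by omega),
          h4.2 28 (by omega)⟩
        · rw [h4.2 24 (by omega), k1, hrest]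
        · rw [h4.2 25 (by omega), k2, hsucc, add_zero]
      · rw [if_pos h0] at hrest hsucc
        have hctx4 := hctx3.of_agree h4 (by omega)
        have hc := hctx4.reg_const
        have hent := hctx3.entry o ho p hp t ht
        rw [← e3', ← e4] at hent
        have hsize := hent.2.2
        have g24 : s4.reg 24 = restVar A v (nt + 2) t := (h4.2 24 (by omega)).trans k1
        have g25 : s4.reg 25 = nt + 2 + 2 * Nat.count (0 < A ·) t := (h4.2 25 (by omega)).trans k2
        have g26 : s4.reg 26 = t := (h4.2 26 (by omega)).trans e3
        refine EmitsTo.congr (l := [7, 8, 7, 7, 8, 7, 7, 7, 7, 7, 5, 2, restVar A v (nt + 2) t, 3, 2,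
            nt + 2 + 2 * Nat.count (0 < A ·) t, 2, nt + 2 + 2 * Nat.count (0 < A ·) t + 1, 7] ++
            (mulWords (A t) t (nt + 2 + 2 * Nat.count (0 < A ·) t)
              (nt + 2 + 2 * Nat.count (0 < A ·) t + 2) ++ ([4, 4, 7] ++ [])))
          (c := (20 + ((30 + 50 * (A t).size) + (4 + 2))) + 1 + 1) ?_ ?_ (by omega)
        · have hW1 : s4.reg 25 + s4.reg 1 ≤ W := by
            rw [hc 1 (by omega), g25]
            omega
          refine emitsTo_setReg (.add hW1) fun s5 ⟨_, a5⟩ e5 _ => ?_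
          have hW2 : s5.reg 25 + s5.reg 2 ≤ W := by
            rw [a5 2 (by omega), a5 25 (by omega), hc 2 (by omega), g25]
            omega
          refine emitsTo_setReg (.add hW2) fun s6 ⟨m6, a6⟩ e6 _ => ?_
          refine EmitsTo.seq (Q := Agree 33 s6) (emits_emit ?_) fun s7 ⟨m7, a7⟩ => ?_
          · simp [a6, e5, a5, hc, g24, g25]
          refine EmitsTo.seq (Q := Agree 33 s7) (emits_mulProg ?_ ?_ ?_ ?_ ?_ ?_ h0 ?_)
            fun s8 ⟨m8, a8⟩ => ?_
          · intro r hr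
            rw [a7 r (by omega), a6 r (by omega), a5 r (by omega), hc r hr]
          · simp [a7, a6, a5, g25]
          · simp [a7, a6, a5, g26]
          · simpa [a7, a6, a5] using hent
          · simp [a7, a6, a5, e4']
          · simp [a7, e6, a5, g25, hc]
          · omega
          refine EmitsTo.seq (Q := Agree 33 s8) (emits_emit ?_) fun s9 ⟨m9, a9⟩ => ?_
          · simp [a8, a7, a6, a5, hc]
          have f31 : s9.reg 31 = nt + 2 + 2 * Nat.count (0 < A ·) t + 1 := by
            simp [a9, a8, a7, a6, e5, hc, g25]
          have f32 : s9.reg 32 = nt + 2 + 2 * Nat.count (0 < A ·) t + 2 := by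
            simp [a9, a8, a7, e6, a5, hc, g25]
          have f (r : ℕ) (hr : r < 31) : s9.reg r = s4.reg r := by
            rw [a9 r (by omega), a8 r (by omega), a7 r (by omega), a6 r (by omega), a5 r hr]
          refine EmitsTo.weaken (emitsTo_move_move ?_ (by omega) (by omega) ?_ ?_)
            (fun s10 ⟨m10, x1, x2, x3⟩ => ?_) rfl le_rfl
          · rw [f 0 (by omega), hc 0 (by omega)]
          · omega
          · omega
          refine ⟨⟨h3.trans ((h4.mono (by omega)).trans ⟨?_, fun r hr => ?_⟩), ?_, ?_⟩, ?_, ?_, ?_⟩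
          · rw [m10, m9, m8, m7, m6]
            assumption
          · rw [x3 r (by omega) (by omega), f r (by omega)]
          · rw [x1, f31, hrest]
          · rw [x2, f32, hsucc]
            omega
          · rw [x3 26 (by omega) (by omega), f 26 (by omega), h4.2 26 (by omega)]
          · rw [x3 27 (by omega) (by omega), f 27 (by omega), h4.2 27 (by omega)]
          · rw [x3 28 (by omega) (by omega), f 28 (by omega), h4.2 28 (by omega)]
        · simp [summandWords]
  · simp only [linWords, hf, List.append_assoc]
  · simp only [Finset.sum_add_distrib, Finset.sum_const, Finset.card_range, smul_eq_mul,
      ← Finset.mul_sum]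
    omega

/-- The words of the row of a place in the state equation. The place is in register `20`, the
address of its entries in register `21`. -/
def rowProg : Prog :=
  .seq (emit [7, 8, 7, 7, 8, 7, 7, 7]) (.seq (.add 23 21 0) (.seq (linProg 10)
    (.seq (emit [7, 7, 7]) (.seq (.add 23 21 1) (.seq (linProg 13)
      (emit [7, 5, 3, 1, 20, 2, 10, 3, 0, 20, 2, 13, 4, 4, 4, 4, 4, 4, 4, 4]))))))

theorem emits_rowProg {p : ℕ} (hctx : Ctx W inp np nt M s) (hp : p < np) (h20 : s.reg 20 = p)
    (h21 : s.reg 21 = 0 + p * (2 * nt)) :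
    Emits W inp 23 rowProg s (rowWords nt (M 0) (M 1) p)
      (100 + 100 * ∑ t ∈ Finset.range nt, (2 + (M 0 p t).size + (M 1 p t).size)) := by
  have hbound := hctx.bound
  have hrow := row_le (np := np) (nt := nt) hp le_rfl
  have hc := hctx.reg_const
  refine EmitsTo.congr (l := [7, 8, 7, 7, 8, 7, 7, 7] ++ (linWords (M 0 p) nt nt (nt + 2) ++
      ([7, 7, 7] ++ (linWords (M 1 p) nt (nt + 1) (nt + 2) ++
        [7, 5, 3, 1, p, 2, nt, 3, 0, p, 2, nt + 1, 4, 4, 4, 4, 4, 4, 4, 4]))))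
    (c := 9 + ((30 + 100 * ∑ t ∈ Finset.range nt, (1 + (M 0 p t).size)) +
      (4 + ((30 + 100 * ∑ t ∈ Finset.range nt, (1 + (M 1 p t).size)) + 21 + 1)) + 1)) ?_ ?_ ?_
  · refine Emits.seq (emits_emit ?_) fun s1 h1 => emits_add le_rfl ?_ fun s2 h2 e2 =>
      Emits.seq (Emits.mono (emits_linProg (o := 0) ?_ (by omega) hp ?_ (by omega) ?_)
        (by omega)) fun s3 h3 => Emits.seq (emits_emit ?_) fun s4 h4 =>
      emits_add le_rfl ?_ fun s5 h5 e5 =>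
      Emits.seq (Emits.mono (emits_linProg (o := 1) ?_ (by omega) hp ?_ (by omega) ?_)
        (by omega)) fun s6 h6 => emits_emit ?_
    · simp [hc]
    · simp only [h1.2, h21, hc, Nat.reduceLT, Nat.reduceLeDiff]
      omega
    · exact (hctx.of_agree h1 (by omega)).of_agree h2 (by omega)
    · simp [h2.2, h1.2, hctx.reg_nt]
    · simp [e2, h1.2, h21, hc]
    · simp [h3.2, h2.2, h1.2, hc]
    · simp only [h4.2, h3.2, h2.2, h1.2, h21, hc, Nat.reduceLT, Nat.reduceLeDiff]
      omega
    · exact ((((hctx.of_agree h1 (by omega)).of_agree h2 (by omega)).of_agree h3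
        (by omega)).of_agree h4 (by omega)).of_agree h5 (by omega)
    · simp [h5.2, h4.2, h3.2, h2.2, h1.2, hctx.reg_nt_one]
    · simp [e5, h4.2, h3.2, h2.2, h1.2, h21, hc, add_comm]
    · simp [h6.2, h5.2, h4.2, h3.2, h2.2, h1.2, h20, hctx.reg_nt, hctx.reg_nt_one, hc]
  · simp only [rowWords, List.append_assoc]
  · simp only [Finset.sum_add_distrib, Finset.sum_const, Finset.card_range, smul_eq_mul]
    omega

/-! ### The program for the firing sets -/

/-- The words of a conjunction over all `i < n`, in a loop as described at `forLoop`. -/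
def conjProg (R rn rb rd : ℕ) (body : Prog) : Prog :=
  .seq (forLoop R rn rb rd (.seq (emit [7, 7]) (.seq body (emit [7]))))
    (.seq (emit [7, 4, 4]) (forLoop R rn 0 0 (emit [4, 4])))

/-- The words of a conjunction over the `i < n` for which the matrix entry at the address in the
register `R + 1` is not zero. -/
def conjProg' (R rn rb rd : ℕ) (body : Prog) : Prog :=
  .seq (forLoop R rn rb rd (ifEntry (R + 3) (R + 1)
      (.seq (emit [7, 7]) (.seq body (emit [7])))))
    (.seq (emit [7, 4, 4]) (forLoop R rn rb rd (ifEntry (R + 3) (R + 1) (emit [4, 4]))))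

/-- The words of a disjunction over the `i < n` for which the matrix entry at the address in the
register `R + 1` is not zero. -/
def disjProg' (R rn rb rd : ℕ) (body : Prog) : Prog :=
  .seq (forLoop R rn rb rd (ifEntry (R + 3) (R + 1)
      (.seq (emit [7, 7]) (.seq body (emit [4]))))) (emit [4])

/-- The words of a formula preceded by existential quantifiers. -/
def exProg (R rn : ℕ) (body : Prog) : Prog :=
  .seq (forLoop R rn 0 0 (emit [7, 8, 7])) (.seq body (forLoop R rn 0 0 (emit [4, 4])))

theorem Ctx.map_reg (h : Ctx W inp np nt M s) {rs : List ℕ} (hrs : ∀ r ∈ rs, r ≤ 8) :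
    rs.map s.reg = rs := by
  refine (List.map_congr_left fun r hr => ?_).trans (List.map_id _)
  exact h.reg_const r (hrs r hr)

/-- The words around a member of a conjunction (`r = 7`) or disjunction (`r = 4`). -/
theorem emits_bracket {R c r : ℕ} {body : Prog} {l : List ℕ} {t : ℕ} (hctx : Ctx W inp np nt M s)
    (hR : 15 ≤ R) (hr : r ≤ 8) (hc : 3 + (t + 2) = c)
    (h : ∀ s', Agree R s s' → Emits W inp R body s' l t) :
    Emits W inp R (.seq (emit [7, 7]) (.seq body (emit [r]))) s ([7, 7] ++ l ++ [r]) c := by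
  refine EmitsTo.congr (l := [7, 7] ++ (l ++ [r])) (c := 3 + (t + 2)) ?_
    (by rw [List.append_assoc]) hc.le
  refine Emits.seq (emits_emit (hctx.map_reg (by simp))) fun s1 h1 => Emits.seq (h s1 h1)
    fun s2 h2 => emits_emit ?_
  exact ((hctx.of_agree h1 hR).of_agree h2 hR).map_reg (by simpa)

theorem emits_conjProg {R rn rb rd n b d : ℕ} {body : Prog} {f : ℕ → List ℕ} {t : ℕ → ℕ}
    (hctx : Ctx W inp np nt M s) (hR : 15 ≤ R ∧ rn < R ∧ rb < R ∧ rd < R) (hn : s.reg rn = n)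
    (hb : s.reg rb = b) (hd : s.reg rd = d) (hnW : n ≤ W) (hbW : b + n * d ≤ W)
    (h : ∀ i < n, ∀ s', Agree R s s' → s'.reg R = i → s'.reg (R + 1) = b + i * d →
      Emits W inp (R + 3) body s' (f i) (t i)) :
    Emits W inp R (conjProg R rn rb rd body) s (conjWords n f)
      (12 + ∑ i ∈ Finset.range n, (t i + 16)) := by
  refine EmitsTo.congr (l := ((List.range n).flatMap fun i => [7, 7] ++ f i ++ [7]) ++ ([7, 4, 4] ++
      (List.range n).flatMap fun _ => [4, 4]))
    (c := (4 + ∑ i ∈ Finset.range n, ((t i + 5) + 4)) + (4 + (4 + n * (2 + 5)))) ?_ ?_ ?_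
  · refine Emits.seq (emits_forLoop (by omega) (hctx.reg_const 1 (by omega)) hn hb hd hnW hbW
      fun i hi s1 h1 e1 e1' => ?_) fun s1 h1 => ?_
    · refine emits_bracket (t := t i) (hctx.of_agree h1 hR.1) (by omega) (by omega) (by omega)
        fun s2 h2 => ?_
      refine h i hi s2 (h1.trans (h2.mono (by omega))) ?_ ?_
      · rw [h2.2 R (by omega), e1]
      · rw [h2.2 (R + 1) (by omega), e1']
    · have hctx1 := hctx.of_agree h1 hR.1
      refine Emits.seq (emits_emit (hctx1.map_reg (by simp))) fun s2 h2 =>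
        emits_forLoop_emit (by omega) (fun r _ hr => ?_) (by simp; omega) ?_ hnW
      · refine (hctx1.of_agree h2 hR.1).reg_const r ?_
        simp only [List.mem_cons, List.not_mem_nil, or_false] at hr
        omega
      · rw [h2.2 rn (by omega), h1.2 rn (by omega), hn]
  · simp only [conjWords, List.append_assoc]
  · simp only [Finset.sum_add_distrib, Finset.sum_const, Finset.card_range, smul_eq_mul]
    omega

theorem emits_conjProg' {R rn rb rd n b d t : ℕ} {body : Prog} {f : ℕ → List ℕ} {A : ℕ → ℕ}
    (hctx : Ctx W inp np nt M s) (hR : 15 ≤ R ∧ rn < R ∧ rb < R ∧ rd < R) (hn : s.reg rn = n)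
    (hb : s.reg rb = b) (hd : s.reg rd = d) (hnW : n ≤ W) (hbW : b + n * d ≤ W)
    (hA : ∀ i < n, Entry inp (s.mem (b + i * d)) (A i))
    (h : ∀ i < n, ∀ s', Agree R s s' → s'.reg R = i →
      Emits W inp (R + 3) body s' (f i) t) :
    Emits W inp R (conjProg' R rn rb rd body) s (conjWords' A n f) (12 + n * (t + 24)) := by
  refine EmitsTo.congr (l := ((List.range n).flatMap fun i =>
      if 0 < A i then [7, 7] ++ f i ++ [7] else []) ++ ([7, 4, 4] ++
      (List.range n).flatMap fun i => if 0 < A i then [4, 4] else []))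
    (c := (4 + n * (((t + 5) + 4) + 4)) + (4 + (4 + n * ((3 + 4) + 4)))) ?_ ?_ ?_
  · refine Emits.seq (emits_forLoop_const (by omega) (hctx.reg_const 1 (by omega)) hn hb hd hnW hbW
      fun i hi s1 h1 e1 e1' => emits_ifEntry ?_ hctx.length_le fun _ s2 h2 _ _ => ?_) fun s1 h1 => ?_
    · rw [e1', h1.1]
      exact hA i hi
    · have h2' := h1.trans (h2.mono (by omega))
      refine emits_bracket (t := t) (hctx.of_agree h2' hR.1) (by omega) (by omega) (by omega)
        fun s3 h3 => ?_
      refine h i hi s3 (h2'.trans (h3.mono (by omega))) ?_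
      rw [h3.2 R (by omega), h2.2 R (by omega), e1]
    · have hctx1 := hctx.of_agree h1 hR.1
      refine Emits.seq (emits_emit (hctx1.map_reg (by simp))) fun s2 h2 =>
        emits_forLoop_const (b := b) (d := d) (by omega) ?_ ?_ ?_ ?_ hnW hbW
          fun i hi s3 h3 e3 e3' => emits_ifEntry ?_ hctx.length_le fun _ s4 h4 _ _ => ?_
      · exact (hctx1.of_agree h2 hR.1).reg_const 1 (by omega)
      · rw [h2.2 rn (by omega), h1.2 rn (by omega), hn]
      · rw [h2.2 rb (by omega), h1.2 rb (by omega), hb]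
      · rw [h2.2 rd (by omega), h1.2 rd (by omega), hd]
      · rw [e3', h3.1, h2.1, h1.1]
        exact hA i hi
      · exact emits_emit ((((hctx1.of_agree h2 hR.1).of_agree h3 hR.1).of_agree h4
          (by omega)).map_reg (by simp))
  · simp only [conjWords', List.append_assoc]
  · have : n * (((t + 5) + 4) + 4) + n * ((3 + 4) + 4) = n * (t + 24) := by ring
    omega

theorem emits_disjProg' {R rn rb rd n b d t : ℕ} {body : Prog} {f : ℕ → List ℕ} {A : ℕ → ℕ}
    (hctx : Ctx W inp np nt M s) (hR : 15 ≤ R ∧ rn < R ∧ rb < R ∧ rd < R) (hn : s.reg rn = n)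
    (hb : s.reg rb = b) (hd : s.reg rd = d) (hnW : n ≤ W) (hbW : b + n * d ≤ W)
    (hA : ∀ i < n, Entry inp (s.mem (b + i * d)) (A i))
    (h : ∀ i < n, ∀ s', Agree R s s' → s'.reg R = i →
      Emits W inp (R + 3) body s' (f i) t) :
    Emits W inp R (disjProg' R rn rb rd body) s (disjWords' A n f)
      (4 + n * (((t + 5) + 4) + 4) + 2) := by
  refine Emits.seq (emits_forLoop_const (by omega) (hctx.reg_const 1 (by omega)) hn hb hd hnW hbW
    fun i hi s1 h1 e1 e1' => emits_ifEntry ?_ hctx.length_le fun _ s2 h2 _ _ => ?_) fun s1 h1 => ?_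
  · rw [e1', h1.1]
    exact hA i hi
  · have h2' := h1.trans (h2.mono (by omega))
    refine emits_bracket (t := t) (hctx.of_agree h2' hR.1) (by omega) (by omega) (by omega)
      fun s3 h3 => ?_
    refine h i hi s3 (h2'.trans (h3.mono (by omega))) ?_
    rw [h3.2 R (by omega), h2.2 R (by omega), e1]
  · exact emits_emit ((hctx.of_agree h1 hR.1).map_reg (by simp))

theorem emits_exProg {R rn n t : ℕ} {body : Prog} {l : List ℕ}
    (hctx : Ctx W inp np nt M s) (hR : 15 ≤ R ∧ rn < R) (hn : s.reg rn = n) (hnW : n ≤ W)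
    (h : ∀ s', Agree R s s' → Emits W inp R body s' l t) :
    Emits W inp R (exProg R rn body) s (exWords n l)
      ((4 + n * (3 + 5)) + (t + (4 + n * (2 + 5)))) := by
  refine EmitsTo.congr (l := ((List.range n).flatMap fun _ => [7, 8, 7]) ++ (l ++
      (List.range n).flatMap fun _ => [4, 4])) ?_ ?_ le_rfl
  · refine Emits.seq (emits_forLoop_emit (by omega) (fun r _ hr => ?_) (by simp; omega) hn hnW)
      fun s1 h1 => Emits.seq (h s1 h1) fun s2 h2 =>
      emits_forLoop_emit (by omega) (fun r _ hr => ?_) (by simp; omega) ?_ hnW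
    · refine hctx.reg_const r ?_
      simp only [List.mem_cons, List.not_mem_nil, or_false] at hr
      omega
    · refine ((hctx.of_agree h1 hR.1).of_agree h2 hR.1).reg_const r ?_
      simp only [List.mem_cons, List.not_mem_nil, or_false] at hr
      omega
    · rw [h2.2 rn (by omega), h1.2 rn (by omega), hn]
  · simp only [exWords, List.append_assoc]

/-- The words of the formula for the transitions. The register `o < 2` selects the matrix. -/
def dtProg (o : ℕ) : Prog :=
  conjProg 20 10 o 2 (.seq (emit [7, 6, 3, 2, 20, 2, 20, 2, 20]) (.seq (.add 23 12 20)
    (conjProg' 24 9 21 11 (.seq (.add 29 10 24)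
      (emit [7, 7, 6, 3, 2, 29, 2, 29, 2, 29, 7, 7, 6, 2, 29, 2, 23, 4, 4, 4])))))

/-- The words of the formula for the places. The register `o < 2` selects the matrix, and
`b < 2` is the tag for the variables of the marking. -/
def mkProg (o b : ℕ) : Prog :=
  conjProg 20 9 o 11 (.seq (.add 23 10 20)
    (.seq (emit [7, 6, 3, 2, 23, 2, 23, 2, 23, 7, 7, 6, 3, b, 20, b, 20, b, 20, 4])
    (disjProg' 24 10 21 2 (.seq (.add 29 12 24)
      (emit [7, 7, 6, 3, 2, 24, 2, 24, 2, 24, 7, 6, 2, 23, 2, 29, 4, 4])))))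

/-- The outer loop runs over the columns, so the address in the inner loop advances by the length of
a row. -/
theorem emits_dtProg {o : ℕ} (hctx : Ctx W inp np nt M s) (ho : o < 2) :
    Emits W inp 20 (dtProg o) s (dtWords np nt (M o)) (12 + nt * (40 + np * 46)) := by
  have hbound := hctx.bound
  have hc := hctx.reg_const
  refine EmitsTo.congr (emits_conjProg (t := fun _ => 10 + (12 + np * (22 + 24) + 1)) hctx
    (by omega) hctx.reg_nt (hc o (by omega)) (hc 2 (by omega)) (by omega) (by omega)
    fun t ht s1 h1 e1 e1' => ?_) rfl ?_
  · refine Emits.seq (emits_emit ?_) fun s2 h2 => emits_add (by omega) ?_ fun s3 h3 e3 =>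
      Emits.mono (R' := 24) (emits_conjProg' (b := o + t * 2) (d := 2 * nt) (n := np)
        (((hctx.of_agree h1 (by omega)).of_agree h2 (by omega)).of_agree h3 (by omega)) (by omega)
        ?_ ?_ ?_ (by omega) (by omega) ?_ fun p hp s4 h4 e4 => ?_) (by omega)
    · simp [h1.2, e1, hc, posWords]
    · simp only [h2.2, h1.2, e1, hctx.reg_sum, Nat.reduceLT, Nat.reduceAdd]
      omega
    · simp [h3.2, h2.2, h1.2, hctx.reg_np]
    · simpa [h3.2, h2.2] using e1'
    · simp [h3.2, h2.2, h1.2, hctx.reg_stride]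
    · intro p hp
      rw [h3.1, h2.1, h1.1, add_right_comm]
      exact hctx.entry o ho p hp t ht
    · refine emits_add (c := 21) (by omega) ?_ fun s5 h5 e5 =>
        Emits.mono (R' := 30) (emits_emit ?_) (by omega)
      · simp only [h4.2, h3.2, h2.2, h1.2, e4, hctx.reg_nt, Nat.reduceLT, Nat.reduceAdd]
        omega
      · simp [e5, h5.2, h4.2, e4, e3, h3.2, h2.2, h1.2, e1, hctx.reg_nt, hctx.reg_sum, hc,
          posWords]
  · simp only [Finset.sum_const, Finset.card_range, smul_eq_mul]
    refine Nat.add_le_add_left (Nat.mul_le_mul_left _ ?_) _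
    omega

theorem emits_mkProg {o b : ℕ} (hctx : Ctx W inp np nt M s) (ho : o < 2) (hb : b < 2) :
    Emits W inp 20 (mkProg o b) s (mkWords np nt (M o) b) (12 + np * (44 + nt * 33)) := by
  have hbound := hctx.bound
  have hc := hctx.reg_const
  refine EmitsTo.congr (emits_conjProg (t := fun _ => (21 + (4 + nt * (((20 + 5) + 4) + 4) + 2)) + 1)
    (f := fun p => ([7] ++ posWords (nt + p) ++ [7, 7, 6, 3, b, p, b, p, b, p, 4]) ++
      disjWords' (M o p) nt fun t => [7, 7] ++ posWords t ++ [7, 6, 2, nt + p, 2, nt + np + t, 4, 4])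
    hctx (by omega) hctx.reg_np (hc o (by omega)) hctx.reg_stride (by omega) (by omega)
    fun p hp s1 h1 e1 e1' => ?_) ?_ ?_
  · have hrow := row_le (np := np) (nt := nt) hp le_rfl
    refine emits_add le_rfl ?_ fun s2 h2 e2 => Emits.mono (R' := 24) ?_ (by omega)
    · simp only [h1.2, e1, hctx.reg_nt, Nat.reduceLT]
      omega
    refine Emits.seq (c := 21) (emits_emit ?_) fun s3 h3 => emits_disjProg' (t := 20)
      (b := o + p * (2 * nt)) (d := 2) (n := nt)
      (((hctx.of_agree h1 (by omega)).of_agree h2 (by omega)).of_agree h3 (by omega)) (by omega)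
      ?_ ?_ ?_ (by omega) (by omega) ?_ fun t ht s4 h4 e4 => ?_
    · have hb20 : b < 20 := by omega
      have hb23 : b < 23 := by omega
      have hb8 : b ≤ 8 := by omega
      simp [e2, h2.2, h1.2, e1, hc, hctx.reg_nt, posWords, hb20, hb23, hb8]
    · simp [h3.2, h2.2, h1.2, hctx.reg_nt]
    · simpa [h3.2, h2.2] using e1'
    · simp [h3.2, h2.2, h1.2, hc]
    · intro t ht
      rw [h3.1, h2.1, h1.1]
      exact hctx.entry o ho p hp t ht
    · refine emits_add (c := 19) (by omega) ?_ fun s5 h5 e5 =>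
        Emits.mono (R' := 30) (emits_emit ?_) (by omega)
      · simp only [h4.2, h3.2, h2.2, h1.2, e4, hctx.reg_sum, Nat.reduceLT]
        omega
      · simp [e5, h5.2, h4.2, e4, h3.2, e2, h2.2, h1.2, e1, hctx.reg_nt, hctx.reg_sum, hc,
          posWords]
  · simp only [mkWords, List.append_assoc]
  · simp only [Finset.sum_const, Finset.card_range, smul_eq_mul]
    refine Nat.add_le_add_left (Nat.mul_le_mul_left _ ?_) _
    omega

/-- The words of the formula for the firing set of the net with backward matrix `o` and forward
matrix `o'`. -/
def fsProg (o o' b : ℕ) : Prog :=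
  exProg 20 12 (.seq (emit [7, 7]) (.seq (dtProg o) (.seq (emit [7]) (.seq (mkProg o' b)
    (emit [4, 4])))))

theorem emits_fsProg {o o' b : ℕ} (hctx : Ctx W inp np nt M s) (ho : o < 2) (ho' : o' < 2)
    (hb : b < 2) : Emits W inp 20 (fsProg o o' b) s (fsWords np nt (M o) (M o') b)
      (50 + 60 * np + 60 * nt + 79 * (np * nt)) := by
  have hbound := hctx.bound
  refine EmitsTo.congr (emits_exProg (n := nt + np) (t := 3 + ((12 + nt * (40 + np * 46)) +
      (2 + ((12 + np * (44 + nt * 33)) + 3)))) (l := [7, 7] ++ (dtWords np nt (M o) ++ ([7] ++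
      (mkWords np nt (M o') b ++ [4, 4])))) hctx (by omega) hctx.reg_sum (by omega)
      fun s1 h1 => ?_) ?_ ?_
  · have hctx1 := hctx.of_agree h1 (by omega)
    refine Emits.seq (emits_emit (hctx1.map_reg (by simp))) fun s2 h2 => ?_
    have hctx2 := hctx1.of_agree h2 (by omega)
    refine Emits.seq (emits_dtProg hctx2 ho) fun s3 h3 => ?_
    have hctx3 := hctx2.of_agree h3 (by omega)
    refine Emits.seq (emits_emit (hctx3.map_reg (by simp))) fun s4 h4 => ?_
    have hctx4 := hctx3.of_agree h4 (by omega)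
    refine Emits.seq (emits_mkProg hctx4 ho' hb) fun s5 h5 => ?_
    exact emits_emit ((hctx4.of_agree h5 (by omega)).map_reg (by simp))
  · simp only [fsWords, add_comm nt np, List.append_assoc]
  · have h1 : nt * (40 + np * 46) = 40 * nt + 46 * (np * nt) := by ring
    have h2 : np * (44 + nt * 33) = 44 * np + 33 * (np * nt) := by ring
    omega

/-- The words of the formula for reachability. -/
def reachProg : Prog :=
  exProg 20 10 (.seq (emit [7, 7]) (.seq (conjProg 20 9 0 11 rowProg) (.seq (emit [7, 7, 7])
    (.seq (fsProg 0 1 0) (.seq (emit [7]) (.seq (fsProg 1 0 1) (emit [4, 4, 4, 4])))))))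

theorem emits_reachProg (hctx : Ctx W inp np nt M s) :
    Emits W inp 20 reachProg s (reachWords np nt (M 0) (M 1))
      (150 + 240 * np + 140 * nt + 160 * (np * nt) + 100 * ∑ p ∈ Finset.range np,
        ∑ t ∈ Finset.range nt, (2 + (M 0 p t).size + (M 1 p t).size)) := by
  have hbound := hctx.bound
  refine EmitsTo.congr (emits_exProg (n := nt) (t := 3 + ((12 + ∑ p ∈ Finset.range np,
      (100 + 100 * ∑ t ∈ Finset.range nt, (2 + (M 0 p t).size + (M 1 p t).size) + 16)) +
      (4 + ((50 + 60 * np + 60 * nt + 79 * (np * nt)) +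
      (2 + ((50 + 60 * np + 60 * nt + 79 * (np * nt)) + 5))))))
      (l := [7, 7] ++ (conjWords np (rowWords nt (M 0) (M 1)) ++ ([7, 7, 7] ++
      (fsWords np nt (M 0) (M 1) 0 ++ ([7] ++ (fsWords np nt (M 1) (M 0) 1 ++ [4, 4, 4, 4]))))))
      hctx (by omega) hctx.reg_nt (by omega) fun s1 h1 => ?_) ?_ ?_
  · have hctx1 := hctx.of_agree h1 (by omega)
    refine Emits.seq (emits_emit (hctx1.map_reg (by simp))) fun s2 h2 => ?_
    have hctx2 := hctx1.of_agree h2 (by omega)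
    refine Emits.seq (emits_conjProg hctx2 (by omega) hctx2.reg_np (hctx2.reg_const 0 (by omega))
      hctx2.reg_stride (by omega) (by omega) fun p hp s3 h3 e3 e3' =>
      emits_rowProg (hctx2.of_agree h3 (by omega)) hp e3 e3') fun s3 h3 => ?_
    have hctx3 := hctx2.of_agree h3 (by omega)
    refine Emits.seq (emits_emit (hctx3.map_reg (by simp))) fun s4 h4 => ?_
    have hctx4 := hctx3.of_agree h4 (by omega)
    refine Emits.seq (emits_fsProg hctx4 (by omega) (by omega) (by omega)) fun s5 h5 => ?_
    have hctx5 := hctx4.of_agree h5 (by omega)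
    refine Emits.seq (emits_emit (hctx5.map_reg (by simp))) fun s6 h6 => ?_
    have hctx6 := hctx5.of_agree h6 (by omega)
    refine Emits.seq (emits_fsProg hctx6 (by omega) (by omega) (by omega)) fun s7 h7 => ?_
    exact emits_emit ((hctx6.of_agree h7 (by omega)).map_reg (by simp))
  · simp [reachWords]
  · have (g : ℕ → ℕ) : ∑ p ∈ Finset.range np, (100 + 100 * g p + 16) =
        116 * np + 100 * ∑ p ∈ Finset.range np, g p := by
      rw [Finset.mul_sum, Finset.sum_add_distrib, Finset.sum_add_distrib]
      simp only [Finset.sum_const, Finset.card_range, smul_eq_mul]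
      ring
    rw [this]
    omega

/-! ### The table of positions -/

/-- The entries of the two matrices in the order in which they stand in the input. -/
def entries (np nt : ℕ) (M : ℕ → ℕ → ℕ → ℕ) : List ℕ :=
  (List.range np).flatMap fun p => (List.range nt).flatMap fun t => [M 0 p t, M 1 p t]

theorem length_flatMap_range_const {β : Type} {n m : ℕ} {f : ℕ → List β}
    (hf : ∀ i, (f i).length = m) : ((List.range n).flatMap f).length = n * m := by
  rw [length_flatMap_range]
  simp [hf]

theorem getElem?_flatMap_range {β : Type} {n m i j : ℕ} {f : ℕ → List β}
    (hf : ∀ i, (f i).length = m) (hi : i < n) (hj : j < m) :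
    ((List.range n).flatMap f)[i * m + j]? = (f i)[j]? := by
  induction n generalizing i f with
  | zero => omega
  | succ n ih =>
    rw [flatMap_range_succ']
    cases i with
    | zero => rw [zero_mul, zero_add, List.getElem?_append_left (by rw [hf]; exact hj)]
    | succ i =>
      have h1 : (i + 1) * m + j = m + (i * m + j) := by ring
      rw [h1, List.getElem?_append_right (by rw [hf]; omega), hf, Nat.add_sub_cancel_left]
      exact ih (f := fun i => f (i + 1)) (fun i => hf (i + 1)) (by omega)

theorem length_entries : (entries np nt M).length = np * (2 * nt) := by
  refine length_flatMap_range_const fun p => ?_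
  rw [length_flatMap_range_const (m := 2) fun t => rfl, mul_comm]

theorem getElem?_entries {o p t : ℕ} (ho : o < 2) (hp : p < np) (ht : t < nt) :
    (entries np nt M)[o + p * (2 * nt) + t * 2]? = some (M o p t) := by
  have h1 : o + p * (2 * nt) + t * 2 = p * (nt * 2) + (t * 2 + o) := by ring
  rw [h1, entries, getElem?_flatMap_range (m := nt * 2)
    (fun p => length_flatMap_range_const fun t => rfl) hp (by omega),
    getElem?_flatMap_range (m := 2) (fun t => rfl) ht ho]
  interval_cases o <;> rfl

/-- The position in the input at which the code of the `e`-th number begins; the first two words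
are the numbers of places and transitions. -/
def position (l : List ℕ) (e : ℕ) : ℕ := 2 + ((l.take e).flatMap PetriNet.natCode).length

theorem entry_position {l : List ℕ} {e a x y : ℕ} (h : l[e]? = some a)
    (hinp : inp = x :: y :: l.flatMap PetriNet.natCode) : Entry inp (position l e) a := by
  have h1 : l = l.take e ++ a :: l.drop (e + 1) := by
    obtain ⟨he, rfl⟩ := List.getElem?_eq_some_iff.1 h
    rw [List.getElem_cons_drop, List.take_append_drop]
  have h2 : position l e =
      (x :: y :: (l.take e).flatMap PetriNet.natCode).length := by
    simp only [position, List.length_cons]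
    omega
  rw [h2]
  refine entry_of_eq_append (l₂ := (l.drop (e + 1)).flatMap PetriNet.natCode) ?_
  rw [hinp]
  conv_lhs => rw [h1]
  simp

theorem position_succ {l : List ℕ} {e a : ℕ} (h : l[e]? = some a) :
    position l (e + 1) = a.size + 1 + position l e := by
  have hlen : (PetriNet.natCode a).length = a.size + 1 := by
    simp [PetriNet.natCode, Nat.size_eq_bits_len]
  rw [position, position, List.take_add_one, h]
  simp [hlen]
  omega

/-- Puts the constants into the registers `1` to `8`, and reads the numbers of places and
transitions. -/
def initProg (q : Prog) : Prog :=
  .seq (.const 1 1) (.seq (.const 2 2) (.seq (.const 3 3) (.seq (.const 4 4) (.seq (.const 5 5)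
    (.seq (.const 6 6) (.seq (.const 7 7) (.seq (.const 8 8) (.seq (.input 9 0) (.seq (.input 10 1)
    (.seq (.add 11 10 10) (.seq (.add 12 10 9) (.seq (.add 13 10 1) (.seq (.add 14 10 2)
    (.seq (.const 15 0) q))))))))))))))

theorem emitsTo_initProg {q : Prog} {Q : State → Prop} {l : List ℕ} {c : ℕ}
    (h0 : inp.getD 0 0 = np) (h1 : inp.getD 1 0 = nt) (hW : 2 * nt + np + 8 ≤ W)
    (h : ∀ s, (∀ r ≤ 8, s.reg r = r) → s.reg 9 = np → s.reg 10 = nt → s.reg 11 = 2 * nt →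
      s.reg 12 = nt + np → s.reg 13 = nt + 1 → s.reg 14 = nt + 2 → s.reg 15 = 0 → s.out = [] →
      EmitsTo W inp q s Q l c) :
    EmitsTo W inp (initProg q) State.start Q l (c + 15) := by
  have hz : State.start.reg 0 = 0 := rfl
  refine emitsTo_setReg (.const (by omega)) fun s1 ⟨_, a1⟩ e1 o1 => ?_
  refine emitsTo_setReg (.const (by omega)) fun s2 ⟨_, a2⟩ e2 o2 => ?_
  refine emitsTo_setReg (.const (by omega)) fun s3 ⟨_, a3⟩ e3 o3 => ?_
  refine emitsTo_setReg (.const (by omega)) fun s4 ⟨_, a4⟩ e4 o4 => ?_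
  refine emitsTo_setReg (.const (by omega)) fun s5 ⟨_, a5⟩ e5 o5 => ?_
  refine emitsTo_setReg (.const (by omega)) fun s6 ⟨_, a6⟩ e6 o6 => ?_
  refine emitsTo_setReg (.const (by omega)) fun s7 ⟨_, a7⟩ e7 o7 => ?_
  refine emitsTo_setReg (.const (by omega)) fun s8 ⟨_, a8⟩ e8 o8 => ?_
  have hc : ∀ r ≤ 8, s8.reg r = r := by
    intro r hr
    interval_cases r
    · simp [a8, a7, a6, a5, a4, a3, a2, a1, hz]
    · simp [a8, a7, a6, a5, a4, a3, a2, e1]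
    · simp [a8, a7, a6, a5, a4, a3, e2]
    · simp [a8, a7, a6, a5, a4, e3]
    · simp [a8, a7, a6, a5, e4]
    · simp [a8, a7, a6, e5]
    · simp [a8, a7, e6]
    · simp [a8, e7]
    · exact e8
  have hp : inp.getD (s8.reg 0) 0 = np := by rw [hc 0 (by omega), h0]
  refine emitsTo_setReg (.input (by rw [hp]; omega)) fun s9 ⟨_, a9⟩ e9 o9 => ?_
  have ht : inp.getD (s9.reg 1) 0 = nt := by rw [a9 1 (by omega), hc 1 (by omega), h1]
  refine emitsTo_setReg (.input (by rw [ht]; omega)) fun s10 ⟨_, a10⟩ e10 o10 => ?_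
  rw [hp] at e9
  rw [ht] at e10
  refine emitsTo_setReg (.add (by rw [e10]; omega)) fun s11 ⟨_, a11⟩ e11 o11 => ?_
  refine emitsTo_setReg (.add ?_) fun s12 ⟨_, a12⟩ e12 o12 => ?_
  · simp only [a11, a10, e10, e9, Nat.reduceLT]
    omega
  refine emitsTo_setReg (.add ?_) fun s13 ⟨_, a13⟩ e13 o13 => ?_
  · simp only [a12, a11, a10, a9, e10, hc, Nat.reduceLT, Nat.reduceLeDiff]
    omega
  refine emitsTo_setReg (.add ?_) fun s14 ⟨_, a14⟩ e14 o14 => ?_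
  · simp only [a13, a12, a11, a10, a9, e10, hc, Nat.reduceLT, Nat.reduceLeDiff]
    omega
  refine emitsTo_setReg (.const (by omega)) fun s15 ⟨_, a15⟩ e15 o15 => ?_
  refine h s15 (fun r hr => ?_) ?_ ?_ ?_ ?_ ?_ ?_ e15 ?_
  · rw [a15 r (by omega), a14 r (by omega), a13 r (by omega), a12 r (by omega), a11 r (by omega),
      a10 r (by omega), a9 r (by omega), hc r hr]
  · simp [a15, a14, a13, a12, a11, a10, e9]
  · simp [a15, a14, a13, a12, a11, e10]
  · simp [a15, a14, a13, a12, e11, e10, two_mul]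
  · simp [a15, a14, a13, e12, a11, a10, e10, e9]
  · simp [a15, a14, e13, a12, a11, a10, a9, e10, hc]
  · simp [a15, e14, a13, a12, a11, a10, a9, e10, hc]
  · rw [o15, o14, o13, o12, o11, o10, o9, o8, o7, o6, o5, o4, o3, o2, o1]
    rfl

/-- The rule for a single instruction that changes one register and keeps all others. -/
theorem emitsTo_setReg_self {p : Prog} {r v : ℕ} (he : Exec W inp p s (s.setReg r v) 1) :
    EmitsTo W inp p s (fun s' => s'.mem = s.mem ∧ s'.reg r = v ∧
      ∀ r', r' ≠ r → s'.reg r' = s.reg r') [] 1 :=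
  ⟨_, 1, he, ⟨rfl, setReg_reg _ _ _, fun _ h => setReg_reg_of_ne _ _ h⟩,
    (List.append_nil _).symm, le_rfl⟩

theorem emitsTo_store {a b : ℕ} :
    EmitsTo W inp (.store a b) s (fun s' => s'.mem = Function.update s.mem (s.reg a) (s.reg b) ∧
      s'.reg = s.reg) [] 1 :=
  ⟨_, 1, .store, ⟨rfl, rfl⟩, (List.append_nil _).symm, le_rfl⟩

/-- Puts the number of matrix entries into register `15`, and the positions of the entries in the
input into the memory, in the order of the input. -/
def tableProg : Prog :=
  .seq (forLoop 16 9 0 0 (.add 15 15 11)) (.seq (.add 16 2 0)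
    (forLoop 17 15 0 0 (.seq (.store 17 16) (.seq (.input 20 16) (.seq (.add 20 20 1)
      (.add 16 20 16))))))

/-- The table is built by following the lengths that begin the codes of the numbers; the number of
these codes, `np * (2 * nt)`, is found by repeated addition. -/
theorem emitsTo_tableProg {l : List ℕ} {x y : ℕ} (h0 : s.reg 0 = 0) (h1 : s.reg 1 = 1)
    (h2 : s.reg 2 = 2) (h9 : s.reg 9 = np) (h11 : s.reg 11 = 2 * nt) (h15 : s.reg 15 = 0)
    (hl : l.length = np * (2 * nt)) (hinp : inp = x :: y :: l.flatMap PetriNet.natCode)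
    (hW : np * (2 * nt) + np + inp.length ≤ W) :
    EmitsTo W inp tableProg s (fun s' => (∀ r < 15, s'.reg r = s.reg r) ∧
      ∀ e < l.length, s'.mem e = position l e) [] (20 + 5 * np + 9 * (np * (2 * nt))) := by
  have hlen : 2 ≤ inp.length := by simp [hinp]
  refine EmitsTo.congr (l := (List.range np).flatMap (fun _ => []) ++
      (List.range (np * (2 * nt))).flatMap (fun _ => []))
    (c := (4 + ∑ _i ∈ Finset.range np, (1 + 4)) +
      ((4 + ∑ _i ∈ Finset.range (np * (2 * nt)), ((1 + (1 + 1 + 1 + 1)) + 4)) + 1)) ?_ (by simp) ?_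
  · refine EmitsTo.seq (emitsTo_forLoop (b := 0) (d := 0)
      (K := fun i s' => (∀ r < 15, s'.reg r = s.reg r) ∧ s'.reg 15 = i * (2 * nt))
      (fun i s' s'' hK h => ?_) (by omega) h9 h0 (fun i s' hK => ?_) (by omega) (by omega) ?_
      fun i hi s1 hK e e' => ?_) fun s1 ⟨k1, k2⟩ => ?_
    · exact ⟨fun r hr => (h.2 r (by omega)).trans (hK.1 r hr), (h.2 15 (by omega)).trans hK.2⟩
    · exact ⟨(hK.1 1 (by omega)).trans h1, (hK.1 0 (by omega)).trans h0⟩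
    · exact ⟨fun r _ => rfl, by rw [h15, zero_mul]⟩
    · have hsum : s1.reg 15 + s1.reg 11 = (i + 1) * (2 * nt) := by
        rw [hK.2, hK.1 11 (by omega), h11]
        ring
      have hle : (i + 1) * (2 * nt) ≤ np * (2 * nt) := Nat.mul_le_mul_right _ hi
      refine (emitsTo_setReg_self (.add (by omega))).weaken (fun s2 ⟨_, f1, f2⟩ => ?_) rfl le_rfl
      refine ⟨⟨fun r hr => ?_, by rw [f1, hsum]⟩, f2 _ (by omega), f2 _ (by omega), f2 _ (by omega)⟩
      rw [f2 r (by omega), hK.1 r hr]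
    · have g (r : ℕ) (hr : r < 15) := k1 r hr
      refine emitsTo_setReg (.add (by rw [g 2 (by omega), g 0 (by omega), h2, h0]; omega))
        fun s2 ⟨_, a2⟩ e2 _ => ?_
      have e2' : s2.reg 16 = position l 0 := by
        rw [e2, g 2 (by omega), g 0 (by omega), h2, h0]
        simp [position]
      have g2 (r : ℕ) (hr : r < 15) : s2.reg r = s.reg r := (a2 r (by omega)).trans (g r hr)
      refine EmitsTo.weaken (emitsTo_forLoop (n := np * (2 * nt)) (b := 0) (d := 0)
        (K := fun e s' => (∀ r < 15, s'.reg r = s.reg r) ∧ s'.reg 16 = position l e ∧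
          ∀ e' < e, s'.mem e' = position l e')
        (fun i s' s'' hK h => ?_) (by omega) ?_ ?_ (fun i s' hK => ?_) (by omega) (by omega) ?_
        fun e he s3 hK f f' => ?_) (fun s3 hK => ⟨hK.1, by rw [hl]; exact hK.2.2⟩) rfl le_rfl
      · exact ⟨fun r hr => (h.2 r (by omega)).trans (hK.1 r hr),
          (h.2 16 (by omega)).trans hK.2.1, fun e he => by rw [h.1, hK.2.2 e he]⟩
      · rw [a2 15 (by omega), k2]
      · rw [g2 0 (by omega), h0]
      · exact ⟨(hK.1 1 (by omega)).trans h1, (hK.1 0 (by omega)).trans h0⟩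
      · exact ⟨g2, e2', fun _ he => absurd he (Nat.not_lt_zero _)⟩
      · obtain ⟨a, ha⟩ : ∃ a, l[e]? = some a := ⟨_, List.getElem?_eq_getElem (by omega)⟩
        have hent := entry_position ha hinp
        have hsize := hent.2.2
        refine EmitsTo.seq (l := []) (l' := []) emitsTo_store fun s4 ⟨m4, r4⟩ => ?_
        have f4 : inp.getD (s4.reg 16) 0 = a.size := by rw [r4, hK.2.1, hent.1]
        refine emitsTo_setReg (.input (by rw [f4]; omega)) fun s5 ⟨m5, a5⟩ e5 _ => ?_
        rw [f4] at e5
        have f5 : s5.reg 1 = 1 := by rw [a5 1 (by omega), r4, hK.1 1 (by omega), h1]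
        refine emitsTo_setReg (.add (by omega)) fun s6 ⟨m6, a6⟩ e6 _ => ?_
        rw [e5, f5] at e6
        have f6 : s6.reg 20 + s6.reg 16 = position l (e + 1) := by
          rw [e6, a6 16 (by omega), a5 16 (by omega), r4, hK.2.1, position_succ ha]
        refine (emitsTo_setReg_self (.add ?_)).weaken (fun s7 ⟨m7, x1, x2⟩ => ?_) rfl (by omega)
        · rw [f6, position_succ ha]
          omega
        have x (r : ℕ) (hr : r < 20) (hr' : r ≠ 16) : s7.reg r = s3.reg r := by
          rw [x2 r hr', a6 r hr, a5 r hr, r4]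
        refine ⟨⟨fun r hr => ?_, by rw [x1, f6], fun e' he' => ?_⟩, x 17 (by omega) (by omega),
          x 18 (by omega) (by omega), x 19 (by omega) (by omega)⟩
        · rw [x r (by omega) (by omega), hK.1 r hr]
        · rw [m7, m6, m5, m4, f, hK.2.1]
          rcases Nat.lt_succ_iff_lt_or_eq.1 he' with h | rfl
          · rw [Function.update_of_ne h.ne, hK.2.2 e' h]
          · rw [Function.update_self]
  · simp only [Finset.sum_const, Finset.card_range, smul_eq_mul]
    omega

/-! ### The whole program -/

/-- The program that writes the formula for reachability of a net. -/
def formulaProg : Prog := initProg (.seq tableProg reachProg)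

theorem emitsTo_formulaProg
    (hinp : inp = np :: nt :: (entries np nt M).flatMap PetriNet.natCode)
    (hW : np * (2 * nt) + inp.length + 4 * nt + 2 * np + 20 ≤ W) :
    EmitsTo W inp formulaProg State.start (fun _ => True) (reachWords np nt (M 0) (M 1))
      (200 + 250 * np + 150 * nt + 200 * (np * nt) + 100 * ∑ p ∈ Finset.range np,
        ∑ t ∈ Finset.range nt, (2 + (M 0 p t).size + (M 1 p t).size)) := by
  have hlen := length_entries (np := np) (nt := nt) (M := M)
  have hmul : np * (2 * nt) = 2 * (np * nt) := by ring
  refine (emitsTo_initProg (np := np) (nt := nt) (Q := fun _ => True)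
    (l := [] ++ reachWords np nt (M 0) (M 1))
    (c := (20 + 5 * np + 9 * (np * (2 * nt))) + (150 + 240 * np + 140 * nt + 160 * (np * nt) +
      100 * ∑ p ∈ Finset.range np, ∑ t ∈ Finset.range nt,
        (2 + (M 0 p t).size + (M 1 p t).size)))
    (by rw [hinp]; rfl) (by rw [hinp]; rfl) (by omega)
    fun s hc h9 h10 h11 h12 h13 h14 h15 _ => ?_).congr rfl (by omega)
  refine EmitsTo.seq (emitsTo_tableProg (np := np) (nt := nt) (hc 0 (by omega)) (hc 1 (by omega))
    (hc 2 (by omega)) h9 h11 h15 hlen hinp (by omega)) fun s' ⟨h1, h2⟩ => ?_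
  refine (emits_reachProg (W := W) (inp := inp) (np := np) (nt := nt) (M := M) (s := s') ?_).weaken
    (fun _ _ => trivial) rfl le_rfl
  refine ⟨fun r hr => ?_, ?_, ?_, ?_, ?_, ?_, ?_, fun o ho p hp t ht => ?_, hW⟩
  · rw [h1 r (by omega), hc r hr]
  · rw [h1 9 (by omega), h9]
  · rw [h1 10 (by omega), h10]
  · rw [h1 11 (by omega), h11]
  · rw [h1 12 (by omega), h12]
  · rw [h1 13 (by omega), h13]
  · rw [h1 14 (by omega), h14]
  · have hget := getElem?_entries (M := M) ho hp ht
    obtain ⟨hlt, -⟩ := List.getElem?_eq_some_iff.1 hget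
    rw [h2 _ hlt]
    exact entry_position hget hinp

theorem code_eq {np nt : ℕ} (N : PetriNet (Fin np) (Fin nt)) :
    N.code = np :: nt :: (entries np nt fun o =>
      if o = 0 then extend N.pre else extend N.post).flatMap PetriNet.natCode := by
  have h1 (p : Fin np) : ((List.finRange nt).flatMap fun t =>
      PetriNet.natCode (N.pre p t) ++ PetriNet.natCode (N.post p t)) =
      (List.range nt).flatMap fun t =>
        PetriNet.natCode (extend N.pre p t) ++ PetriNet.natCode (extend N.post p t) := by
    rw [← flatMap_finRange]
    simp only [extend_coe]
  rw [PetriNet.code]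
  simp only [h1]
  rw [flatMap_finRange np fun p => (List.range nt).flatMap fun t =>
    PetriNet.natCode (extend N.pre p t) ++ PetriNet.natCode (extend N.post p t)]
  simp [entries, List.flatMap_assoc]

theorem length_code {np nt : ℕ} (N : PetriNet (Fin np) (Fin nt)) :
    N.code.length = 2 + ∑ p ∈ Finset.range np, ∑ t ∈ Finset.range nt,
      (2 + (extend N.pre p t).size + (extend N.post p t).size) := by
  have hlen (a : ℕ) : (PetriNet.natCode a).length = a.size + 1 := by
    simp [PetriNet.natCode, Nat.size_eq_bits_len]
  rw [code_eq, List.length_cons, List.length_cons]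
  have : ((entries np nt fun o => if o = 0 then extend N.pre else extend N.post).flatMap
      PetriNet.natCode) = (List.range np).flatMap fun p => (List.range nt).flatMap fun t =>
        PetriNet.natCode (extend N.pre p t) ++ PetriNet.natCode (extend N.post p t) := by
    simp [entries, List.flatMap_assoc]
  have hsum (p t : ℕ) : (extend N.pre p t).size + 1 + ((extend N.post p t).size + 1) =
      2 + (extend N.pre p t).size + (extend N.post p t).size := by omega
  rw [this]
  simp only [length_flatMap_range, List.length_append, hlen, hsum]
  omega

theorem exists_exec_formulaProg {np nt : ℕ} (N : PetriNet (Fin np) (Fin nt)) :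
    ∃ (s : State) (k : ℕ),
      Exec (500 * (N.inputLength + 1)) N.code formulaProg State.start s k ∧
      k ≤ 500 * (N.inputLength + 1) ∧ s.out = code (reachFormula N) := by
  set M : ℕ → ℕ → ℕ → ℕ := fun o => if o = 0 then extend N.pre else extend N.post with hM
  have hlen := length_code N
  set S := ∑ p ∈ Finset.range np, ∑ t ∈ Finset.range nt,
    (2 + (extend N.pre p t).size + (extend N.post p t).size) with hS
  have hnm : 2 * (np * nt) ≤ S := by
    have : ∑ _p ∈ Finset.range np, ∑ _t ∈ Finset.range nt, 2 ≤ S :=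
      Finset.sum_le_sum fun p _ => Finset.sum_le_sum fun t _ =>
        (Nat.le_add_right 2 _).trans (Nat.le_add_right _ _)
    simp only [Finset.sum_const, Finset.card_range, smul_eq_mul] at this
    linarith
  have hmul : np * (2 * nt) = 2 * (np * nt) := by ring
  have hL : N.inputLength = np + nt + N.code.length := rfl
  obtain ⟨s, k, h1, -, h2, h3⟩ := emitsTo_formulaProg (M := M)
    (W := 500 * (N.inputLength + 1)) (code_eq N) (by omega)
  refine ⟨s, k, h1, h3.trans ?_, ?_⟩
  · change 200 + 250 * np + 150 * nt + 200 * (np * nt) + 100 * S ≤ _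
    omega
  · rw [h2, code_reachFormula]
    rfl

end RAM

theorem proposition2 :
    -- correctness of the formula and of its parts
    (∀ (np nt : ℕ) (N : PetriNet (Fin np) (Fin nt)),
      AddGt.IsExistential (AddGt.reachFormula N) ∧
      (∀ m₀ m : Fin np → ℚ≥0,
        N.QReachable m₀ m ↔ (AddGt.reachFormula N).Realize (Sum.elim m₀ m)) ∧
      (∀ (w x : Fin np → ℚ≥0) (y : Fin nt → ℚ≥0),
        ((AddGt.eqnFormula N).Realize (Sum.elim w x) y ↔
          ∀ p, (x p : ℚ) = (∑ t, (N.incidence p t : ℚ) * (y t : ℚ)) + (w p : ℚ)) ∧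
        ((AddGt.fsFormula N Sum.inl).Realize (Sum.elim w x) y ↔
          Function.support y ∈ N.firingSet w) ∧
        ((AddGt.fsFormula N.reverse Sum.inr).Realize (Sum.elim w x) y ↔
          Function.support y ∈ N.reverse.firingSet x))) ∧
    -- linear size
    (∃ c : ℕ, ∀ (np nt : ℕ) (N : PetriNet (Fin np) (Fin nt)),
      (AddGt.code (AddGt.reachFormula N)).length ≤ c * (N.size + 1)) ∧
    -- linear time
    (∃ (prog : RAM.Prog) (c : ℕ), ∀ (np nt : ℕ) (N : PetriNet (Fin np) (Fin nt)),
      ∃ (s : RAM.State) (k : ℕ),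
        RAM.Exec (c * (N.inputLength + 1)) N.code prog RAM.State.start s k ∧
        k ≤ c * (N.inputLength + 1) ∧
        s.out = AddGt.code (AddGt.reachFormula N)) := by
  refine ⟨fun np nt N => ⟨AddGt.isExistential_reachFormula N,
      fun m₀ m => (AddGt.realize_reachFormula N m₀ m).symm, fun w x y => ⟨?_, ?_, ?_⟩⟩,
    ⟨119, fun np nt N => AddGt.length_code_reachFormula_le N⟩,
    ⟨RAM.formulaProg, 500, fun np nt N => RAM.exists_exec_formulaProg N⟩⟩
  · rw [AddGt.realize_eqnFormula]
    exact forall_congr' fun p => AddGt.state_eq_iff N w x y p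
  · exact AddGt.realize_fsFormula N Sum.inl (Sum.elim w x) y
  · exact AddGt.realize_fsFormula N.reverse Sum.inr (Sum.elim w x) y
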